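/- Let $n\ge 1$. All sequences $\vec f=\{f_j\}_{j\in\mathbf Z}$ below consist of tempered distributions on $\mathbf R^n$, $\|\cdot\|_{\ell^2}$ is the norm of $\ell^2(\mathbf Z)$ (with value $\infty$ for sequences that are not square summable), $\Phi_t(x)=t^{-n}\Phi(x/t)$, and $\|g\|_{L^{p,\infty}}=\sup_{s>0}s\,|\{x\in\mathbf R^n:\ |g(x)|>s\}|^{1/p}$. For a Schwartz function $\Phi$, $a,b>0$ and a positive integer $N$ put $$M(\vec f;\Phi)(x)=\sup_{t>0}\|\{(\Phi_t*f_j)(x)\}_j\|_{\ell^2},\qquad M_a^*(\vec f;\Phi)(x)=\sup_{t>0}\ \sup_{|y-x|\le at}\|\{(\Phi_t*f_j)(y)\}_j\|_{\ell^2},$$ $$M_b^{**}(\vec f;\Phi)(x)=\sup_{t>0}\sup_{y\in\mathbf R^n}\frac{\|\{(\Phi_t*f_j)(x-y)\}_j\|_{\ell^2}}{(1+t^{-1}|y|)^b},\qquad \mathcal M_N(\vec f\,)(x)=\sup_{\varphi\in\mathcal S(\mathbf R^n),\ \mathfrak N_N(\varphi)\le 1}M_1^*(\vec f;\varphi)(x),$$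 where $\mathfrak N_N(\varphi)=\int_{\mathbf R^n}(1+|x|)^N\sum_{|\alpha|\le N+1}|\partial^\alpha\varphi(x)|\,dx$. A tempered distribution $f$ is bounded if $\varphi*f\in L^\infty(\mathbf R^n)$ for every $\varphi\in\mathcal S(\mathbf R^n)$. The sequence $\vec f$ is bounded if it lies in $\mathcal S'(\mathbf R^n,\ell^2)$, that is, for some $C,M>0$ one has $\|\{\langle f_j,\varphi\rangle\}_j\|_{\ell^2}\le C\sum_{|\alpha|,|\beta|\le M}\sup_{y}|y^\beta\partial^\alpha\varphi(y)|$ for all $\varphi\in\mathcal S(\mathbf R^n)$, and if moreover $\|\{\varphi*f_j\}_j\|_{\ell^2}\in L^\infty(\mathbf R^n)$ for every $\varphi\in\mathcal S(\mathbf R^n)$. Let $P(x)=\Gamma(\frac{n+1}2)\,\pi^{-\frac{n+1}2}(1+|x|^2)^{-\frac{n+1}2}$ be the Poisson kernel and $P_t(x)=t^{-n}P(x/t)$. For a bounded distribution $f$, $P_t*f$ is the bounded continuous function that represents the distribution $\langle P_t*f,\psi\rangle=\int_{\mathbf R^n}(\widetilde\psi*f)(y)\,P_t(-y)\,dy$,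 $\widetilde\psi(x)=\psi(-x)$. For $0<p<\infty$, a sequence $\vec f$ of bounded distributions lies in $H^{p,\infty}(\mathbf R^n,\ell^2)$ if $M(\vec f;P)(x)=\sup_{t>0}\|\{(P_t*f_j)(x)\}_j\|_{\ell^2}$ lies in $L^{p,\infty}(\mathbf R^n)$, and $\|\vec f\,\|_{H^{p,\infty}(\mathbf R^n,\ell^2)}=\|M(\vec f;P)\|_{L^{p,\infty}}$; this quasi-norm is taken to be $\infty$ if some $f_j$ is not bounded. **Theorem.** The following hold. (a) There are a Schwartz function $\Phi$ on $\mathbf R^n$ with integral $1$ and a constant $C_1$ such that, for every $0<p<\infty$ and every sequence $\vec f$ of tempered distributions, $$\|M(\vec f;\Phi)\|_{L^{p,\infty}}\le C_1\,\|\vec f\,\|_{H^{p,\infty}(\mathbf R^n,\ell^2)}.$$ (b) For every $0<p<\infty$, $a>0$ and $\Phi\in\mathcal S(\mathbf R^n)$ with $\int\Phi\ne0$ there is a constant $C_2(n,p,a,\Phi)$ such that, for every sequence $\vec f$ of tempered distributions, $$\|M_a^*(\vec f;\Phi)\|_{L^{p,\infty}}\le C_2(n,p,a,\Phi)\,\|M(\vec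 f;\Phi)\|_{L^{p,\infty}}.$$ (c) For every $0<p<\infty$, $a>0$, $b>n/p$ and $\Phi\in\mathcal S(\mathbf R^n)$ there is a constant $C_3(n,p,a,b,\Phi)$ such that, for every sequence $\vec f$ of tempered distributions, $$\|M_b^{**}(\vec f;\Phi)\|_{L^{p,\infty}}\le C_3(n,p,a,b,\Phi)\,\|M_a^*(\vec f;\Phi)\|_{L^{p,\infty}}.$$ (d) For every $b>0$ and $\Phi\in\mathcal S(\mathbf R^n)$ with $\int\Phi\ne0$ there is a constant $C_4(b,\Phi)$, independent of $p$, such that, with $N=[b]+1$, for every $0<p<\infty$ and every sequence $\vec f$ of tempered distributions, $$\|\mathcal M_N(\vec f\,)\|_{L^{p,\infty}}\le C_4(b,\Phi)\,\|M_b^{**}(\vec f;\Phi)\|_{L^{p,\infty}}.$$ (e) For every positive integer $N$ there is a constant $C_5(n,N)$, independent of $p$, such that, for every $0<p<\infty$, every sequence $\vec f$ of tempered distributions with $\|\mathcal M_N(\vec f\,)\|_{L^{p,\infty}}<\infty$ is bounded, lies in $H^{p,\infty}(\mathbf R^n,\ell^2)$, and satisfies $$\|\vec f\,\|_{H^{p,\infty}(\mathbf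 R^n,\ell^2)}\le C_5(n,N)\,\|\mathcal M_N(\vec f\,)\|_{L^{p,\infty}}.$$ -/

import Mathlib

open MeasureTheory SchwartzMap
open scoped ENNReal NNReal LineDeriv BoundedContinuousFunction

noncomputable section

namespace WeakHardy

/-- Euclidean space `ℝⁿ`. -/
abbrev Rn (n : ℕ) := EuclideanSpace ℝ (Fin n)

/-- The `ℓ²(ℤ)` norm of a complex sequence, with value `∞` if it is not square summable. -/
def ell2 (c : ℤ → ℂ) : ℝ≥0∞ := (∑' j, ‖c j‖ₑ ^ 2) ^ (1 / 2 : ℝ)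

/-- The quasi-norm of weak `L^p`: `sup_{s > 0} s · |{x : g x > s}|^{1/p}`. -/
def weakLpNorm {n : ℕ} (p : ℝ) (g : Rn n → ℝ≥0∞) : ℝ≥0∞ :=
  ⨆ s : ℝ≥0, (s : ℝ≥0∞) * volume {x | (s : ℝ≥0∞) < g x} ^ (1 / p)

/-- Membership in `L^{p,∞}(ℝⁿ)`. -/
def MemWeakLp {n : ℕ} (p : ℝ) (g : Rn n → ℝ≥0∞) : Prop :=
  AEMeasurable g volume ∧ weakLpNorm p g < ∞

/-! ### Schwartz functions -/

/-- `φ_t(x) = t^{-n} φ(x / t)`. -/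
def dilate {n : ℕ} (t : {t : ℝ // 0 < t}) (φ : 𝓢(Rn n, ℂ)) : 𝓢(Rn n, ℂ) :=
  (((t : ℝ) ^ n)⁻¹ : ℝ) • SchwartzMap.compCLMOfContinuousLinearEquiv ℂ
    (ContinuousLinearEquiv.smulLeft (Units.mk0 (t : ℝ)⁻¹ (inv_ne_zero t.2.ne'))) φ

/-- `φ̃(x) = φ(-x)`. -/
def reflect {n : ℕ} (φ : 𝓢(Rn n, ℂ)) : 𝓢(Rn n, ℂ) :=
  SchwartzMap.compCLMOfContinuousLinearEquiv ℂ (ContinuousLinearEquiv.neg ℝ) φ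

theorem dilate_apply {n : ℕ} (t : {t : ℝ // 0 < t}) (φ : 𝓢(Rn n, ℂ)) (x : Rn n) :
    dilate t φ x = (((t : ℝ) ^ n)⁻¹ : ℝ) • φ ((t : ℝ)⁻¹ • x) := rfl

theorem reflect_apply {n : ℕ} (φ : 𝓢(Rn n, ℂ)) (x : Rn n) : reflect φ x = φ (-x) := rfl

/-- The mixed partial derivative `∂^α φ` for a multi-index `α`. -/
def mixedDeriv {n : ℕ} (α : Fin n → ℕ) (φ : 𝓢(Rn n, ℂ)) : 𝓢(Rn n, ℂ) :=
  (List.finRange n).foldr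
    (fun i g => (fun h : 𝓢(Rn n, ℂ) => ∂_{(EuclideanSpace.single i (1 : ℝ) : Rn n)} h)^[α i] g) φ

/-- The multi-indices of order at most `m`. -/
def multiIdx (n m : ℕ) : Finset (Fin n → ℕ) :=
  (Fintype.piFinset fun _ : Fin n => Finset.range (m + 1)).filter fun α => ∑ i, α i ≤ m

theorem mem_multiIdx {n m : ℕ} (α : Fin n → ℕ) : α ∈ multiIdx n m ↔ ∑ i, α i ≤ m := by
  simp only [multiIdx, Finset.mem_filter, Fintype.mem_piFinset, Finset.mem_range,
    and_iff_right_iff_imp]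
  intro h i
  have := Finset.single_le_sum (f := α) (fun i _ => Nat.zero_le _) (Finset.mem_univ i)
  omega

/-- `𝔑_N(φ) = ∫ (1 + |x|)^N ∑_{|α| ≤ N + 1} |∂^α φ(x)| dx`. -/
def frakN {n : ℕ} (N : ℕ) (φ : 𝓢(Rn n, ℂ)) : ℝ :=
  ∫ x, (1 + ‖x‖) ^ N * ∑ α ∈ multiIdx n (N + 1), ‖mixedDeriv α φ x‖

/-! ### Tempered distributions -/

/-- The function `(φ * f)(x) = ⟨f, φ(x - ·)⟩`, for `φ` Schwartz and `f` tempered. -/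
def conv {n : ℕ} (φ : 𝓢(Rn n, ℂ)) (f : 𝓢'(Rn n, ℂ)) (x : Rn n) : ℂ :=
  f (SchwartzMap.compSubConstCLM ℂ x (reflect φ))

/-- `f` is a bounded tempered distribution: `φ * f` is a bounded function for every Schwartz
function `φ`. (As `φ * f` is continuous, being in `L^∞` means being bounded everywhere.) -/
def IsBoundedDist {n : ℕ} (f : 𝓢'(Rn n, ℂ)) : Prop :=
  ∀ φ : 𝓢(Rn n, ℂ), ∃ C : ℝ, ∀ x, ‖conv φ f x‖ ≤ C

/-- The sequence of distributions lies in `𝓢'(ℝⁿ, ℓ²)`. -/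
def IsTemperedSeq {n : ℕ} (f : ℤ → 𝓢'(Rn n, ℂ)) : Prop :=
  ∃ (C : ℝ≥0) (M : ℕ), ∀ φ : 𝓢(Rn n, ℂ),
    ell2 (fun j => f j φ) ≤ C * ∑ α ∈ multiIdx n M, ∑ β ∈ multiIdx n M,
      ⨆ y : Rn n, ENNReal.ofReal ((∏ i, |y i| ^ β i) * ‖mixedDeriv α φ y‖)

/-- The sequence is a bounded sequence in `𝓢'(ℝⁿ, ℓ²)`: the function `‖{φ * f_j}_j‖_{ℓ²}` is
bounded for every Schwartz function `φ`. (This function is lower semicontinuous, so being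
essentially bounded means being bounded everywhere.) -/
def IsBoundedSeq {n : ℕ} (f : ℤ → 𝓢'(Rn n, ℂ)) : Prop :=
  IsTemperedSeq f ∧
    ∀ φ : 𝓢(Rn n, ℂ), ∃ C : ℝ≥0, ∀ x, ell2 (fun j => conv φ (f j) x) ≤ C

/-! ### Poisson integrals of bounded distributions -/

/-- The Poisson kernel `P(x) = Γ((n+1)/2) π^{-(n+1)/2} (1 + |x|²)^{-(n+1)/2}`. -/
def poissonKernel {n : ℕ} (x : Rn n) : ℝ :=
  Real.Gamma (((n : ℝ) + 1) / 2) / Real.pi ^ (((n : ℝ) + 1) / 2) /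
    (1 + ‖x‖ ^ 2) ^ (((n : ℝ) + 1) / 2)

/-- `P_t(x) = t^{-n} P(x / t)`. -/
def poissonKernelDil {n : ℕ} (t : {t : ℝ // 0 < t}) (x : Rn n) : ℝ :=
  ((t : ℝ) ^ n)⁻¹ * poissonKernel ((t : ℝ)⁻¹ • x)

/-- The bounded continuous function `u` is the convolution `P_t * f`. The convolution of an
integrable function `h` with a bounded distribution `f` is the distribution
`⟨h * f, ψ⟩ = ∫ (ψ̃ * f)(y) h(-y) dy`. -/
def IsPoissonConv {n : ℕ} (t : {t : ℝ // 0 < t}) (f : 𝓢'(Rn n, ℂ)) (u : Rn n →ᵇ ℂ) : Prop :=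
  ∀ ψ : 𝓢(Rn n, ℂ),
    ∫ x, u x * ψ x = ∫ y, conv (reflect ψ) f y * (poissonKernelDil t (-y) : ℂ)

open Classical in
/-- The function `P_t * f`, for a bounded distribution `f`: the bounded continuous function that
represents this distribution. It is unique, and it exists for every bounded `f`, so that the
fallback value is never used for a bounded `f`. -/
def poissonConv {n : ℕ} (t : {t : ℝ // 0 < t}) (f : 𝓢'(Rn n, ℂ)) : Rn n → ℂ :=
  if h : ∃ u : Rn n →ᵇ ℂ, IsPoissonConv t f u then ⇑h.choose else 0

/-! ### Maximal functions -/

/-- The smooth maximal function `M(f; Φ)(x) = sup_{t > 0} ‖{(Φ_t * f_j)(x)}_j‖_{ℓ²}`. -/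
def smoothMax {n : ℕ} (Φ : 𝓢(Rn n, ℂ)) (f : ℤ → 𝓢'(Rn n, ℂ)) (x : Rn n) : ℝ≥0∞ :=
  ⨆ t : {t : ℝ // 0 < t}, ell2 fun j => conv (dilate t Φ) (f j) x

/-- The nontangential maximal function `M*_a(f; Φ)` with aperture `a`. -/
def nontangMax {n : ℕ} (a : ℝ) (Φ : 𝓢(Rn n, ℂ)) (f : ℤ → 𝓢'(Rn n, ℂ)) (x : Rn n) : ℝ≥0∞ :=
  ⨆ t : {t : ℝ // 0 < t}, ⨆ y : Rn n, ⨆ _ : ‖y - x‖ ≤ a * t,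
    ell2 fun j => conv (dilate t Φ) (f j) y

/-- The auxiliary maximal function `M**_b(f; Φ)`. -/
def auxMax {n : ℕ} (b : ℝ) (Φ : 𝓢(Rn n, ℂ)) (f : ℤ → 𝓢'(Rn n, ℂ)) (x : Rn n) : ℝ≥0∞ :=
  ⨆ t : {t : ℝ // 0 < t}, ⨆ y : Rn n,
    ell2 (fun j => conv (dilate t Φ) (f j) (x - y)) /
      ENNReal.ofReal ((1 + (t : ℝ)⁻¹ * ‖y‖) ^ b)

/-- The grand maximal function `𝓜_N(f)`: the supremum of `M*_1(f; φ)` over the Schwartz functions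
`φ` with `𝔑_N(φ) ≤ 1`. -/
def grandMax {n : ℕ} (N : ℕ) (f : ℤ → 𝓢'(Rn n, ℂ)) (x : Rn n) : ℝ≥0∞ :=
  ⨆ φ : {φ : 𝓢(Rn n, ℂ) // frakN N φ ≤ 1}, nontangMax 1 (φ : 𝓢(Rn n, ℂ)) f x

/-- The Poisson maximal function `M(f; P)`, for a sequence of bounded distributions. -/
def poissonMax {n : ℕ} (f : ℤ → 𝓢'(Rn n, ℂ)) (x : Rn n) : ℝ≥0∞ :=
  ⨆ t : {t : ℝ // 0 < t}, ell2 fun j => poissonConv t (f j) x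

/-! ### The weak Hardy space -/

/-- `f` lies in `H^{p,∞}(ℝⁿ, ℓ²)`: every `f_j` is a bounded distribution and the Poisson maximal
function lies in `L^{p,∞}`. -/
def MemWeakHardy {n : ℕ} (p : ℝ) (f : ℤ → 𝓢'(Rn n, ℂ)) : Prop :=
  (∀ j, IsBoundedDist (f j)) ∧ MemWeakLp p (poissonMax f)

open Classical in
/-- The quasi-norm of `H^{p,∞}(ℝⁿ, ℓ²)`, with value `∞` for a sequence of tempered distributions
that are not all bounded, where the Poisson maximal function is not defined. -/
def weakHardyNorm {n : ℕ} (p : ℝ) (f : ℤ → 𝓢'(Rn n, ℂ)) : ℝ≥0∞ :=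
  if ∀ j, IsBoundedDist (f j) then weakLpNorm p (poissonMax f) else ∞

end WeakHardy

end

noncomputable section

namespace WeakHardy

variable {n : ℕ}

/-! ### The norm of `ℓ²` by duality -/

/-! The five bounds rest on three mechanisms: a reproducing formula, a covering argument, and two
ways of passing between the Poisson kernel and Schwartz functions. The `ℓ²` norm is always reached
by duality: a scalar bound, uniform over the distributions `∑ l_j f_j` with finitely many `l_j` of
`ℓ²` norm at most one, is a vector bound with the same constant.

Reproducing formula. Normalise `∫ Φ = 1` and put `D_s φ = φ - φ * Φ_s`. In weighted `L¹`, `D_s`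
gains a factor `s` and costs one derivative. Telescoping the powers `D_s^(N+1)` over `s = 2^{-k}`
writes `φ` as a sum of terms `θ_k * Φ_s`, with `s` one of `2^{-k}`, `2^{-k-1}` and the `k`-th
coefficient of size `2^{-kN}` times a Sobolev norm of `φ`. If `Φ_s * f` grows at most like `s^{-r}`
with `r < N`, the series converges and controls `φ_t * f`; this is `exists_enorm_conv_le`. It gives
(d) pointwise, hence with a constant free of `p`.

Covering. Let balls of radius `ct` about a set of points `(t, y)` lie in `E`. By Vitali, the points
`x` with `|y - x| ≤ At` form a set of measure at most `((2A + 3c)/c)^n |E|`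
(`volume_setOf_near_le`). Splitting the tangential supremum dyadically in `|y|/t` then proves (c):
the `k`-th level set costs `2^{kn}` and gains `2^{-kbp}`.

For (b), the reproducing formula applied to `Φ - Φ(· + h)`, whose Sobolev norm is small with `h`,
shows that `Φ_t * f(y)` changes over a ball of radius `ct` by at most `ε M**_b`. Where `M*_a > s`,
then, either `M**_b` exceeds a large multiple of `s`, on a set that (c) makes small enough to
absorb, or a whole ball lies in `{M > s/2}`, and the covering lemma applies. Absorption needs a
finite left side. This is secured by finitely many components and by weights damping `f` at infinity
and at small scales; a second run without weights makes the constant independent of `f`.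

For (e), a finite weak norm of the grand maximal function bounds `φ * f` everywhere, because each of
its values is a lower bound, up to a factor, on a unit ball. The Poisson kernel is a positive
superposition of Gaussians, `P_t = c ∫ e^{-μ²} γ_{t/μ} dμ`, so its maximal function is at most a
multiple of that of the Gaussian. To justify `P_t * f = c ∫ e^{-μ²} (γ_{t/μ} * f) dμ` one needs
bounds on `γ_s * f` that are uniform in `x`, polynomial in `1/s` and bounded for large `s`; they
follow from the uniform boundedness principle and the reproducing formula.

For (a), a series `∑ c_k P_{2^k}` is built that is itself a Schwartz function of nonzero integral.
Its coefficients come from the entire function `E(z) = ∏ (1 - 4^{-k} z)`: the zeros `E(4^i) = 0`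
cancel every term of the expansion of `∑ e_k (4^k + |x|²)^{-(n+1)/2}` at infinity, while `E(1/2) ≠
0` keeps the integral from vanishing. Since `∑ |c_k| < ∞`, its maximal function is pointwise at most
a constant times the Poisson one. -/

theorem enorm_sum_mul_le_ell2 (c l : ℤ → ℂ) (s : Finset ℤ) (hl : ∑ j ∈ s, ‖l j‖ ^ 2 ≤ 1) :
    ‖∑ j ∈ s, l j * c j‖ₑ ≤ ell2 c := by
  have h1 : ‖∑ j ∈ s, l j * c j‖ ^ 2 ≤ ∑ j ∈ s, ‖c j‖ ^ 2 := by
    have h2 : ‖∑ j ∈ s, l j * c j‖ ≤ ∑ j ∈ s, ‖l j‖ * ‖c j‖ := by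
      refine (norm_sum_le _ _).trans (le_of_eq ?_)
      simp
    have h3 := Finset.sum_mul_sq_le_sq_mul_sq s (fun j => ‖l j‖) (fun j => ‖c j‖)
    have h4 : (0 : ℝ) ≤ ∑ j ∈ s, ‖c j‖ ^ 2 := Finset.sum_nonneg fun _ _ => by positivity
    calc ‖∑ j ∈ s, l j * c j‖ ^ 2 ≤ (∑ j ∈ s, ‖l j‖ * ‖c j‖) ^ 2 := by gcongr
      _ ≤ _ := h3
      _ ≤ 1 * ∑ j ∈ s, ‖c j‖ ^ 2 := by gcongr
      _ = _ := one_mul _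
  have h5 : ‖∑ j ∈ s, l j * c j‖ₑ ^ 2 ≤ ∑' j, ‖c j‖ₑ ^ 2 := by
    refine le_trans ?_ (ENNReal.sum_le_tsum s)
    have : ∀ z : ℂ, ‖z‖ₑ ^ 2 = ENNReal.ofReal (‖z‖ ^ 2) := fun z => by
      rw [ENNReal.ofReal_pow (norm_nonneg _), ofReal_norm]
    simp only [this]
    rw [← ENNReal.ofReal_sum_of_nonneg (fun _ _ => by positivity)]
    exact ENNReal.ofReal_le_ofReal h1
  calc ‖∑ j ∈ s, l j * c j‖ₑ = (‖∑ j ∈ s, l j * c j‖ₑ ^ 2) ^ (1 / 2 : ℝ) := by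
        rw [← ENNReal.rpow_natCast, ← ENNReal.rpow_mul]; norm_num
    _ ≤ _ := ENNReal.rpow_le_rpow h5 (by norm_num)

/-- The extremal coefficients are the conjugates of `c j` divided by the norm of the partial
sequence. Only finite combinations are tested, so distributions can be combined without any
convergence question. -/
theorem ell2_le_of_forall {c : ℤ → ℂ} {B : ℝ≥0∞}
    (h : ∀ (s : Finset ℤ) (l : ℤ → ℂ), ∑ j ∈ s, ‖l j‖ ^ 2 ≤ 1 → ‖∑ j ∈ s, l j * c j‖ₑ ≤ B) :
    ell2 c ≤ B := by
  have key : ∑' j, ‖c j‖ₑ ^ 2 ≤ B ^ 2 := by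
    rw [ENNReal.tsum_eq_iSup_sum]
    refine iSup_le fun s => ?_
    set σ : ℝ := ∑ j ∈ s, ‖c j‖ ^ 2 with hσ
    have hσ0 : 0 ≤ σ := Finset.sum_nonneg fun _ _ => by positivity
    have e1 : ∑ j ∈ s, ‖c j‖ₑ ^ 2 = ENNReal.ofReal σ := by
      rw [hσ, ENNReal.ofReal_sum_of_nonneg (fun _ _ => by positivity)]
      refine Finset.sum_congr rfl fun j _ => ?_
      rw [ENNReal.ofReal_pow (norm_nonneg _), ofReal_norm]
    rw [e1]
    rcases hσ0.eq_or_lt with h0 | h0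
    · simp [← h0]
    have hs : 0 < √σ := Real.sqrt_pos.2 h0
    have h2 := h s (fun j => (starRingEnd ℂ) (c j) / (√σ : ℂ)) (by
      simp only [norm_div, RCLike.norm_conj, Complex.norm_real, Real.norm_eq_abs, div_pow, sq_abs,
        Real.sq_sqrt hσ0]
      rw [← Finset.sum_div, ← hσ, div_self h0.ne'])
    have e2 : ∑ j ∈ s, (starRingEnd ℂ) (c j) / (√σ : ℂ) * c j = ((√σ : ℝ) : ℂ) := by
      have : ∀ j, (starRingEnd ℂ) (c j) / (√σ : ℂ) * c j = ((‖c j‖ ^ 2 / √σ : ℝ) : ℂ) := by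
        intro j
        rw [div_mul_eq_mul_div, Complex.conj_mul']
        push_cast; rfl
      simp only [this]
      rw [← Complex.ofReal_sum, ← Finset.sum_div, ← hσ, Real.div_sqrt]
    rw [e2] at h2
    have e3 : ‖((√σ : ℝ) : ℂ)‖ₑ = ENNReal.ofReal (√σ) := by
      rw [← ofReal_norm, Complex.norm_real, Real.norm_of_nonneg hs.le]
    rw [e3] at h2
    calc ENNReal.ofReal σ = ENNReal.ofReal (√σ) ^ 2 := by
          rw [← ENNReal.ofReal_pow hs.le, Real.sq_sqrt hσ0]
      _ ≤ B ^ 2 := by gcongr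
  calc ell2 c ≤ (B ^ 2) ^ (1 / 2 : ℝ) := ENNReal.rpow_le_rpow key (by norm_num)
    _ = B := by rw [← ENNReal.rpow_natCast, ← ENNReal.rpow_mul]; norm_num

theorem ell2_mono {c d : ℤ → ℂ} (h : ∀ j, ‖c j‖ ≤ ‖d j‖) : ell2 c ≤ ell2 d := by
  refine ENNReal.rpow_le_rpow (ENNReal.tsum_le_tsum fun j => ?_) (by norm_num)
  gcongr
  exact enorm_le_iff_norm_le.2 (h j)

theorem ell2_le_add_of_norm_le {a b d : ℤ → ℂ} (h : ∀ j, a j = b j + d j) :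
    ell2 a ≤ ell2 b + ell2 d := by
  refine ell2_le_of_forall fun s l hl => ?_
  have : ∑ j ∈ s, l j * a j = ∑ j ∈ s, l j * b j + ∑ j ∈ s, l j * d j := by
    rw [← Finset.sum_add_distrib]
    exact Finset.sum_congr rfl fun j _ => by rw [h j, mul_add]
  rw [this]
  exact (enorm_add_le _ _).trans
    (add_le_add (enorm_sum_mul_le_ell2 b l s hl) (enorm_sum_mul_le_ell2 d l s hl))

theorem ell2_const_mul (a : ℂ) (c : ℤ → ℂ) : ell2 (fun j => a * c j) = ‖a‖ₑ * ell2 c := by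
  unfold ell2
  have : ∀ j, ‖a * c j‖ₑ ^ 2 = ‖a‖ₑ ^ 2 * ‖c j‖ₑ ^ 2 := fun j => by rw [enorm_mul, mul_pow]
  simp only [this]
  rw [ENNReal.tsum_mul_left, ENNReal.mul_rpow_of_nonneg _ _ (by norm_num),
    ← ENNReal.rpow_natCast, ← ENNReal.rpow_mul]
  norm_num

theorem enorm_le_ell2 (c : ℤ → ℂ) (j : ℤ) : ‖c j‖ₑ ≤ ell2 c := by
  simpa using enorm_sum_mul_le_ell2 c 1 {j} (by simp)

/-- The `ℓ²` norm is exhausted by finitely many terms. -/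
theorem exists_finset_lt_ell2 {c : ℤ → ℂ} {s : ℝ≥0∞} (h : s < ell2 c) :
    ∃ J : Finset ℤ, s < ell2 (fun j => if j ∈ J then c j else 0) := by
  by_contra! hc
  refine absurd (ell2_le_of_forall fun J l hl => ?_) h.not_ge
  refine le_trans (le_of_eq ?_)
    ((enorm_sum_mul_le_ell2 (fun j => if j ∈ J then c j else 0) l J hl).trans (hc J))
  congr 1
  exact Finset.sum_congr rfl fun j hj => by simp [hj]

/-! ### Weak `L^p` quasi-norms -/

theorem weakLpNorm_le_iff {p : ℝ} (hp : 0 < p) {g : Rn n → ℝ≥0∞} {A : ℝ≥0∞} :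
    weakLpNorm p g ≤ A ↔ ∀ s : ℝ≥0, (s : ℝ≥0∞) ^ p * volume {x | (s : ℝ≥0∞) < g x} ≤ A ^ p := by
  unfold weakLpNorm
  rw [iSup_le_iff]
  refine forall_congr' fun s => ?_
  rw [← ENNReal.rpow_le_rpow_iff hp, ENNReal.mul_rpow_of_nonneg _ _ hp.le, ← ENNReal.rpow_mul,
    one_div_mul_cancel hp.ne', ENNReal.rpow_one]

theorem volume_mul_le_weakLpNorm {p : ℝ} (hp : 0 < p) (g : Rn n → ℝ≥0∞) (s : ℝ≥0) :
    (s : ℝ≥0∞) ^ p * volume {x | (s : ℝ≥0∞) < g x} ≤ weakLpNorm p g ^ p :=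
  (weakLpNorm_le_iff hp).1 le_rfl s

theorem weakLpNorm_le_const_mul {p : ℝ} (hp : 0 < p) {g h : Rn n → ℝ≥0∞} {C : ℝ≥0}
    (H : ∀ x, g x ≤ C * h x) : weakLpNorm p g ≤ C * weakLpNorm p h := by
  rw [weakLpNorm_le_iff hp]
  intro s
  rcases eq_or_ne C 0 with rfl | hC
  · have : ∀ x, g x = 0 := fun x => by simpa using H x
    simp [this]
  have hsub : {x | (s : ℝ≥0∞) < g x} ⊆ {x | ((s / C : ℝ≥0) : ℝ≥0∞) < h x} := by
    intro x hx
    have h1 : (s : ℝ≥0∞) < C * h x := lt_of_lt_of_le hx (H x)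
    simp only [Set.mem_ofPred_eq, ENNReal.coe_div hC]
    rw [mul_comm] at h1
    exact ENNReal.div_lt_of_lt_mul h1
  calc (s : ℝ≥0∞) ^ p * volume {x | (s : ℝ≥0∞) < g x}
      ≤ (s : ℝ≥0∞) ^ p * volume {x | ((s / C : ℝ≥0) : ℝ≥0∞) < h x} := by gcongr
    _ = (C : ℝ≥0∞) ^ p * (((s / C : ℝ≥0) : ℝ≥0∞) ^ p *
          volume {x | ((s / C : ℝ≥0) : ℝ≥0∞) < h x}) := by
        rw [← mul_assoc, ← ENNReal.mul_rpow_of_nonneg _ _ hp.le, ← ENNReal.coe_mul,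
          mul_div_cancel₀ _ hC]
    _ ≤ (C : ℝ≥0∞) ^ p * weakLpNorm p h ^ p := by
        gcongr
        exact volume_mul_le_weakLpNorm hp h _
    _ = _ := (ENNReal.mul_rpow_of_nonneg _ _ hp.le).symm

theorem weakLpNorm_mono {p : ℝ} (hp : 0 < p) {g h : Rn n → ℝ≥0∞} (H : ∀ x, g x ≤ h x) :
    weakLpNorm p g ≤ weakLpNorm p h := by
  simpa using weakLpNorm_le_const_mul (C := 1) hp (by simpa using H)

/-- Weak `L^p` bounds pass to a function that is exhausted by a directed family. -/
theorem weakLpNorm_le_of_directed {p : ℝ} (hp : 0 < p) {ι : Type*} [Countable ι] [Nonempty ι]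
    {g : Rn n → ℝ≥0∞} {G : ι → Rn n → ℝ≥0∞} (hd : Directed (· ≤ ·) G) {A : ℝ≥0∞}
    (hG : ∀ i, weakLpNorm p (G i) ≤ A)
    (hg : ∀ x (s : ℝ≥0), (s : ℝ≥0∞) < g x → ∃ i, (s : ℝ≥0∞) < G i x) :
    weakLpNorm p g ≤ A := by
  rw [weakLpNorm_le_iff hp]
  intro s
  have hsub : {x | (s : ℝ≥0∞) < g x} ⊆ ⋃ i, {x | (s : ℝ≥0∞) < G i x} := fun x hx => by
    simpa using hg x s hx
  have hdir : Directed (· ⊆ ·) fun i => {x | (s : ℝ≥0∞) < G i x} := fun i j => by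
    obtain ⟨k, hi, hj⟩ := hd i j
    exact ⟨k, fun x hx => lt_of_lt_of_le hx (hi x), fun x hx => lt_of_lt_of_le hx (hj x)⟩
  calc (s : ℝ≥0∞) ^ p * volume {x | (s : ℝ≥0∞) < g x}
      ≤ (s : ℝ≥0∞) ^ p * volume (⋃ i, {x | (s : ℝ≥0∞) < G i x}) := by gcongr
    _ = ⨆ i, (s : ℝ≥0∞) ^ p * volume {x | (s : ℝ≥0∞) < G i x} := by
        -- Continuity from below along a countable directed family holds for arbitrary sets, so no
        -- measurability of the functions is needed.
        rw [hdir.measure_iUnion, ENNReal.mul_iSup]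
    _ ≤ A ^ p := iSup_le fun i => (weakLpNorm_le_iff hp).1 (hG i) s

/-! ### Change of aperture -/

/-- The nontangential supremum of a function on the upper half space. -/
def ntSup (a : ℝ) (g : {t : ℝ // 0 < t} → Rn n → ℝ≥0∞) (x : Rn n) : ℝ≥0∞ :=
  ⨆ t : {t : ℝ // 0 < t}, ⨆ y : Rn n, ⨆ _ : ‖y - x‖ ≤ a * t, g t y

/-- The tangential supremum of a function on the upper half space. -/
def auxSup (b : ℝ) (g : {t : ℝ // 0 < t} → Rn n → ℝ≥0∞) (x : Rn n) : ℝ≥0∞ :=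
  ⨆ t : {t : ℝ // 0 < t}, ⨆ y : Rn n, g t (x - y) / ENNReal.ofReal ((1 + (t : ℝ)⁻¹ * ‖y‖) ^ b)

theorem le_ntSup {a : ℝ} (g : {t : ℝ // 0 < t} → Rn n → ℝ≥0∞) {x y : Rn n} {t : {t : ℝ // 0 < t}}
    (h : ‖y - x‖ ≤ a * t) : g t y ≤ ntSup a g x :=
  le_iSup_of_le t (le_iSup_of_le y (le_iSup_of_le h le_rfl))

theorem lt_ntSup_iff {a : ℝ} (g : {t : ℝ // 0 < t} → Rn n → ℝ≥0∞) {x : Rn n} {s : ℝ≥0∞} :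
    s < ntSup a g x ↔ ∃ t : {t : ℝ // 0 < t}, ∃ y, ‖y - x‖ ≤ a * t ∧ s < g t y := by
  simp only [ntSup, lt_iSup_iff, exists_prop]

theorem le_auxSup (b : ℝ) (g : {t : ℝ // 0 < t} → Rn n → ℝ≥0∞) (x y : Rn n)
    (t : {t : ℝ // 0 < t}) :
    g t y ≤ auxSup b g x * ENNReal.ofReal ((1 + (t : ℝ)⁻¹ * ‖x - y‖) ^ b) := by
  have h1 : g t (x - (x - y)) / ENNReal.ofReal ((1 + (t : ℝ)⁻¹ * ‖x - y‖) ^ b) ≤ auxSup b g x :=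
    le_iSup_of_le t (le_iSup_of_le (x - y) le_rfl)
  have hpos : 0 < (1 + (t : ℝ)⁻¹ * ‖x - y‖) ^ b := by
    have := inv_pos.2 t.2
    positivity
  rw [sub_sub_cancel] at h1
  exact (ENNReal.div_le_iff (by simpa using hpos) ENNReal.ofReal_ne_top).1 h1

/-- Vitali covering: a disjoint subfamily of the balls of radius `c t` has total measure at most
that of `E`, and its enlargement by the factor `(2A + 3c)/c` already covers every point seen from
`B` with aperture `A`. Only monotonicity of the measure is used on `E`, which may be non-measurable.
-/
theorem volume_setOf_near_le (hn : 0 < n) {A c : ℝ} (hA : 0 ≤ A) (hc : 0 < c) (E : Set (Rn n))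
    (B : Set ({t : ℝ // 0 < t} × Rn n))
    (hB : ∀ q ∈ B, Metric.closedBall q.2 (c * q.1) ⊆ E) :
    volume {x | ∃ q ∈ B, ‖q.2 - x‖ ≤ A * q.1} ≤
      ENNReal.ofReal (((2 * A + 3 * c) / c) ^ n) * volume E := by
  have hnz : Nonempty (Fin n) := ⟨⟨0, hn⟩⟩
  have hK : 0 < (2 * A + 3 * c) / c := by positivity
  rcases eq_or_ne (volume E) ∞ with hE | hE
  · rw [hE, ENNReal.mul_top (by simpa using pow_pos hK n)]
    exact le_top
  have hvol : ∀ (x : Rn n) (r : ℝ), 0 ≤ r → volume (Metric.closedBall x r) =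
      ENNReal.ofReal (r ^ n) * volume (Metric.closedBall (0 : Rn n) 1) := by
    intro x r hr
    rw [Measure.addHaar_closedBall' _ _ hr]
    simp
  have hv1 : volume (Metric.closedBall (0 : Rn n) 1) ≠ 0 :=
    (Metric.measure_closedBall_pos _ _ one_pos).ne'
  have hv1' : volume (Metric.closedBall (0 : Rn n) 1) ≠ ∞ := measure_closedBall_lt_top.ne
  -- the radii are bounded
  obtain ⟨R, hR⟩ : ∃ R : ℝ, ∀ q ∈ B, c * (q.1 : ℝ) ≤ R := by
    set V : ℝ := (volume E / volume (Metric.closedBall (0 : Rn n) 1)).toReal with hV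
    refine ⟨max 1 V, fun q hq => ?_⟩
    have hq1 : 0 ≤ c * (q.1 : ℝ) := by have := q.1.2; positivity
    have h1 := measure_mono (μ := volume) (hB q hq)
    rw [hvol _ _ hq1] at h1
    have h2 : ENNReal.ofReal ((c * (q.1 : ℝ)) ^ n) ≤
        volume E / volume (Metric.closedBall (0 : Rn n) 1) :=
      (ENNReal.le_div_iff_mul_le (Or.inl hv1) (Or.inl hv1')).2 h1
    have h3 : (c * (q.1 : ℝ)) ^ n ≤ V :=
      (ENNReal.ofReal_le_iff_le_toReal (ENNReal.div_ne_top hE hv1)).1 h2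
    rcases le_total (c * (q.1 : ℝ)) 1 with h | h
    · exact h.trans (le_max_left _ _)
    · exact ((le_self_pow₀ h hn.ne').trans h3).trans (le_max_right _ _)
  obtain ⟨u, huB, hdisj, hcov⟩ := Vitali.exists_disjoint_subfamily_covering_enlargement
    (fun q : {t : ℝ // 0 < t} × Rn n => Metric.closedBall q.2 (c * q.1)) B (fun q => (q.1 : ℝ)) 2
    one_lt_two (fun q _ => q.1.2.le) (R / c) (fun q hq => by
      rw [le_div_iff₀ hc, mul_comm]; exact hR q hq)
    (fun q _ => ⟨q.2, Metric.mem_closedBall_self (by have := q.1.2; positivity)⟩)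
  have hcount : u.Countable := by
    refine hdisj.countable_of_nonempty_interior fun q _ => ?_
    refine ⟨q.2, Metric.ball_subset_interior_closedBall (Metric.mem_ball_self ?_)⟩
    have := q.1.2
    positivity
  have hsub : {x | ∃ q ∈ B, ‖q.2 - x‖ ≤ A * q.1} ⊆
      ⋃ q ∈ u, Metric.closedBall q.2 ((2 * A + 3 * c) * q.1) := by
    rintro x ⟨q, hq, hx⟩
    obtain ⟨q', hq', ⟨z, hz1, hz2⟩, hle⟩ := hcov q hq
    simp only [Set.mem_iUnion, Metric.mem_closedBall, exists_prop]
    refine ⟨q', hq', ?_⟩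
    rw [Metric.mem_closedBall] at hz1 hz2
    have d1 : dist x q.2 ≤ A * q.1 := by rwa [dist_comm, dist_eq_norm]
    have d2 : dist x q'.2 ≤ dist x q.2 + dist q.2 z + dist z q'.2 := dist_triangle4 _ _ _ _
    rw [dist_comm q.2 z] at d2
    -- The selected ball meets that of `q` and has at least half its scale, so the distance is at
    -- most `(A + c) t + c t' ≤ (2A + 3c) t'`.
    have : (q.1 : ℝ) ≤ 2 * q'.1 := hle
    nlinarith
  calc volume {x | ∃ q ∈ B, ‖q.2 - x‖ ≤ A * q.1}
      ≤ volume (⋃ q ∈ u, Metric.closedBall q.2 ((2 * A + 3 * c) * q.1)) := measure_mono hsub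
    _ ≤ ∑' q : u, volume (Metric.closedBall (q : {t : ℝ // 0 < t} × Rn n).2
          ((2 * A + 3 * c) * (q : {t : ℝ // 0 < t} × Rn n).1)) := measure_biUnion_le _ hcount _
    _ = ∑' q : u, ENNReal.ofReal (((2 * A + 3 * c) / c) ^ n) *
          volume (Metric.closedBall (q : {t : ℝ // 0 < t} × Rn n).2
          (c * (q : {t : ℝ // 0 < t} × Rn n).1)) := by
        refine tsum_congr fun q => ?_
        have hq := (q : {t : ℝ // 0 < t} × Rn n).1.2
        rw [hvol _ ((2 * A + 3 * c) * _) (by positivity), hvol _ (c * _) (by positivity), ← mul_assoc,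
          ← ENNReal.ofReal_mul (by positivity), ← mul_pow]
        congr 3
        field_simp
    _ = ENNReal.ofReal (((2 * A + 3 * c) / c) ^ n) *
          volume (⋃ q ∈ u, Metric.closedBall q.2 (c * q.1)) := by
        rw [ENNReal.tsum_mul_left, measure_biUnion hcount hdisj
          (fun q _ => measurableSet_closedBall)]
    _ ≤ _ := by
        gcongr
        exact Set.iUnion₂_subset fun q hq => hB q (huB hq)

/-- On the shell `|y| ∼ 2^k t` the denominator is about `2^{kb}`, so the level rises by that factor
while widening the aperture to `2^k` multiplies measure by about `2^{kn}`. The resulting series has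
ratio `2^{n - bp}`, which is below one exactly because `b > n/p`. -/
theorem exists_weakLpNorm_auxSup_le (hn : 0 < n) {p a b : ℝ} (hp : 0 < p) (ha : 0 < a)
    (hb : (n : ℝ) / p < b) :
    ∃ C : ℝ≥0, ∀ g : {t : ℝ // 0 < t} → Rn n → ℝ≥0∞,
      weakLpNorm p (auxSup b g) ≤ C * weakLpNorm p (ntSup a g) := by
  have hbp : (n : ℝ) < b * p := (div_lt_iff₀ hp).1 hb
  have hb0 : 0 < b := lt_of_le_of_lt (by positivity) hb
  set r : ℝ := 2 ^ ((n : ℝ) - b * p) with hr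
  have hr0 : 0 < r := by positivity
  have hr1 : r < 1 := Real.rpow_lt_one_of_one_lt_of_neg one_lt_two (by linarith)
  set K : ℝ := ((2 + 3 * a) / a) ^ n * 2 ^ (b * p) with hK
  have hK0 : 0 ≤ K := by positivity
  set D : ℝ≥0∞ := ENNReal.ofReal (∑' k : ℕ, K * r ^ k) with hD
  have hDsum : ∑' k : ℕ, ENNReal.ofReal (K * r ^ k) = D :=
    (ENNReal.ofReal_tsum_of_nonneg (fun k => by positivity)
      ((summable_geometric_of_lt_one hr0.le hr1).mul_left K)).symm
  have hDp : D ^ (1 / p) ≠ ∞ := ENNReal.rpow_ne_top_of_nonneg (by positivity) ENNReal.ofReal_ne_top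
  refine ⟨(D ^ (1 / p)).toNNReal, fun g => ?_⟩
  rw [ENNReal.coe_toNNReal hDp, weakLpNorm_le_iff hp]
  intro s
  rw [ENNReal.mul_rpow_of_nonneg _ _ hp.le, ← ENNReal.rpow_mul, one_div_mul_cancel hp.ne',
    ENNReal.rpow_one]
  -- The exponent `k - 1` is what minimality of `k` yields below; for `k = 0` it is merely a
  -- harmless lower bound for the denominator.
  set σ : ℕ → ℝ≥0 := fun k => s * (2 : ℝ≥0) ^ (((k : ℝ) - 1) * b) with hσ
  set B : ℕ → Set ({t : ℝ // 0 < t} × Rn n) := fun k => {q | (σ k : ℝ≥0∞) < g q.1 q.2} with hB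
  have hsub : {x | (s : ℝ≥0∞) < auxSup b g x} ⊆
      ⋃ k : ℕ, {x | ∃ q ∈ B k, ‖q.2 - x‖ ≤ 2 ^ k * q.1} := by
    intro x hx
    simp only [auxSup, Set.mem_ofPred_eq, lt_iSup_iff] at hx
    obtain ⟨t, y, hty⟩ := hx
    have ht := t.2
    have hex : ∃ k : ℕ, ‖y‖ ≤ 2 ^ k * (t : ℝ) := by
      obtain ⟨k, hk⟩ := pow_unbounded_of_one_lt (‖y‖ / t) (one_lt_two (α := ℝ))
      exact ⟨k, ((div_lt_iff₀ ht).1 hk).le⟩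
    classical
    -- Taking the least `k` gives both the upper bound for `|y|` and, through the failure of `k -
    -- 1`, the lower bound for the denominator.
    let k := Nat.find hex
    have hk1 : ‖y‖ ≤ 2 ^ k * (t : ℝ) := Nat.find_spec hex
    have hk2 : (2 : ℝ) ^ ((k : ℝ) - 1) ≤ 1 + (t : ℝ)⁻¹ * ‖y‖ := by
      rcases Nat.eq_zero_or_pos k with h0 | h0
      · rw [h0]
        have : (2 : ℝ) ^ (((0 : ℕ) : ℝ) - 1) ≤ 1 :=
          Real.rpow_le_one_of_one_le_of_nonpos (by norm_num) (by norm_num)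
        have h3 : 0 ≤ (t : ℝ)⁻¹ * ‖y‖ := by positivity
        linarith
      · have h2 := Nat.find_min hex (Nat.sub_lt h0 one_pos)
        rw [not_le] at h2
        have h3 : (2 : ℝ) ^ ((k : ℝ) - 1) = 2 ^ (k - 1) := by
          rw [← Real.rpow_natCast, Nat.cast_sub h0, Nat.cast_one]
        rw [h3]
        have h4 : (2 : ℝ) ^ (k - 1) ≤ (t : ℝ)⁻¹ * ‖y‖ := by
          rw [inv_mul_eq_div, le_div_iff₀ ht]
          exact h2.le
        linarith
    simp only [Set.mem_iUnion]
    refine ⟨k, ⟨t, x - y⟩, ?_, by simpa using hk1⟩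
    have hpos : 0 < (1 + (t : ℝ)⁻¹ * ‖y‖) ^ b := by positivity
    rw [ENNReal.lt_div_iff_mul_lt (Or.inl (by simpa using hpos))
      (Or.inl ENNReal.ofReal_ne_top)] at hty
    refine lt_of_le_of_lt ?_ hty
    rw [hσ]
    push_cast
    gcongr
    have : ((2 : ℝ≥0) ^ (((k : ℝ) - 1) * b) : ℝ≥0) = Real.toNNReal ((2 : ℝ) ^ (((k : ℝ) - 1) * b)) := by
      rw [Real.toNNReal_rpow_of_nonneg (by norm_num)]
      simp
    rw [this]
    refine ENNReal.ofReal_le_ofReal ?_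
    rw [Real.rpow_mul (by norm_num)]
    gcongr
  have hterm : ∀ k : ℕ, (s : ℝ≥0∞) ^ p * volume {x | ∃ q ∈ B k, ‖q.2 - x‖ ≤ 2 ^ k * q.1} ≤
      ENNReal.ofReal (K * r ^ k) * weakLpNorm p (ntSup a g) ^ p := by
    intro k
    have h1 := volume_setOf_near_le hn (A := 2 ^ k) (by positivity) ha
      {x | (σ k : ℝ≥0∞) < ntSup a g x} (B k) (fun q hq z hz => by
        refine lt_of_lt_of_le hq (le_ntSup g ?_)
        rwa [Metric.mem_closedBall, dist_comm, dist_eq_norm] at hz)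
    have h2 := volume_mul_le_weakLpNorm hp (ntSup a g) (σ k)
    have h3 : (s : ℝ≥0∞) ^ p =
        ENNReal.ofReal ((2 : ℝ) ^ (-(((k : ℝ) - 1) * b * p))) * (σ k : ℝ≥0∞) ^ p := by
      rw [← ENNReal.coe_rpow_of_nonneg _ hp.le, ← ENNReal.coe_rpow_of_nonneg _ hp.le,
        ENNReal.ofReal, ← ENNReal.coe_mul]
      congr 1
      rw [hσ, NNReal.mul_rpow, ← NNReal.rpow_mul, Real.toNNReal_rpow_of_nonneg (by norm_num)]
      have : Real.toNNReal 2 = 2 := by simp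
      rw [this, mul_left_comm, ← NNReal.rpow_add (by norm_num), neg_add_cancel, NNReal.rpow_zero,
        mul_one]
    calc (s : ℝ≥0∞) ^ p * volume {x | ∃ q ∈ B k, ‖q.2 - x‖ ≤ 2 ^ k * q.1}
        ≤ (ENNReal.ofReal ((2 : ℝ) ^ (-(((k : ℝ) - 1) * b * p))) * (σ k : ℝ≥0∞) ^ p) *
          (ENNReal.ofReal (((2 * 2 ^ k + 3 * a) / a) ^ n) *
            volume {x | (σ k : ℝ≥0∞) < ntSup a g x}) := by
          rw [h3]
          gcongr
      _ = (ENNReal.ofReal ((2 : ℝ) ^ (-(((k : ℝ) - 1) * b * p))) *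
            ENNReal.ofReal (((2 * 2 ^ k + 3 * a) / a) ^ n)) *
          ((σ k : ℝ≥0∞) ^ p * volume {x | (σ k : ℝ≥0∞) < ntSup a g x}) := by ring
      _ ≤ ENNReal.ofReal (K * r ^ k) * weakLpNorm p (ntSup a g) ^ p := by
          refine mul_le_mul' ?_ h2
          rw [← ENNReal.ofReal_mul (by positivity)]
          refine ENNReal.ofReal_le_ofReal ?_
          have e1 : r ^ k = 2 ^ (-((k : ℝ) * b * p)) * ((2 : ℝ) ^ k) ^ n := by
            rw [hr, ← Real.rpow_natCast, ← Real.rpow_mul (by norm_num), ← pow_mul,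
              ← Real.rpow_natCast, ← Real.rpow_add (by norm_num)]
            congr 1
            push_cast
            ring
          have e2 : (2 : ℝ) ^ (-(((k : ℝ) - 1) * b * p)) =
              2 ^ (b * p) * 2 ^ (-((k : ℝ) * b * p)) := by
            rw [← Real.rpow_add (by norm_num)]
            congr 1
            ring
          have e3 : (2 * 2 ^ k + 3 * a) / a ≤ (2 + 3 * a) / a * 2 ^ k := by
            rw [div_mul_eq_mul_div]
            gcongr
            have : (1 : ℝ) ≤ 2 ^ k := one_le_pow₀ (by norm_num)
            nlinarith
          calc (2 : ℝ) ^ (-(((k : ℝ) - 1) * b * p)) * ((2 * 2 ^ k + 3 * a) / a) ^ n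
              ≤ (2 : ℝ) ^ (-(((k : ℝ) - 1) * b * p)) * ((2 + 3 * a) / a * 2 ^ k) ^ n := by gcongr
            _ = K * r ^ k := by rw [hK, e1, e2, mul_pow]; ring
  calc (s : ℝ≥0∞) ^ p * volume {x | (s : ℝ≥0∞) < auxSup b g x}
      ≤ (s : ℝ≥0∞) ^ p * ∑' k : ℕ, volume {x | ∃ q ∈ B k, ‖q.2 - x‖ ≤ 2 ^ k * q.1} := by
        gcongr
        exact (measure_mono hsub).trans (measure_iUnion_le _)
    _ = ∑' k : ℕ, (s : ℝ≥0∞) ^ p * volume {x | ∃ q ∈ B k, ‖q.2 - x‖ ≤ 2 ^ k * q.1} :=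
        ENNReal.tsum_mul_left.symm
    _ ≤ ∑' k : ℕ, ENNReal.ofReal (K * r ^ k) * weakLpNorm p (ntSup a g) ^ p :=
        ENNReal.tsum_le_tsum hterm
    _ = D * weakLpNorm p (ntSup a g) ^ p := by rw [ENNReal.tsum_mul_right, hDsum]

/-! ### Derivatives of Schwartz functions -/

/-- On the Fourier side both derivatives are multiplication operators, which commute. -/
theorem lineDerivOp_comm (v w : Rn n) (φ : 𝓢(Rn n, ℂ)) : ∂_{v} (∂_{w} φ) = ∂_{w} (∂_{v} φ) := by
  apply (FourierTransform.fourierCLE ℂ 𝓢(Rn n, ℂ)).injective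
  simp only [FourierTransform.fourierCLE_apply]
  have h : ∀ u : Rn n, (fun x : Rn n => inner ℝ x u).HasTemperateGrowth :=
    fun u => ((innerSL ℝ).flip u).hasTemperateGrowth
  ext x
  simp only [fourier_lineDerivOp_eq, smul_apply, smulLeftCLM_apply_apply (h _), smul_eq_mul,
    Complex.real_smul]
  ring

/-- The partial derivative as an endomorphism of the Schwartz space. -/
def partialEnd (i : Fin n) : Module.End ℂ 𝓢(Rn n, ℂ) :=
  (LineDeriv.lineDerivOpCLM ℂ 𝓢(Rn n, ℂ) (EuclideanSpace.single i (1 : ℝ) : Rn n) :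
    𝓢(Rn n, ℂ) →L[ℂ] 𝓢(Rn n, ℂ))

theorem partialEnd_apply (i : Fin n) (φ : 𝓢(Rn n, ℂ)) :
    partialEnd i φ = ∂_{(EuclideanSpace.single i (1 : ℝ) : Rn n)} φ := rfl

theorem partialEnd_commute (i j : Fin n) : Commute (partialEnd i) (partialEnd j) := by
  ext1 φ
  exact lineDerivOp_comm _ _ φ

/-- The mixed partial derivative as an endomorphism of the Schwartz space. -/
def mixedEnd (l : List (Fin n)) (α : Fin n → ℕ) : Module.End ℂ 𝓢(Rn n, ℂ) :=
  (l.map fun i => partialEnd i ^ α i).prod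

theorem mixedDeriv_eq (α : Fin n → ℕ) (φ : 𝓢(Rn n, ℂ)) :
    mixedDeriv α φ = mixedEnd (List.finRange n) α φ := by
  unfold mixedDeriv mixedEnd
  induction List.finRange n with
  | nil => rfl
  | cons i l ih =>
    simp only [List.foldr_cons, List.map_cons, List.prod_cons, Module.End.mul_apply, ih,
      Module.End.pow_apply]
    rfl

/-- The new derivative commutes past the others until it reaches its own power; absence of
repetitions guarantees that only this one exponent changes. -/
theorem partialEnd_mul_mixedEnd (i : Fin n) (α : Fin n → ℕ) (l : List (Fin n)) (hl : l.Nodup)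
    (hi : i ∈ l) : partialEnd i * mixedEnd l α = mixedEnd l (α + Pi.single i 1) := by
  induction l with
  | nil => simp at hi
  | cons j l ih =>
    rw [List.nodup_cons] at hl
    have hcons : ∀ β, mixedEnd (j :: l) β = partialEnd j ^ β j * mixedEnd l β := fun β => rfl
    rw [hcons, hcons]
    by_cases hij : i = j
    · subst hij
      have : mixedEnd l (α + Pi.single i 1) = mixedEnd l α := by
        unfold mixedEnd
        congr 1
        refine List.map_congr_left fun k hk => ?_
        have : k ≠ i := fun h => hl.1 (h ▸ hk)
        simp [this]
      rw [this, ← mul_assoc, ← pow_succ']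
      simp
    · have hi' : i ∈ l := by simpa [hij] using hi
      rw [← mul_assoc, ((partialEnd_commute i j).pow_right _).eq, mul_assoc, ih hl.2 hi']
      have hji : j ≠ i := fun h => hij h.symm
      simp [hji]

theorem partialEnd_mixedDeriv (i : Fin n) (α : Fin n → ℕ) (φ : 𝓢(Rn n, ℂ)) :
    partialEnd i (mixedDeriv α φ) = mixedDeriv (α + Pi.single i 1) φ := by
  rw [mixedDeriv_eq, mixedDeriv_eq, ← Module.End.mul_apply,
    partialEnd_mul_mixedEnd i α _ (List.nodup_finRange n) (List.mem_finRange i)]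

/-- An operator that commutes with partial derivatives up to a scalar factor commutes with mixed
derivatives up to a power of it. -/
theorem mixedDeriv_map (T : 𝓢(Rn n, ℂ) →ₗ[ℂ] 𝓢(Rn n, ℂ)) (c : ℂ)
    (hT : ∀ i φ, partialEnd i (T φ) = c • T (partialEnd i φ)) (α : Fin n → ℕ) (φ : 𝓢(Rn n, ℂ)) :
    mixedDeriv α (T φ) = c ^ (∑ i, α i) • T (mixedDeriv α φ) := by
  have hpow : ∀ (i : Fin n) (k : ℕ) (ψ : 𝓢(Rn n, ℂ)),
      (partialEnd i ^ k) (T ψ) = c ^ k • T ((partialEnd i ^ k) ψ) := by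
    intro i k
    induction k with
    | zero => intro ψ; simp
    | succ k ih =>
      intro ψ
      rw [pow_succ, Module.End.mul_apply, hT, map_smul, ih, Module.End.mul_apply, smul_smul,
        pow_succ']
  have hl : ∀ l : List (Fin n), mixedEnd l α (T φ) =
      c ^ (l.map α).sum • T (mixedEnd l α φ) := by
    intro l
    induction l with
    | nil => simp [mixedEnd]
    | cons j l ih =>
      have hcons : mixedEnd (j :: l) α = partialEnd j ^ α j * mixedEnd l α := rfl
      rw [hcons, Module.End.mul_apply, Module.End.mul_apply, ih, map_smul, hpow, smul_smul,
        List.map_cons, List.sum_cons, pow_add, mul_comm]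
  rw [mixedDeriv_eq, mixedDeriv_eq, hl]
  simp [Fin.sum_univ_def]

theorem mixedDeriv_sub (α : Fin n → ℕ) (φ ψ : 𝓢(Rn n, ℂ)) :
    mixedDeriv α (φ - ψ) = mixedDeriv α φ - mixedDeriv α ψ := by
  simp only [mixedDeriv_eq, map_sub]

theorem mixedDeriv_smul (α : Fin n → ℕ) (c : ℂ) (φ : 𝓢(Rn n, ℂ)) :
    mixedDeriv α (c • φ) = c • mixedDeriv α φ := by
  simp only [mixedDeriv_eq, map_smul]

/-! ### Translation and convolution of Schwartz functions -/

/-- `φ(x - v)` -/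
def translate (v : Rn n) : 𝓢(Rn n, ℂ) →L[ℂ] 𝓢(Rn n, ℂ) := SchwartzMap.compSubConstCLM ℂ v

theorem translate_apply (v : Rn n) (φ : 𝓢(Rn n, ℂ)) (x : Rn n) : translate v φ x = φ (x - v) := rfl

theorem conv_eq (φ : 𝓢(Rn n, ℂ)) (f : 𝓢'(Rn n, ℂ)) (x : Rn n) :
    conv φ f x = f (translate x (reflect φ)) := rfl

/-- The convolution of Schwartz functions. -/
def star (φ ψ : 𝓢(Rn n, ℂ)) : 𝓢(Rn n, ℂ) := convolution (ContinuousLinearMap.mul ℂ ℂ) φ ψ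

open FourierTransform in
theorem fourier_star_apply (φ ψ : 𝓢(Rn n, ℂ)) (x : Rn n) :
    𝓕 (star φ ψ) x = 𝓕 φ x * 𝓕 ψ x := by
  unfold star
  rw [fourier_convolution, pairing_apply_apply]
  rfl

/-- The algebra of convolution is verified through this: after the Fourier transform it is pointwise
multiplication. -/
theorem ext_fourier {φ ψ : 𝓢(Rn n, ℂ)}
    (h : ∀ x, FourierTransform.fourier φ x = FourierTransform.fourier ψ x) : φ = ψ := by
  apply (FourierTransform.fourierCLE ℂ 𝓢(Rn n, ℂ)).injective
  simp only [FourierTransform.fourierCLE_apply]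
  exact SchwartzMap.ext h

theorem star_comm (φ ψ : 𝓢(Rn n, ℂ)) : star φ ψ = star ψ φ :=
  ext_fourier fun x => by rw [fourier_star_apply, fourier_star_apply, mul_comm]

theorem star_assoc (φ ψ χ : 𝓢(Rn n, ℂ)) : star (star φ ψ) χ = star φ (star ψ χ) :=
  ext_fourier fun x => by simp only [fourier_star_apply, mul_assoc]

/-- Convolution with a fixed Schwartz function. -/
def starEnd (ψ : 𝓢(Rn n, ℂ)) : Module.End ℂ 𝓢(Rn n, ℂ) :=
  (convolution (ContinuousLinearMap.mul ℂ ℂ) ψ : 𝓢(Rn n, ℂ) →L[ℂ] 𝓢(Rn n, ℂ))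

theorem starEnd_apply (ψ φ : 𝓢(Rn n, ℂ)) : starEnd ψ φ = star φ ψ := star_comm ψ φ

theorem starEnd_commute (φ ψ : 𝓢(Rn n, ℂ)) : Commute (starEnd φ) (starEnd ψ) := by
  ext1 χ
  simp only [Module.End.mul_apply, starEnd_apply]
  rw [star_assoc, star_assoc, star_comm ψ φ]

theorem lineDerivOp_star (v : Rn n) (φ ψ : 𝓢(Rn n, ℂ)) :
    ∂_{v} (star φ ψ) = star (∂_{v} φ) ψ := by
  have h : (fun x : Rn n => inner ℝ x v).HasTemperateGrowth :=
    ((innerSL ℝ).flip v).hasTemperateGrowth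
  refine ext_fourier fun x => ?_
  rw [fourier_star_apply]
  simp only [fourier_lineDerivOp_eq, smul_apply, smulLeftCLM_apply_apply h, fourier_star_apply]
  simp only [smul_eq_mul, Complex.real_smul]
  ring

theorem star_apply (φ ψ : 𝓢(Rn n, ℂ)) (x : Rn n) : star φ ψ x = ∫ z, ψ z * φ (x - z) := by
  rw [star_comm]
  unfold star
  rw [convolution_apply]
  rfl

theorem mixedDeriv_star (α : Fin n → ℕ) (φ ψ : 𝓢(Rn n, ℂ)) :
    mixedDeriv α (star φ ψ) = star (mixedDeriv α φ) ψ := by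
  have := mixedDeriv_map (starEnd ψ) 1 (fun i φ => by
    rw [starEnd_apply, starEnd_apply, one_smul, partialEnd_apply, partialEnd_apply,
      lineDerivOp_star]) α φ
  simpa only [starEnd_apply, one_pow, one_smul] using this

theorem lineDerivOp_translate (v w : Rn n) (φ : 𝓢(Rn n, ℂ)) :
    ∂_{v} (translate w φ) = translate w (∂_{v} φ) := by
  ext x
  rw [translate_apply, lineDerivOp_apply_eq_fderiv, lineDerivOp_apply_eq_fderiv]
  congr 1
  exact fderiv_comp_sub (𝕜 := ℝ) (f := φ) (x := x) w

theorem mixedDeriv_translate (α : Fin n → ℕ) (v : Rn n) (φ : 𝓢(Rn n, ℂ)) :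
    mixedDeriv α (translate v φ) = translate v (mixedDeriv α φ) := by
  have := mixedDeriv_map (translate v : 𝓢(Rn n, ℂ) →ₗ[ℂ] 𝓢(Rn n, ℂ)) 1 (fun i φ => by
    rw [one_smul]; exact lineDerivOp_translate _ _ _) α φ
  simpa only [one_pow, one_smul] using! this

theorem lineDerivOp_reflect (v : Rn n) (φ : 𝓢(Rn n, ℂ)) :
    ∂_{v} (reflect φ) = (-1 : ℂ) • reflect (∂_{v} φ) := by
  unfold reflect
  rw [lineDerivOp_compCLMOfContinuousLinearEquiv]
  have : (ContinuousLinearEquiv.neg ℝ : Rn n ≃L[ℝ] Rn n) v = -v := rfl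
  rw [this, LineDeriv.lineDerivOp_left_neg, map_neg, neg_one_smul]

theorem mixedDeriv_reflect (α : Fin n → ℕ) (φ : 𝓢(Rn n, ℂ)) :
    mixedDeriv α (reflect φ) = (-1 : ℂ) ^ (∑ i, α i) • reflect (mixedDeriv α φ) := by
  exact mixedDeriv_map (SchwartzMap.compCLMOfContinuousLinearEquiv ℂ
    (ContinuousLinearEquiv.neg ℝ) : 𝓢(Rn n, ℂ) →L[ℂ] 𝓢(Rn n, ℂ)).toLinearMap (-1)
    (fun i φ => lineDerivOp_reflect _ φ) α φ

/-- Dilation as a linear map. -/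
def dilateLM (t : {t : ℝ // 0 < t}) : 𝓢(Rn n, ℂ) →ₗ[ℂ] 𝓢(Rn n, ℂ) where
  toFun := dilate t
  map_add' φ ψ := by
    ext x
    simp only [dilate_apply, add_apply, smul_add]
  map_smul' c φ := by
    ext x
    simp only [dilate_apply, smul_apply, RingHom.id_apply]
    rw [smul_comm]

theorem dilateLM_apply (t : {t : ℝ // 0 < t}) (φ : 𝓢(Rn n, ℂ)) : dilateLM t φ = dilate t φ := rfl

theorem lineDerivOp_dilate (t : {t : ℝ // 0 < t}) (v : Rn n) (φ : 𝓢(Rn n, ℂ)) :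
    ∂_{v} (dilate t φ) = ((t : ℝ)⁻¹ : ℂ) • dilate t (∂_{v} φ) := by
  unfold dilate
  rw [LineDeriv.lineDerivOp_smul, lineDerivOp_compCLMOfContinuousLinearEquiv]
  have : (ContinuousLinearEquiv.smulLeft (Units.mk0 (t : ℝ)⁻¹ (inv_ne_zero t.2.ne')) :
    Rn n ≃L[ℝ] Rn n) v = (t : ℝ)⁻¹ • v := rfl
  rw [this, LineDeriv.lineDerivOp_left_smul]
  ext x
  simp only [smul_apply, compCLMOfContinuousLinearEquiv_apply, Function.comp_apply,
    Complex.real_smul, smul_eq_mul]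
  push_cast
  ring

theorem mixedDeriv_dilate (α : Fin n → ℕ) (t : {t : ℝ // 0 < t}) (φ : 𝓢(Rn n, ℂ)) :
    mixedDeriv α (dilate t φ) = ((t : ℝ)⁻¹ : ℂ) ^ (∑ i, α i) • dilate t (mixedDeriv α φ) := by
  have := mixedDeriv_map (dilateLM t) ((t : ℝ)⁻¹ : ℂ) (fun i φ => by
    rw [dilateLM_apply, dilateLM_apply, partialEnd_apply, partialEnd_apply,
      lineDerivOp_dilate]) α φ
  rwa [dilateLM_apply, dilateLM_apply] at this

theorem dilate_dilate (s t : {t : ℝ // 0 < t}) (φ : 𝓢(Rn n, ℂ)) :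
    dilate s (dilate t φ) = dilate (s * t) φ := by
  ext x
  simp only [dilate_apply, smul_smul, Positive.val_mul, mul_inv, mul_pow]
  rw [mul_comm (t : ℝ)⁻¹]

theorem integral_dilate (t : {t : ℝ // 0 < t}) (φ : 𝓢(Rn n, ℂ)) :
    ∫ x, dilate t φ x = ∫ x, φ x := by
  simp only [dilate_apply]
  rw [integral_smul, Measure.integral_comp_inv_smul]
  have := pow_pos t.2 n
  simp only [finrank_euclideanSpace, Fintype.card_fin, smul_smul, abs_of_pos this]
  rw [inv_mul_cancel₀ this.ne', one_smul]

theorem dilate_star (t : {t : ℝ // 0 < t}) (φ ψ : 𝓢(Rn n, ℂ)) :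
    dilate t (star φ ψ) = star (dilate t φ) (dilate t ψ) := by
  ext x
  have h := pow_pos t.2 n
  rw [dilate_apply, star_apply, star_apply]
  have : (fun z => dilate t ψ z * dilate t φ (x - z)) = fun z =>
      (fun z => ((((t : ℝ) ^ n)⁻¹ * ((t : ℝ) ^ n)⁻¹ : ℝ) : ℂ) *
        (ψ z * φ ((t : ℝ)⁻¹ • x - z))) ((t : ℝ)⁻¹ • z) := by
    ext z
    simp only [dilate_apply, smul_sub, Complex.real_smul]
    push_cast
    ring
  rw [this, Measure.integral_comp_inv_smul volume (fun z : Rn n =>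
    ((((t : ℝ) ^ n)⁻¹ * ((t : ℝ) ^ n)⁻¹ : ℝ) : ℂ) * (ψ z * φ ((t : ℝ)⁻¹ • x - z))),
    integral_const_mul]
  simp only [finrank_euclideanSpace, Fintype.card_fin, abs_of_pos h, Complex.real_smul]
  push_cast
  have h' : ((t : ℝ) : ℂ) ^ n ≠ 0 := by exact_mod_cast h.ne'
  field_simp

theorem reflect_star (φ ψ : 𝓢(Rn n, ℂ)) : reflect (star φ ψ) = star (reflect φ) (reflect ψ) := by
  ext x
  rw [reflect_apply, star_apply, star_apply, ← integral_neg_eq_self]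
  simp only [reflect_apply, sub_neg_eq_add, neg_sub]
  congr 1
  ext z
  congr 2
  abel

theorem translate_star (v : Rn n) (φ ψ : 𝓢(Rn n, ℂ)) :
    translate v (star φ ψ) = star (translate v φ) ψ := by
  ext x
  simp only [translate_apply, star_apply, sub_right_comm]

theorem reflect_reflect (φ : 𝓢(Rn n, ℂ)) : reflect (reflect φ) = φ := by
  ext x
  simp [reflect_apply]

theorem translate_translate (v w : Rn n) (φ : 𝓢(Rn n, ℂ)) :
    translate v (translate w φ) = translate (v + w) φ := by
  ext x
  simp only [translate_apply]
  congr 1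
  abel

theorem reflect_translate (v : Rn n) (φ : 𝓢(Rn n, ℂ)) :
    reflect (translate v φ) = translate (-v) (reflect φ) := by
  ext x
  simp only [reflect_apply, translate_apply]
  congr 1
  abel

theorem dilate_translate (t : {t : ℝ // 0 < t}) (v : Rn n) (φ : 𝓢(Rn n, ℂ)) :
    dilate t (translate v φ) = translate ((t : ℝ) • v) (dilate t φ) := by
  ext x
  simp only [dilate_apply, translate_apply, smul_sub, smul_smul, inv_mul_cancel₀ t.2.ne', one_smul]

/-! ### Continuity of translations -/

/-- The supremum of the Schwartz seminorms of order at most `m`. -/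
def supSeminorm (m : ℕ × ℕ) : Seminorm ℂ 𝓢(Rn n, ℂ) :=
  (Finset.Iic m).sup (fun m => SchwartzMap.seminorm ℂ m.1 m.2)

theorem one_add_norm_pow_mul_le (k l : ℕ) (φ : 𝓢(Rn n, ℂ)) (x : Rn n) :
    (1 + ‖x‖) ^ k * ‖iteratedFDeriv ℝ l φ x‖ ≤ 2 ^ k * supSeminorm (k, l) φ :=
  one_add_le_sup_seminorm_apply (𝕜 := ℂ) (m := (k, l)) le_rfl le_rfl φ x

theorem norm_le_mul_one_add (x z : Rn n) : ‖x‖ ≤ (1 + ‖z‖) * (1 + ‖x - z‖) := by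
  have h1 : ‖x‖ ≤ ‖z‖ + ‖x - z‖ := by
    simpa using norm_add_le z (x - z)
  nlinarith [norm_nonneg z, norm_nonneg (x - z)]

theorem iteratedFDeriv_translate (l : ℕ) (z : Rn n) (φ : 𝓢(Rn n, ℂ)) (x : Rn n) :
    iteratedFDeriv ℝ l (translate z φ) x = iteratedFDeriv ℝ l φ (x - z) :=
  iteratedFDeriv_comp_sub (𝕜 := ℝ) (f := φ) l z x

theorem seminorm_translate_le (k l : ℕ) (z : Rn n) (φ : 𝓢(Rn n, ℂ)) :
    SchwartzMap.seminorm ℂ k l (translate z φ) ≤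
      (1 + ‖z‖) ^ k * (2 ^ k * supSeminorm (k, l) φ) := by
  refine seminorm_le_bound ℂ k l _ ?_ fun x => ?_
  · have := apply_nonneg (supSeminorm (k, l)) φ
    positivity
  rw [iteratedFDeriv_translate]
  calc ‖x‖ ^ k * ‖iteratedFDeriv ℝ l φ (x - z)‖
      ≤ ((1 + ‖z‖) * (1 + ‖x - z‖)) ^ k * ‖iteratedFDeriv ℝ l φ (x - z)‖ := by
        gcongr
        exact norm_le_mul_one_add x z
    _ = (1 + ‖z‖) ^ k * ((1 + ‖x - z‖) ^ k * ‖iteratedFDeriv ℝ l φ (x - z)‖) := by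
        rw [mul_pow, mul_assoc]
    _ ≤ _ := by
        refine mul_le_mul_of_nonneg_left ?_ (by positivity)
        exact one_add_norm_pow_mul_le k l φ _

/-- Mean value inequality on the segment from `x - w` to `x - z`, at the cost of one derivative. The
weight survives because every point of that segment is within `1 + ‖w‖` of `x`. -/
theorem seminorm_translate_sub_le (k l : ℕ) (z w : Rn n) (hzw : ‖z - w‖ ≤ 1) (φ : 𝓢(Rn n, ℂ)) :
    SchwartzMap.seminorm ℂ k l (translate z φ - translate w φ) ≤
      (2 + ‖w‖) ^ k * (2 ^ k * supSeminorm (k, l + 1) φ) * ‖z - w‖ := by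
  have h0 := apply_nonneg (supSeminorm (k, l + 1)) φ
  refine seminorm_le_bound ℂ k l _ (by positivity) fun x => ?_
  have e1 : iteratedFDeriv ℝ l (translate z φ - translate w φ : 𝓢(Rn n, ℂ)) x =
      iteratedFDeriv ℝ l φ (x - z) - iteratedFDeriv ℝ l φ (x - w) := by
    rw [← iteratedFDeriv_translate, ← iteratedFDeriv_translate]
    exact iteratedFDeriv_sub_apply ((translate z φ).smooth l).contDiffAt
      ((translate w φ).smooth l).contDiffAt
  rw [e1]
  have hdiff : ∀ y, DifferentiableAt ℝ (iteratedFDeriv ℝ l φ) y := fun y =>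
    ((φ.smooth ⊤).differentiable_iteratedFDeriv (mod_cast ENat.natCast_lt_top l)) y
  have key : ∀ y ∈ segment ℝ (x - w) (x - z), ‖x‖ ^ k * ‖fderiv ℝ (iteratedFDeriv ℝ l φ) y‖ ≤
      (2 + ‖w‖) ^ k * (2 ^ k * supSeminorm (k, l + 1) φ) := by
    intro y hy
    obtain ⟨θ, ⟨hθ0, hθ1⟩, rfl⟩ := (segment_eq_image' ℝ (x - w) (x - z)).subset hy
    rw [norm_fderiv_iteratedFDeriv]
    set y := x - w + θ • (x - z - (x - w)) with hy'
    have h1 : ‖x - y‖ ≤ 1 + ‖w‖ := by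
      have : x - y = w + θ • (z - w) := by
        rw [hy']
        have : x - z - (x - w) = -(z - w) := by abel
        rw [this, smul_neg]
        abel
      rw [this]
      refine (norm_add_le _ _).trans ?_
      rw [norm_smul, Real.norm_of_nonneg hθ0]
      nlinarith [norm_nonneg (z - w)]
    have h2 : ‖x‖ ≤ (2 + ‖w‖) * (1 + ‖y‖) := by
      have h3 : ‖x‖ ≤ ‖x - y‖ + ‖y‖ := by simpa using norm_add_le (x - y) y
      nlinarith [norm_nonneg w, norm_nonneg y]
    calc ‖x‖ ^ k * ‖iteratedFDeriv ℝ (l + 1) φ y‖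
        ≤ ((2 + ‖w‖) * (1 + ‖y‖)) ^ k * ‖iteratedFDeriv ℝ (l + 1) φ y‖ := by gcongr
      _ = (2 + ‖w‖) ^ k * ((1 + ‖y‖) ^ k * ‖iteratedFDeriv ℝ (l + 1) φ y‖) := by
        rw [mul_pow, mul_assoc]
      _ ≤ _ := by
        refine mul_le_mul_of_nonneg_left ?_ (by positivity)
        exact one_add_norm_pow_mul_le k (l + 1) φ _
  -- The weight is frozen at the base point `x`, so only the derivative of `φ` varies along the
  -- segment.
  have hmvt := (convex_segment (𝕜 := ℝ) (x - w) (x - z)).norm_image_sub_le_of_norm_fderiv_le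
    (f := fun y => ‖x‖ ^ k • iteratedFDeriv ℝ l φ y) (𝕜 := ℝ)
    (C := (2 + ‖w‖) ^ k * (2 ^ k * supSeminorm (k, l + 1) φ))
    (fun y _ => (hdiff y).fun_const_smul _) (fun y hy => by
      rw [fderiv_fun_const_smul (hdiff y), norm_smul, norm_pow, norm_norm]
      exact key y hy) (left_mem_segment ℝ _ _) (right_mem_segment ℝ _ _)
  rw [← smul_sub, norm_smul, norm_pow, norm_norm] at hmvt
  refine hmvt.trans (le_of_eq ?_)
  congr 1
  rw [show x - z - (x - w) = -(z - w) by abel, norm_neg]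

theorem continuous_translate (φ : 𝓢(Rn n, ℂ)) : Continuous fun z : Rn n => translate z φ := by
  rw [continuous_iff_continuousAt]
  intro w
  refine ((schwartz_withSeminorms ℂ (Rn n) ℂ).tendsto_nhds _ _).2 fun m ε hε => ?_
  set K := (2 + ‖w‖) ^ m.1 * (2 ^ m.1 * supSeminorm (m.1, m.2 + 1) φ) with hK
  have h0 : 0 ≤ K := by
    have := apply_nonneg (supSeminorm (m.1, m.2 + 1)) φ
    positivity
  have hball : Metric.ball w (min 1 (ε / (K + 1))) ∈ nhds w :=
    Metric.ball_mem_nhds _ (by positivity)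
  filter_upwards [hball] with z hz
  rw [Metric.mem_ball, dist_eq_norm, lt_min_iff] at hz
  calc SchwartzMap.seminorm ℂ m.1 m.2 (translate z φ - translate w φ) ≤ K * ‖z - w‖ :=
        seminorm_translate_sub_le _ _ _ _ hz.1.le _
    _ ≤ (K + 1) * ‖z - w‖ := by gcongr; linarith
    _ < ε := by
      have := (lt_div_iff₀ (by positivity)).1 hz.2
      rwa [mul_comm]

/-! ### Convolution with a tempered distribution -/

theorem exists_norm_le_supSeminorm (f : 𝓢'(Rn n, ℂ)) :
    ∃ (m : ℕ × ℕ) (C : ℝ), 0 < C ∧ ∀ φ, ‖f φ‖ ≤ C * supSeminorm m φ := by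
  obtain ⟨s, C, hC, h⟩ := Seminorm.bound_of_continuous (schwartz_withSeminorms ℂ (Rn n) ℂ)
    ((normSeminorm ℂ ℂ).comp (f : 𝓢(Rn n, ℂ) →L[ℂ] ℂ).toLinearMap)
    (continuous_norm.comp (map_continuous f))
  refine ⟨s.sup id, C, NNReal.coe_pos.2 (pos_iff_ne_zero.2 hC), fun φ => (h φ).trans ?_⟩
  change (C : ℝ) * _ ≤ _
  gcongr
  refine Seminorm.finset_sup_apply_le (apply_nonneg _ _) fun i hi => ?_
  exact Seminorm.le_def.1 (Finset.le_sup (f := fun m : ℕ × ℕ => SchwartzMap.seminorm ℂ m.1 m.2)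
    (Finset.mem_Iic.2 (Finset.le_sup (f := id) hi))) φ

theorem conv_continuous (φ : 𝓢(Rn n, ℂ)) (f : 𝓢'(Rn n, ℂ)) : Continuous (conv φ f) :=
  (map_continuous f).comp (continuous_translate (reflect φ))

theorem supSeminorm_mono {m m' : ℕ × ℕ} (h : m ≤ m') (φ : 𝓢(Rn n, ℂ)) :
    supSeminorm m φ ≤ supSeminorm m' φ := by
  refine Seminorm.le_def.1 (Finset.sup_mono ?_) φ
  exact Finset.Iic_subset_Iic.2 h

theorem supSeminorm_translate_le (m : ℕ × ℕ) (z : Rn n) (φ : 𝓢(Rn n, ℂ)) :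
    supSeminorm m (translate z φ) ≤ (1 + ‖z‖) ^ m.1 * (2 ^ m.1 * supSeminorm m φ) := by
  have h0 := apply_nonneg (supSeminorm m) φ
  refine Seminorm.finset_sup_apply_le (by positivity) fun i hi => ?_
  rw [Finset.mem_Iic] at hi
  have h1 := apply_nonneg (supSeminorm i) φ
  refine (seminorm_translate_le i.1 i.2 z φ).trans ?_
  gcongr
  · linarith [norm_nonneg z]
  · exact hi.1
  · norm_num
  · exact hi.1
  · exact supSeminorm_mono hi φ

theorem seminorm_reflect_le (k l : ℕ) (φ : 𝓢(Rn n, ℂ)) :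
    SchwartzMap.seminorm ℂ k l (reflect φ) ≤ SchwartzMap.seminorm ℂ k l φ := by
  refine seminorm_le_bound ℂ k l _ (apply_nonneg _ _) fun x => ?_
  have h : (reflect φ : Rn n → ℂ) = φ ∘ (LinearIsometryEquiv.neg ℝ : Rn n ≃ₗᵢ[ℝ] Rn n) := rfl
  rw [h, LinearIsometryEquiv.norm_iteratedFDeriv_comp_right]
  simpa using! le_seminorm ℂ k l φ (-x)

theorem supSeminorm_reflect_le (m : ℕ × ℕ) (φ : 𝓢(Rn n, ℂ)) :
    supSeminorm m (reflect φ) ≤ supSeminorm m φ := by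
  refine Seminorm.finset_sup_apply_le (apply_nonneg _ _) fun i hi => ?_
  refine (seminorm_reflect_le i.1 i.2 φ).trans ?_
  exact Seminorm.le_def.1 (Finset.le_sup (f := fun m : ℕ × ℕ => SchwartzMap.seminorm ℂ m.1 m.2) hi) φ

theorem exists_norm_conv_le (f : 𝓢'(Rn n, ℂ)) :
    ∃ (m : ℕ × ℕ) (C : ℝ), 0 < C ∧
      ∀ φ x, ‖conv φ f x‖ ≤ C * (1 + ‖x‖) ^ m.1 * supSeminorm m φ := by
  obtain ⟨m, C, hC, h⟩ := exists_norm_le_supSeminorm f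
  refine ⟨m, C * 2 ^ m.1, by positivity, fun φ x => ?_⟩
  calc ‖conv φ f x‖ ≤ C * supSeminorm m (translate x (reflect φ)) := h _
    _ ≤ C * ((1 + ‖x‖) ^ m.1 * (2 ^ m.1 * supSeminorm m φ)) := by
      gcongr
      refine (supSeminorm_translate_le m x _).trans ?_
      gcongr
      exact supSeminorm_reflect_le m φ
    _ = _ := by ring

/-! ### Embedding of the Schwartz space into a Banach space -/

theorem norm_weightedDerivAux_le (k : ℕ) {l : ℕ} (v : Fin l → Fin n) (φ : 𝓢(Rn n, ℂ)) (y : Rn n) :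
    ‖(‖y‖ ^ k : ℝ) • (∂^{fun i => (EuclideanSpace.single (v i) (1 : ℝ) : Rn n)} φ) y‖ ≤
      SchwartzMap.seminorm ℂ k l φ := by
  rw [norm_smul, norm_pow, norm_norm, iteratedLineDerivOp_eq_iteratedFDeriv]
  refine le_trans ?_ (le_seminorm ℂ k l φ y)
  gcongr
  simpa using (iteratedFDeriv ℝ l φ y).le_opNorm
    (fun i => (EuclideanSpace.single (v i) (1 : ℝ) : Rn n))

/-- The weighted partial derivative `‖y‖ ^ k • ∂_{v_1} … ∂_{v_l} φ(y)` along basis vectors, as a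
bounded continuous function. -/
def weightedDeriv (k : ℕ) {l : ℕ} (v : Fin l → Fin n) (φ : 𝓢(Rn n, ℂ)) : Rn n →ᵇ ℂ :=
  BoundedContinuousFunction.ofNormedAddCommGroup
    (fun y => (‖y‖ ^ k : ℝ) • (∂^{fun i => (EuclideanSpace.single (v i) (1 : ℝ) : Rn n)} φ) y)
    ((continuous_norm.pow k).smul (SchwartzMap.continuous _))
    (SchwartzMap.seminorm ℂ k l φ) (norm_weightedDerivAux_le k v φ)

theorem weightedDeriv_apply (k : ℕ) {l : ℕ} (v : Fin l → Fin n) (φ : 𝓢(Rn n, ℂ)) (y : Rn n) :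
    weightedDeriv k v φ y =
      (‖y‖ ^ k : ℝ) • (∂^{fun i => (EuclideanSpace.single (v i) (1 : ℝ) : Rn n)} φ) y := rfl

theorem norm_multilinear_le_sum {l : ℕ} (A : ContinuousMultilinearMap ℝ (fun _ : Fin l => Rn n) ℂ) :
    ‖A‖ ≤ ∑ v : Fin l → Fin n, ‖A fun i => (EuclideanSpace.single (v i) (1 : ℝ) : Rn n)‖ := by
  refine A.opNorm_le_bound (Finset.sum_nonneg fun _ _ => norm_nonneg _) fun w => ?_
  have h1 : A w = ∑ v : Fin l → Fin n, (∏ i, w i (v i)) •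
      A fun i => (EuclideanSpace.single (v i) (1 : ℝ) : Rn n) := by
    have h2 : w = fun i => ∑ j, w i j • (EuclideanSpace.single j (1 : ℝ) : Rn n) := by
      ext i k
      simp [Finset.sum_apply, Pi.single_apply]
    conv_lhs => rw [h2]
    rw [A.map_sum]
    refine Finset.sum_congr rfl fun v _ => ?_
    exact A.map_smul_univ (fun i => w i (v i)) _
  rw [h1, Finset.sum_mul]
  refine (norm_sum_le _ _).trans (Finset.sum_le_sum fun v _ => ?_)
  rw [norm_smul, mul_comm, norm_prod]
  gcongr with i
  exact PiLp.norm_apply_le (w i) (v i)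

/-- The Banach space of tuples of weighted derivatives. -/
abbrev JetSpace (n : ℕ) (m : ℕ × ℕ) := (Σ i : Finset.Iic m, (Fin i.1.2 → Fin n)) → (Rn n →ᵇ ℂ)

/-- The embedding of the Schwartz space into the space of jets. -/
def jet (m : ℕ × ℕ) : 𝓢(Rn n, ℂ) →ₗ[ℂ] JetSpace n m where
  toFun φ i := weightedDeriv i.1.1.1 i.2 φ
  map_add' φ ψ := by
    ext i y
    simp only [Pi.add_apply, BoundedContinuousFunction.add_apply, weightedDeriv_apply,
      LineDeriv.iteratedLineDerivOp_add, add_apply, smul_add]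
  map_smul' c φ := by
    ext i y
    simp only [Pi.smul_apply, BoundedContinuousFunction.smul_apply, weightedDeriv_apply,
      RingHom.id_apply, LineDeriv.iteratedLineDerivOp_smul, smul_apply]
    rw [smul_comm c]

theorem norm_jet_le (m : ℕ × ℕ) (φ : 𝓢(Rn n, ℂ)) : ‖jet m φ‖ ≤ supSeminorm m φ := by
  refine (pi_norm_le_iff_of_nonneg (apply_nonneg _ _)).2 fun i => ?_
  refine le_trans (b := SchwartzMap.seminorm ℂ i.1.1.1 i.1.1.2 φ)
    ((BoundedContinuousFunction.norm_le (apply_nonneg _ _)).2 fun y =>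
      norm_weightedDerivAux_le _ _ φ y) ?_
  exact Seminorm.le_def.1
    (Finset.le_sup (f := fun m : ℕ × ℕ => SchwartzMap.seminorm ℂ m.1 m.2) i.1.2) φ

/-- Together with `norm_jet_le` this makes the jet norm equivalent to the Schwartz norm. The factor
counts the tuples of basis vectors on which a multilinear form is evaluated. -/
theorem supSeminorm_le_norm_jet (m : ℕ × ℕ) (φ : 𝓢(Rn n, ℂ)) :
    supSeminorm m φ ≤ ((n : ℝ) + 1) ^ m.2 * ‖jet m φ‖ := by
  refine Seminorm.finset_sup_apply_le (by positivity) fun i hi => ?_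
  refine seminorm_le_bound ℂ i.1 i.2 _ (by positivity) fun y => ?_
  calc ‖y‖ ^ i.1 * ‖iteratedFDeriv ℝ i.2 φ y‖
      ≤ ‖y‖ ^ i.1 * ∑ v : Fin i.2 → Fin n, ‖iteratedFDeriv ℝ i.2 φ y
          fun k => (EuclideanSpace.single (v k) (1 : ℝ) : Rn n)‖ := by
        gcongr
        exact norm_multilinear_le_sum _
    _ = ∑ v : Fin i.2 → Fin n, ‖weightedDeriv i.1 v φ y‖ := by
        rw [Finset.mul_sum]
        refine Finset.sum_congr rfl fun v _ => ?_
        rw [weightedDeriv_apply, norm_smul, norm_pow, norm_norm,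
          iteratedLineDerivOp_eq_iteratedFDeriv]
    _ ≤ ∑ v : Fin i.2 → Fin n, ‖jet m φ‖ := by
        refine Finset.sum_le_sum fun v _ => ?_
        exact ((weightedDeriv i.1 v φ).norm_coe_le_norm y).trans
          (norm_le_pi_norm (jet m φ) ⟨⟨i, hi⟩, v⟩)
    _ = (n : ℝ) ^ i.2 * ‖jet m φ‖ := by simp
    _ ≤ _ := by
        gcongr
        calc (n : ℝ) ^ i.2 ≤ ((n : ℝ) + 1) ^ i.2 := by gcongr; linarith
          _ ≤ _ := pow_le_pow_right₀ (by linarith [Nat.cast_nonneg (α := ℝ) n])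
            (Finset.mem_Iic.1 hi).2

theorem jet_injective (m : ℕ × ℕ) : Function.Injective (jet (n := n) m) := by
  rw [injective_iff_map_eq_zero]
  intro φ h
  have h0 := supSeminorm_le_norm_jet m φ
  rw [h, norm_zero, mul_zero] at h0
  have h1 : SchwartzMap.seminorm ℂ 0 0 φ ≤ supSeminorm m φ :=
    Seminorm.le_def.1 (Finset.le_sup (f := fun m : ℕ × ℕ => SchwartzMap.seminorm ℂ m.1 m.2)
      (b := ((0 : ℕ), (0 : ℕ))) (Finset.mem_Iic.2 (Prod.mk_le_mk.2 ⟨Nat.zero_le _, Nat.zero_le _⟩))) φ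
  ext x
  have h2 := norm_le_seminorm ℂ φ x
  simpa using h2.trans (h1.trans h0)

theorem continuous_supSeminorm (m : ℕ × ℕ) : Continuous (supSeminorm (n := n) m) := by
  have h : ∀ s : Finset (ℕ × ℕ),
      Continuous (s.sup (fun m : ℕ × ℕ => SchwartzMap.seminorm ℂ m.1 m.2) :
        Seminorm ℂ 𝓢(Rn n, ℂ)) := by
    intro s
    induction s using Finset.cons_induction with
    | empty => simpa using! continuous_const
    | cons i s hi ih =>
      rw [Finset.sup_cons]
      exact ((schwartz_withSeminorms ℂ (Rn n) ℂ).continuous_seminorm i).sup ih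
  exact h _

theorem continuous_jet (m : ℕ × ℕ) : Continuous (jet (n := n) m) := by
  refine continuous_of_continuousAt_zero (jet m) ?_
  have h0 := (continuous_supSeminorm (n := n) m).tendsto 0
  rw [map_zero] at h0
  change Filter.Tendsto (jet m) (nhds 0) (nhds (jet m 0))
  rw [map_zero]
  exact squeeze_zero_norm (norm_jet_le m) h0

/-- A tempered distribution is bounded for one jet norm, so Hahn–Banach extends it from the image of
the Schwartz space to a Banach space. There it commutes with Bochner integrals, which is how it is
moved under a convolution integral. -/
theorem exists_extension_jet (f : 𝓢'(Rn n, ℂ)) :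
    ∃ (m : ℕ × ℕ) (G : JetSpace n m →L[ℂ] ℂ), ∀ φ, f φ = G (jet m φ) := by
  obtain ⟨m, C, hC, h⟩ := exists_norm_le_supSeminorm f
  let e := LinearEquiv.ofInjective (jet (n := n) m) (jet_injective m)
  let g : LinearMap.range (jet (n := n) m) →L[ℂ] ℂ :=
    ((f : 𝓢(Rn n, ℂ) →L[ℂ] ℂ).toLinearMap ∘ₗ e.symm.toLinearMap).mkContinuous
      (C * ((n : ℝ) + 1) ^ m.2) (fun x => by
      obtain ⟨φ, rfl⟩ := e.surjective x
      have : e.symm (e φ) = φ := e.symm_apply_apply φ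
      simp only [LinearMap.comp_apply, LinearEquiv.coe_coe, this]
      rw [mul_assoc]
      refine (h φ).trans ?_
      gcongr
      exact supSeminorm_le_norm_jet m φ)
  obtain ⟨G, hG, -⟩ := exists_extension_norm_eq _ g
  refine ⟨m, G, fun φ => ?_⟩
  have h1 := hG (e φ)
  have h2 : ((e φ : LinearMap.range (jet (n := n) m)) : JetSpace n m) = jet m φ := rfl
  rw [h2] at h1
  rw [h1]
  have : e.symm (e φ) = φ := e.symm_apply_apply φ
  change f φ = f (e.symm (e φ))
  rw [this]

/-! ### Convolution of a distribution with a convolution -/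

theorem integrable_one_add_norm_pow_mul (k : ℕ) (φ : 𝓢(Rn n, ℂ)) :
    Integrable fun z : Rn n => (1 + ‖z‖) ^ k * ‖φ z‖ := by
  have h1 : Integrable fun z : Rn n => 2 ^ (k - 1) * (‖φ z‖ + ‖z‖ ^ k * ‖φ z‖) :=
    (φ.integrable.norm.add (integrable_pow_mul volume φ k)).const_mul _
  refine h1.mono' (by fun_prop) (.of_forall fun z => ?_)
  rw [Real.norm_of_nonneg (by positivity)]
  calc (1 + ‖z‖) ^ k * ‖φ z‖ ≤ (2 ^ (k - 1) * (1 ^ k + ‖z‖ ^ k)) * ‖φ z‖ := by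
        gcongr
        exact add_pow_le zero_le_one (norm_nonneg _) k
    _ = _ := by rw [one_pow]; ring

theorem translate_iteratedLineDerivOp {l : ℕ} (v : Fin l → Rn n) (z : Rn n) (φ : 𝓢(Rn n, ℂ)) :
    ∂^{v} (translate z φ) = translate z (∂^{v} φ) := by
  induction l with
  | zero => simp
  | succ l ih =>
    rw [LineDeriv.iteratedLineDerivOp_succ_left, LineDeriv.iteratedLineDerivOp_succ_left, ih,
      lineDerivOp_translate]

theorem star_iteratedLineDerivOp {l : ℕ} (v : Fin l → Rn n) (φ ψ : 𝓢(Rn n, ℂ)) :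
    ∂^{v} (star φ ψ) = star (∂^{v} φ) ψ := by
  induction l with
  | zero => simp
  | succ l ih =>
    rw [LineDeriv.iteratedLineDerivOp_succ_left, LineDeriv.iteratedLineDerivOp_succ_left, ih,
      lineDerivOp_star]

/-- A tempered distribution may be moved under the integral that defines a convolution. -/
theorem apply_star (f : 𝓢'(Rn n, ℂ)) (φ ψ : 𝓢(Rn n, ℂ)) :
    f (star φ ψ) = ∫ z, ψ z * f (translate z φ) := by
  obtain ⟨m, G, hG⟩ := exists_extension_jet f
  have hint : Integrable fun z : Rn n => ψ z • jet m (translate z φ) := by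
    refine ((integrable_one_add_norm_pow_mul m.1 ψ).mul_const
      (2 ^ m.1 * supSeminorm m φ)).mono' ?_ (.of_forall fun z => ?_)
    -- Spaces of bounded continuous functions need not be separable, so strong measurability is
    -- taken from the second countable domain.
    · have : SecondCountableTopologyEither (Rn n) (JetSpace n m) := ⟨Or.inl inferInstance⟩
      exact (ψ.continuous.smul
        ((continuous_jet m).comp (continuous_translate φ))).aestronglyMeasurable
    · rw [norm_smul]
      calc ‖ψ z‖ * ‖jet m (translate z φ)‖
          ≤ ‖ψ z‖ * ((1 + ‖z‖) ^ m.1 * (2 ^ m.1 * supSeminorm m φ)) := by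
            gcongr
            exact (norm_jet_le m _).trans (supSeminorm_translate_le m z φ)
        _ = _ := by ring
  -- Point evaluations of the components separate jets, so the vector-valued identity reduces to the
  -- scalar formula for a derivative of a convolution.
  have key : jet m (star φ ψ) = ∫ z, ψ z • jet m (translate z φ) := by
    ext i y
    let E : JetSpace n m →L[ℂ] ℂ :=
      (BoundedContinuousFunction.evalCLM ℂ y).comp (ContinuousLinearMap.proj i)
    have hE : ∀ J : JetSpace n m, E J = J i y := fun J => rfl
    rw [← hE (∫ z, ψ z • jet m (translate z φ)), ← E.integral_comp_comm hint]
    simp only [hE]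
    change weightedDeriv _ _ _ y = ∫ z, ψ z • weightedDeriv _ _ _ y
    simp only [weightedDeriv_apply, translate_iteratedLineDerivOp, star_iteratedLineDerivOp,
      translate_apply, star_apply]
    rw [← integral_smul]
    refine integral_congr_ae (.of_forall fun z => ?_)
    simp only [smul_eq_mul, Complex.real_smul]
    ring
  rw [hG, key, ← G.integral_comp_comm hint]
  simp only [map_smul, hG, smul_eq_mul]

theorem conv_star (φ ψ : 𝓢(Rn n, ℂ)) (f : 𝓢'(Rn n, ℂ)) (x : Rn n) :
    conv (star φ ψ) f x = ∫ z, ψ z * conv φ f (x - z) := by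
  rw [conv_eq, reflect_star, translate_star, apply_star, ← integral_neg_eq_self]
  simp only [translate_translate, reflect_apply, neg_neg, conv_eq]
  refine integral_congr_ae (.of_forall fun z => ?_)
  simp only
  congr 4
  abel

/-- Pairing the functions `φ * f` and `ψ` amounts to pairing `ψ̃ * f` and `φ̃`. -/
theorem integral_conv_mul (φ ψ : 𝓢(Rn n, ℂ)) (f : 𝓢'(Rn n, ℂ)) :
    ∫ x, conv φ f x * ψ x = ∫ y, conv (reflect ψ) f y * φ (-y) := by
  -- Both sides are values at the origin of the distribution convolved with `φ` and `ψ̃`, taken in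
  -- the two orders.
  have h1 := conv_star φ (reflect ψ) f 0
  have h2 := conv_star (reflect ψ) φ f 0
  rw [star_comm, h2] at h1
  rw [← integral_neg_eq_self, ← integral_neg_eq_self (fun y => conv (reflect ψ) f y * φ (-y))]
  simp only [zero_sub, reflect_apply] at h1
  simp only [neg_neg]
  rw [integral_congr_ae (.of_forall fun z => mul_comm _ _), ← h1]
  exact integral_congr_ae (.of_forall fun z => mul_comm _ _)

theorem conv_star_dilate (φ ψ : 𝓢(Rn n, ℂ)) (f : 𝓢'(Rn n, ℂ)) (x : Rn n) (t : {t : ℝ // 0 < t}) :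
    conv (star φ (dilate t ψ)) f x = ∫ z, ψ z * conv φ f (x - (t : ℝ) • z) := by
  rw [conv_star]
  have h := pow_pos t.2 n
  have : (fun z => dilate t ψ z * conv φ f (x - z)) = fun z =>
      (fun z => ((((t : ℝ) ^ n)⁻¹ : ℝ) : ℂ) * (ψ z * conv φ f (x - (t : ℝ) • z)))
        ((t : ℝ)⁻¹ • z) := by
    ext z
    simp only [dilate_apply, smul_smul, mul_inv_cancel₀ t.2.ne', one_smul, Complex.real_smul]
    ring
  rw [this, Measure.integral_comp_inv_smul volume (fun z : Rn n =>
    ((((t : ℝ) ^ n)⁻¹ : ℝ) : ℂ) * (ψ z * conv φ f (x - (t : ℝ) • z))), integral_const_mul]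
  simp only [finrank_euclideanSpace, Fintype.card_fin, abs_of_pos h, Complex.real_smul]
  push_cast
  have h' : ((t : ℝ) : ℂ) ^ n ≠ 0 := by exact_mod_cast h.ne'
  field_simp

/-- Approximation of the identity. -/
theorem tendsto_conv_star_dilate (φ ψ : 𝓢(Rn n, ℂ)) (f : 𝓢'(Rn n, ℂ)) (x : Rn n)
    (u : ℕ → {t : ℝ // 0 < t}) (hu : Filter.Tendsto (fun k => (u k : ℝ)) Filter.atTop (nhds 0)) :
    Filter.Tendsto (fun k => conv (star φ (dilate (u k) ψ)) f x) Filter.atTop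
      (nhds ((∫ z, ψ z) * conv φ f x)) := by
  simp only [conv_star_dilate]
  rw [← integral_mul_const]
  obtain ⟨m, C, hC, h⟩ := exists_norm_conv_le f
  have hc := conv_continuous φ f
  refine tendsto_integral_filter_of_dominated_convergence
    (fun z => (1 + ‖z‖) ^ m.1 * ‖ψ z‖ * (C * (1 + ‖x‖) ^ m.1 * supSeminorm m φ))
    (.of_forall fun k => by fun_prop) ?_ ((integrable_one_add_norm_pow_mul m.1 ψ).mul_const _) ?_
  · filter_upwards [hu.eventually (gt_mem_nhds one_pos)] with k hk
    refine .of_forall fun z => ?_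
    rw [norm_mul]
    have h1 : (1 + ‖x - (u k : ℝ) • z‖) ≤ (1 + ‖z‖) * (1 + ‖x‖) := by
      have h2 : ‖(u k : ℝ) • z‖ ≤ ‖z‖ := by
        rw [norm_smul, Real.norm_of_nonneg (u k).2.le]
        nlinarith [norm_nonneg z]
      nlinarith [norm_sub_le x ((u k : ℝ) • z), norm_nonneg x, norm_nonneg z]
    calc ‖ψ z‖ * ‖conv φ f (x - (u k : ℝ) • z)‖
        ≤ ‖ψ z‖ * (C * ((1 + ‖z‖) * (1 + ‖x‖)) ^ m.1 * supSeminorm m φ) := by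
          gcongr
          refine (h φ _).trans ?_
          gcongr
      _ = _ := by rw [mul_pow]; ring
  · refine .of_forall fun z => ?_
    have h3 : Filter.Tendsto (fun k => x - (u k : ℝ) • z) Filter.atTop (nhds x) := by
      simpa using tendsto_const_nhds.sub (hu.smul_const z)
    exact ((hc.tendsto x).comp h3).const_mul _

/-! ### Linearity of convolution -/

theorem conv_add (φ ψ : 𝓢(Rn n, ℂ)) (f : 𝓢'(Rn n, ℂ)) (x : Rn n) :
    conv (φ + ψ) f x = conv φ f x + conv ψ f x := by
  simp only [conv_eq, reflect, map_add]

theorem conv_sub (φ ψ : 𝓢(Rn n, ℂ)) (f : 𝓢'(Rn n, ℂ)) (x : Rn n) :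
    conv (φ - ψ) f x = conv φ f x - conv ψ f x := by
  simp only [conv_eq, reflect, map_sub]

theorem conv_smul (c : ℂ) (φ : 𝓢(Rn n, ℂ)) (f : 𝓢'(Rn n, ℂ)) (x : Rn n) :
    conv (c • φ) f x = c * conv φ f x := by
  simp only [conv_eq, reflect, map_smul, smul_eq_mul]

theorem conv_sum {ι : Type*} (s : Finset ι) (φ : ι → 𝓢(Rn n, ℂ)) (f : 𝓢'(Rn n, ℂ)) (x : Rn n) :
    conv (∑ i ∈ s, φ i) f x = ∑ i ∈ s, conv (φ i) f x := by
  simp only [conv_eq, reflect, map_sum]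

theorem conv_translate (v : Rn n) (φ : 𝓢(Rn n, ℂ)) (f : 𝓢'(Rn n, ℂ)) (x : Rn n) :
    conv (translate v φ) f x = conv φ f (x - v) := by
  rw [conv_eq, conv_eq, reflect_translate, translate_translate, sub_eq_add_neg]

theorem conv_linComb (φ : 𝓢(Rn n, ℂ)) (f : ℤ → 𝓢'(Rn n, ℂ)) (s : Finset ℤ) (l : ℤ → ℂ) (x : Rn n) :
    conv φ (∑ j ∈ s, l j • f j) x = ∑ j ∈ s, l j * conv φ (f j) x := by
  simp only [conv_eq]
  induction s using Finset.cons_induction with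
  | empty => simp
  | cons j s hj ih =>
    rw [Finset.sum_cons, Finset.sum_cons, ← ih]
    rfl

/-! ### Weighted `L¹` norms -/

/-- The weighted norm `∫ (1 + |x|)^N |φ(x)| dx`. -/
def wNorm (N : ℕ) (φ : 𝓢(Rn n, ℂ)) : ℝ≥0∞ := ∫⁻ x, ENNReal.ofReal ((1 + ‖x‖) ^ N) * ‖φ x‖ₑ

/-- The weighted Sobolev norm `∑_{|α| ≤ m} ∫ (1 + |x|)^N |∂^α φ(x)| dx`. -/
def sobNorm (N m : ℕ) (φ : 𝓢(Rn n, ℂ)) : ℝ≥0∞ := ∑ α ∈ multiIdx n m, wNorm N (mixedDeriv α φ)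

theorem wNorm_eq (N : ℕ) (φ : 𝓢(Rn n, ℂ)) :
    wNorm N φ = ENNReal.ofReal (∫ x, (1 + ‖x‖) ^ N * ‖φ x‖) := by
  rw [ofReal_integral_eq_lintegral_ofReal (integrable_one_add_norm_pow_mul N φ)
    (.of_forall fun x => by positivity)]
  refine lintegral_congr fun x => ?_
  rw [ENNReal.ofReal_mul (by positivity), ofReal_norm]

theorem wNorm_ne_top (N : ℕ) (φ : 𝓢(Rn n, ℂ)) : wNorm N φ ≠ ∞ := by
  rw [wNorm_eq]
  exact ENNReal.ofReal_ne_top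

theorem sobNorm_ne_top (N m : ℕ) (φ : 𝓢(Rn n, ℂ)) : sobNorm N m φ ≠ ∞ :=
  ENNReal.sum_ne_top.2 fun _ _ => wNorm_ne_top _ _

theorem sobNorm_eq_frakN (N : ℕ) (φ : 𝓢(Rn n, ℂ)) :
    sobNorm N (N + 1) φ = ENNReal.ofReal (frakN N φ) := by
  unfold sobNorm frakN
  simp only [wNorm_eq, Finset.mul_sum]
  rw [integral_finsetSum _ fun α _ => integrable_one_add_norm_pow_mul N _,
    ENNReal.ofReal_sum_of_nonneg fun α _ => integral_nonneg fun x => by positivity]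

theorem wNorm_measurable (N : ℕ) (φ : 𝓢(Rn n, ℂ)) :
    Measurable fun x : Rn n => ENNReal.ofReal ((1 + ‖x‖) ^ N) * ‖φ x‖ₑ := by
  have := φ.continuous
  fun_prop

theorem wNorm_add_le (N : ℕ) (φ ψ : 𝓢(Rn n, ℂ)) : wNorm N (φ + ψ) ≤ wNorm N φ + wNorm N ψ := by
  unfold wNorm
  rw [← lintegral_add_left (wNorm_measurable N φ)]
  refine lintegral_mono fun x => ?_
  simp only
  rw [← mul_add]
  gcongr
  exact enorm_add_le _ _

theorem wNorm_smul (N : ℕ) (c : ℂ) (φ : 𝓢(Rn n, ℂ)) : wNorm N (c • φ) = ‖c‖ₑ * wNorm N φ := by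
  unfold wNorm
  rw [← lintegral_const_mul _ (wNorm_measurable N φ)]
  refine lintegral_congr fun x => ?_
  rw [smul_apply, enorm_smul]
  ring

theorem wNorm_sum_le {ι : Type*} (N : ℕ) (s : Finset ι) (φ : ι → 𝓢(Rn n, ℂ)) :
    wNorm N (∑ i ∈ s, φ i) ≤ ∑ i ∈ s, wNorm N (φ i) := by
  induction s using Finset.cons_induction with
  | empty => simp [wNorm]
  | cons i s hi ih =>
    rw [Finset.sum_cons, Finset.sum_cons]
    exact (wNorm_add_le _ _ _).trans (by gcongr)

theorem sobNorm_mono {N m m' : ℕ} (h : m ≤ m') (φ : 𝓢(Rn n, ℂ)) :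
    sobNorm N m φ ≤ sobNorm N m' φ := by
  refine Finset.sum_le_sum_of_subset fun α hα => ?_
  rw [mem_multiIdx] at hα ⊢
  exact hα.trans h

theorem wNorm_le_sobNorm (N m : ℕ) (φ : 𝓢(Rn n, ℂ)) : wNorm N φ ≤ sobNorm N m φ := by
  have h : mixedDeriv 0 φ = φ := by
    rw [mixedDeriv_eq]
    simp [mixedEnd]
  calc wNorm N φ = wNorm N (mixedDeriv 0 φ) := by rw [h]
    _ ≤ _ := Finset.single_le_sum (f := fun α => wNorm N (mixedDeriv α φ))
      (fun _ _ => zero_le) ((mem_multiIdx 0).2 (by simp))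

theorem sum_sobNorm_partial_le (N m : ℕ) (φ : 𝓢(Rn n, ℂ)) :
    ∑ α ∈ multiIdx n m, ∑ i, wNorm N (partialEnd i (mixedDeriv α φ)) ≤
      n * sobNorm N (m + 1) φ := by
  rw [Finset.sum_comm]
  calc ∑ i, ∑ α ∈ multiIdx n m, wNorm N (partialEnd i (mixedDeriv α φ))
      ≤ ∑ _i : Fin n, sobNorm N (m + 1) φ := by
        refine Finset.sum_le_sum fun i _ => ?_
        simp only [partialEnd_mixedDeriv]
        rw [← Finset.sum_image (s := multiIdx n m) (g := fun α => α + Pi.single i 1)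
          (f := fun β => wNorm N (mixedDeriv β φ)) (fun a _ b _ h => add_right_cancel h)]
        refine Finset.sum_le_sum_of_subset fun β hβ => ?_
        obtain ⟨α, hα, rfl⟩ := Finset.mem_image.1 hβ
        rw [mem_multiIdx] at hα ⊢
        simp only [Pi.add_apply, Finset.sum_add_distrib, Finset.sum_pi_single', Finset.mem_univ,
          if_true]
        omega
    _ = n * sobNorm N (m + 1) φ := by simp

theorem wNorm_translate_le (N : ℕ) (z : Rn n) (φ : 𝓢(Rn n, ℂ)) :
    wNorm N (translate z φ) ≤ ENNReal.ofReal ((1 + ‖z‖) ^ N) * wNorm N φ := by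
  unfold wNorm
  rw [← lintegral_add_right_eq_self _ z, ← lintegral_const_mul _ (wNorm_measurable N φ)]
  refine lintegral_mono fun x => ?_
  simp only [translate_apply, add_sub_cancel_right]
  rw [← mul_assoc, ← ENNReal.ofReal_mul (by positivity), ← mul_pow]
  gcongr
  nlinarith [norm_add_le x z, norm_nonneg x, norm_nonneg z]

theorem norm_fderiv_apply_le (φ : 𝓢(Rn n, ℂ)) (y z : Rn n) :
    ‖fderiv ℝ φ y z‖ ≤ ‖z‖ * ∑ i, ‖partialEnd i φ y‖ := by
  have h2 : z = ∑ j, z j • (EuclideanSpace.single j (1 : ℝ) : Rn n) := by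
    ext k
    simp [Finset.sum_apply, Pi.single_apply]
  conv_lhs => rw [h2]
  rw [map_sum, Finset.mul_sum]
  refine (norm_sum_le _ _).trans (Finset.sum_le_sum fun i _ => ?_)
  rw [map_smul, norm_smul, partialEnd_apply, lineDerivOp_apply_eq_fderiv]
  gcongr
  exact PiLp.norm_apply_le z i

/-- Fundamental theorem of calculus along the segment. It is kept as an integral, rather than a
supremum, so that Fubini turns it into an `L¹` estimate. -/
theorem enorm_sub_translate_le (φ : 𝓢(Rn n, ℂ)) (x z : Rn n) :
    ‖φ x - φ (x - z)‖ₑ ≤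
      ∫⁻ θ in Set.Icc (0 : ℝ) 1, ENNReal.ofReal ‖z‖ * ∑ i, ‖partialEnd i φ (x - θ • z)‖ₑ := by
  have hd : ∀ θ : ℝ, HasDerivAt (fun θ : ℝ => φ (x - θ • z)) (-(fderiv ℝ φ (x - θ • z) z)) θ := by
    intro θ
    have h1 : HasDerivAt (fun θ : ℝ => x - θ • z) (-z) θ := by
      simpa using ((hasDerivAt_id θ).smul_const z).const_sub x
    have h2 := (φ.differentiableAt (x := x - θ • z)).hasFDerivAt.comp_hasDerivAt θ h1
    rw [map_neg] at h2
    exact h2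
  have hcont : Continuous fun θ : ℝ => -(fderiv ℝ φ (x - θ • z) z) := by
    have h1 : Continuous (fderiv ℝ φ) := (φ.smooth 1).continuous_fderiv one_ne_zero
    fun_prop
  have h3 := intervalIntegral.integral_eq_sub_of_hasDerivAt (a := 0) (b := 1)
    (fun θ _ => hd θ) (hcont.intervalIntegrable 0 1)
  simp only [one_smul, zero_smul, sub_zero] at h3
  rw [← neg_sub, ← h3, enorm_neg, intervalIntegral.integral_of_le zero_le_one,
    ← integral_Icc_eq_integral_Ioc]
  refine (enorm_integral_le_lintegral_enorm _).trans (lintegral_mono fun θ => ?_)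
  have h4 := norm_fderiv_apply_le φ (x - θ • z) z
  rw [enorm_neg, ← ofReal_norm]
  refine (ENNReal.ofReal_le_ofReal h4).trans (le_of_eq ?_)
  rw [ENNReal.ofReal_mul (norm_nonneg _), ENNReal.ofReal_sum_of_nonneg fun _ _ => norm_nonneg _]
  simp only [ofReal_norm]

theorem wNorm_sub_translate_le (N : ℕ) (z : Rn n) (φ : 𝓢(Rn n, ℂ)) :
    wNorm N (φ - translate z φ) ≤
      ENNReal.ofReal (‖z‖ * (1 + ‖z‖) ^ N) * ∑ i, wNorm N (partialEnd i φ) := by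
  have hc : ∀ i, Continuous (partialEnd i φ) := fun i => SchwartzMap.continuous _
  have hmeas : Measurable (Function.uncurry fun (x : Rn n) (θ : ℝ) =>
      ENNReal.ofReal ((1 + ‖x‖) ^ N) *
        (ENNReal.ofReal ‖z‖ * ∑ i, ‖partialEnd i φ (x - θ • z)‖ₑ)) := by
    unfold Function.uncurry
    refine Measurable.mul (by fun_prop) (Measurable.const_mul ?_ _)
    refine Finset.measurable_fun_sum _ fun i _ => ?_
    have : Continuous fun a : Rn n × ℝ => partialEnd i φ (a.1 - a.2 • z) :=
      (hc i).comp (by fun_prop)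
    exact this.measurable.enorm
  calc wNorm N (φ - translate z φ)
      ≤ ∫⁻ x, ∫⁻ θ in Set.Icc (0 : ℝ) 1, ENNReal.ofReal ((1 + ‖x‖) ^ N) *
          (ENNReal.ofReal ‖z‖ * ∑ i, ‖partialEnd i φ (x - θ • z)‖ₑ) := by
        refine lintegral_mono fun x => ?_
        rw [lintegral_const_mul' _ _ ENNReal.ofReal_ne_top]
        gcongr
        exact enorm_sub_translate_le φ x z
    _ = ∫⁻ θ in Set.Icc (0 : ℝ) 1, ∫⁻ x, ENNReal.ofReal ((1 + ‖x‖) ^ N) *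
          (ENNReal.ofReal ‖z‖ * ∑ i, ‖partialEnd i φ (x - θ • z)‖ₑ) :=
        lintegral_lintegral_swap hmeas.aemeasurable
    _ ≤ ∫⁻ θ in Set.Icc (0 : ℝ) 1, ENNReal.ofReal (‖z‖ * (1 + ‖z‖) ^ N) *
          ∑ i, wNorm N (partialEnd i φ) := by
        refine setLIntegral_mono' measurableSet_Icc fun θ hθ => ?_
        have e1 : ∫⁻ x, ENNReal.ofReal ((1 + ‖x‖) ^ N) *
            (ENNReal.ofReal ‖z‖ * ∑ i, ‖partialEnd i φ (x - θ • z)‖ₑ) =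
            ENNReal.ofReal ‖z‖ * ∑ i, wNorm N (translate (θ • z) (partialEnd i φ)) := by
          unfold wNorm
          rw [← lintegral_finsetSum _ fun i _ => wNorm_measurable _ _,
            ← lintegral_const_mul _ (Finset.measurable_fun_sum _ fun i _ => wNorm_measurable _ _)]
          refine lintegral_congr fun x => ?_
          rw [mul_left_comm, Finset.mul_sum]
          rfl
        rw [e1, ENNReal.ofReal_mul (norm_nonneg _), mul_assoc]
        gcongr
        rw [Finset.mul_sum]
        gcongr with i
        refine (wNorm_translate_le N _ _).trans ?_
        gcongr
        rw [norm_smul, Real.norm_of_nonneg hθ.1]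
        nlinarith [hθ.2, norm_nonneg z]
    _ = _ := by simp

theorem sobNorm_sub_translate_le (N m : ℕ) (z : Rn n) (φ : 𝓢(Rn n, ℂ)) :
    sobNorm N m (φ - translate z φ) ≤
      ENNReal.ofReal (‖z‖ * (1 + ‖z‖) ^ N) * (n * sobNorm N (m + 1) φ) := by
  calc sobNorm N m (φ - translate z φ)
      ≤ ∑ α ∈ multiIdx n m, ENNReal.ofReal (‖z‖ * (1 + ‖z‖) ^ N) *
          ∑ i, wNorm N (partialEnd i (mixedDeriv α φ)) := by
        refine Finset.sum_le_sum fun α _ => ?_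
        rw [mixedDeriv_sub, mixedDeriv_translate]
        exact wNorm_sub_translate_le N z _
    _ ≤ _ := by
        rw [← Finset.mul_sum]
        gcongr
        exact sum_sobNorm_partial_le N m φ

/-- Since `ψ` has integral one, `φ - φ * ψ` is the average of the differences `φ - φ(· - z)` against
`ψ(z) dz`; Fubini then reduces to a single translation. -/
theorem wNorm_sub_star_le (N : ℕ) (φ ψ : 𝓢(Rn n, ℂ)) (hψ : ∫ z, ψ z = 1) :
    wNorm N (φ - star φ ψ) ≤
      (∫⁻ z, ‖ψ z‖ₑ * ENNReal.ofReal (‖z‖ * (1 + ‖z‖) ^ N)) * ∑ i, wNorm N (partialEnd i φ) := by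
  have h1 : ∀ x, ‖(φ - star φ ψ) x‖ₑ ≤ ∫⁻ z, ‖ψ z‖ₑ * ‖(φ - translate z φ) x‖ₑ := by
    intro x
    have e1 : Integrable fun z => ψ z * φ (x - z) := by
      refine (ψ.integrable.mul_const (SchwartzMap.seminorm ℂ 0 0 φ : ℂ)).mono
        (by have := ψ.continuous; have := φ.continuous; fun_prop) (.of_forall fun z => ?_)
      rw [norm_mul, norm_mul]
      gcongr
      refine (norm_le_seminorm ℂ φ _).trans ?_
      rw [Complex.norm_real]
      exact le_abs_self _
    have e2 : (φ - star φ ψ) x = ∫ z, ψ z * (φ - translate z φ) x := by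
      simp only [sub_apply, translate_apply, mul_sub, star_apply]
      rw [integral_sub (ψ.integrable.mul_const _) e1, integral_mul_const, hψ, one_mul]
    rw [e2]
    refine (enorm_integral_le_lintegral_enorm _).trans (le_of_eq ?_)
    simp only [enorm_mul]
  have hmeas : Measurable (Function.uncurry fun (x z : Rn n) =>
      ENNReal.ofReal ((1 + ‖x‖) ^ N) * (‖ψ z‖ₑ * ‖(φ - translate z φ) x‖ₑ)) := by
    simp only [sub_apply, translate_apply]
    unfold Function.uncurry
    have := ψ.continuous
    have := φ.continuous
    fun_prop
  calc wNorm N (φ - star φ ψ)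
      ≤ ∫⁻ x, ∫⁻ z, ENNReal.ofReal ((1 + ‖x‖) ^ N) * (‖ψ z‖ₑ * ‖(φ - translate z φ) x‖ₑ) := by
        refine lintegral_mono fun x => ?_
        rw [lintegral_const_mul' _ _ ENNReal.ofReal_ne_top]
        gcongr
        exact h1 x
    _ = ∫⁻ z, ∫⁻ x, ENNReal.ofReal ((1 + ‖x‖) ^ N) * (‖ψ z‖ₑ * ‖(φ - translate z φ) x‖ₑ) :=
        lintegral_lintegral_swap hmeas.aemeasurable
    _ ≤ ∫⁻ z, ‖ψ z‖ₑ * ENNReal.ofReal (‖z‖ * (1 + ‖z‖) ^ N) *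
          ∑ i, wNorm N (partialEnd i φ) := by
        refine lintegral_mono fun z => ?_
        simp only [mul_left_comm _ ‖ψ z‖ₑ]
        rw [lintegral_const_mul' _ _ enorm_ne_top, mul_assoc]
        gcongr
        exact wNorm_sub_translate_le N z φ
    _ = _ := lintegral_mul_const' _ _ (ENNReal.sum_ne_top.2 fun _ _ => wNorm_ne_top _ _)

/-! ### Dilated kernels and the smoothing defect `φ - φ * Φ_s` -/

theorem lintegral_dilate (t : {t : ℝ // 0 < t}) {F : Rn n → ℝ≥0∞} (hF : Measurable F)
    (φ : 𝓢(Rn n, ℂ)) :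
    ∫⁻ z, ‖dilate t φ z‖ₑ * F z = ∫⁻ w, ‖φ w‖ₑ * F ((t : ℝ) • w) := by
  have ht := pow_pos t.2 n
  set G : Rn n → ℝ≥0∞ := fun w => ‖φ w‖ₑ * F ((t : ℝ) • w) with hG
  have hGm : Measurable G := by
    have := φ.continuous
    fun_prop
  have e1 : ∀ z : Rn n, ‖dilate t φ z‖ₑ * F z =
      ENNReal.ofReal (((t : ℝ) ^ n)⁻¹) * G ((t : ℝ)⁻¹ • z) := by
    intro z
    simp only [hG, dilate_apply, smul_smul, mul_inv_cancel₀ t.2.ne', one_smul, enorm_smul]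
    rw [mul_assoc, Real.enorm_of_nonneg (by positivity)]
  simp only [e1]
  rw [lintegral_const_mul' _ _ ENNReal.ofReal_ne_top,
    ← lintegral_map (μ := volume) hGm (measurable_const_smul (t : ℝ)⁻¹),
    Measure.map_addHaar_smul _ (inv_ne_zero t.2.ne'), lintegral_smul_measure, smul_eq_mul,
    ← mul_assoc, ← ENNReal.ofReal_mul (by positivity)]
  have : ((t : ℝ) ^ n)⁻¹ * |(((t : ℝ)⁻¹) ^ Module.finrank ℝ (Rn n))⁻¹| = 1 := by
    rw [finrank_euclideanSpace, Fintype.card_fin, inv_pow, inv_inv, abs_of_pos ht,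
      inv_mul_cancel₀ ht.ne']
  rw [this, ENNReal.ofReal_one, one_mul]

/-- The single factor `‖z‖` scales to `s ‖w‖` and produces the gain; `s ≤ 1` is used to discard the
scale in the remaining weight. -/
theorem lintegral_dilate_mul_norm_le (N : ℕ) (Φ : 𝓢(Rn n, ℂ)) (s : {t : ℝ // 0 < t})
    (hs : (s : ℝ) ≤ 1) :
    ∫⁻ z, ‖dilate s Φ z‖ₑ * ENNReal.ofReal (‖z‖ * (1 + ‖z‖) ^ N) ≤
      ENNReal.ofReal s * wNorm (N + 1) Φ := by
  rw [lintegral_dilate s (F := fun z => ENNReal.ofReal (‖z‖ * (1 + ‖z‖) ^ N)) (by fun_prop)]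
  unfold wNorm
  rw [← lintegral_const_mul _ (wNorm_measurable _ Φ)]
  refine lintegral_mono fun w => ?_
  simp only
  rw [← mul_assoc, mul_comm, ← ENNReal.ofReal_mul s.2.le]
  refine mul_le_mul' (ENNReal.ofReal_le_ofReal ?_) le_rfl
  rw [norm_smul, Real.norm_of_nonneg s.2.le, mul_assoc, pow_succ']
  have h1 : (s : ℝ) * ‖w‖ ≤ ‖w‖ := by nlinarith [norm_nonneg w]
  refine mul_le_mul_of_nonneg_left ?_ s.2.le
  have := norm_nonneg w
  have := s.2
  gcongr
  linarith

/-- `D_s φ = φ - φ * Φ_s` -/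
def diffEnd (Φ : 𝓢(Rn n, ℂ)) (s : {t : ℝ // 0 < t}) : Module.End ℂ 𝓢(Rn n, ℂ) :=
  1 - starEnd (dilate s Φ)

theorem diffEnd_apply (Φ φ : 𝓢(Rn n, ℂ)) (s : {t : ℝ // 0 < t}) :
    diffEnd Φ s φ = φ - star φ (dilate s Φ) := by
  unfold diffEnd
  rw [LinearMap.sub_apply, starEnd_apply, Module.End.one_apply]

/-- The engine of the reproducing formula: one application of `D_s` trades one derivative for a
factor `s`. Derivatives commute with `D_s`, so the estimate iterates. -/
theorem sobNorm_diffEnd_le (N m : ℕ) (Φ φ : 𝓢(Rn n, ℂ)) (hΦ : ∫ z, Φ z = 1)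
    (s : {t : ℝ // 0 < t}) (hs : (s : ℝ) ≤ 1) :
    sobNorm N m (diffEnd Φ s φ) ≤
      ENNReal.ofReal s * (wNorm (N + 1) Φ * n) * sobNorm N (m + 1) φ := by
  calc sobNorm N m (diffEnd Φ s φ)
      ≤ ∑ α ∈ multiIdx n m, (ENNReal.ofReal s * wNorm (N + 1) Φ) *
          ∑ i, wNorm N (partialEnd i (mixedDeriv α φ)) := by
        refine Finset.sum_le_sum fun α _ => ?_
        rw [diffEnd_apply, mixedDeriv_sub, mixedDeriv_star]
        refine (wNorm_sub_star_le N _ _ (by rw [integral_dilate, hΦ])).trans ?_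
        gcongr
        exact lintegral_dilate_mul_norm_le N Φ s hs
    _ ≤ (ENNReal.ofReal s * wNorm (N + 1) Φ) * (n * sobNorm N (m + 1) φ) := by
        rw [← Finset.mul_sum]
        gcongr
        exact sum_sobNorm_partial_le N m φ
    _ = _ := by ring

theorem sobNorm_diffEnd_pow_le (N m : ℕ) (Φ : 𝓢(Rn n, ℂ)) (hΦ : ∫ z, Φ z = 1)
    (s : {t : ℝ // 0 < t}) (hs : (s : ℝ) ≤ 1) (i : ℕ) (φ : 𝓢(Rn n, ℂ)) :
    sobNorm N m ((diffEnd Φ s ^ i) φ) ≤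
      (ENNReal.ofReal s * (wNorm (N + 1) Φ * n)) ^ i * sobNorm N (m + i) φ := by
  induction i generalizing φ with
  | zero => simp
  | succ i ih =>
    rw [pow_succ, Module.End.mul_apply]
    refine (ih _).trans ?_
    rw [pow_succ, mul_assoc]
    gcongr
    exact sobNorm_diffEnd_le N (m + i) Φ φ hΦ s hs

/-! ### Reproducing formula -/

/-- The dyadic scale `2^{-k}`. -/
def dyad (k : ℕ) : {t : ℝ // 0 < t} := ⟨(1 / 2) ^ k, by positivity⟩

theorem dyad_val (k : ℕ) : (dyad k : ℝ) = (1 / 2) ^ k := rfl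

theorem dyad_le_one (k : ℕ) : (dyad k : ℝ) ≤ 1 := pow_le_one₀ (by norm_num) (by norm_num)

theorem dyad_succ_le (k : ℕ) : (dyad (k + 1) : ℝ) ≤ dyad k :=
  pow_le_pow_of_le_one (by norm_num) (by norm_num) (Nat.le_succ k)

theorem tendsto_dyad : Filter.Tendsto (fun k => (dyad k : ℝ)) Filter.atTop (nhds 0) :=
  tendsto_pow_atTop_nhds_zero_of_lt_one (by norm_num) (by norm_num)

theorem diffEnd_commute (Φ : 𝓢(Rn n, ℂ)) (s t : {t : ℝ // 0 < t}) :
    Commute (diffEnd Φ s) (diffEnd Φ t) :=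
  (Commute.one_left _).sub_left ((Commute.one_right _).sub_right (starEnd_commute _ _))

/-- The coefficient of the increment between the scales `s` and `t` in the reproducing formula. -/
def thetaEnd (Φ : 𝓢(Rn n, ℂ)) (L : ℕ) (s t : {t : ℝ // 0 < t}) : Module.End ℂ 𝓢(Rn n, ℂ) :=
  ∑ i ∈ Finset.range L, diffEnd Φ s ^ i * diffEnd Φ t ^ (L - 1 - i)

/-- Factorisation of `a^L - b^L` for commuting operators, with `D_s - D_t` equal to convolution with
`Φ_t - Φ_s`. Thus each increment is again a convolution with a dilate of `Φ`. -/
theorem diffEnd_pow_sub (Φ : 𝓢(Rn n, ℂ)) (L : ℕ) (s t : {t : ℝ // 0 < t}) :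
    diffEnd Φ s ^ L - diffEnd Φ t ^ L =
      starEnd (dilate t Φ) * thetaEnd Φ L s t - starEnd (dilate s Φ) * thetaEnd Φ L s t := by
  have h := (diffEnd_commute Φ s t).mul_geom_sum₂ L
  rw [← h, ← sub_mul]
  congr 1
  unfold diffEnd
  abel

theorem one_sub_diffEnd_pow (Φ : 𝓢(Rn n, ℂ)) (L : ℕ) (s : {t : ℝ // 0 < t}) :
    1 - diffEnd Φ s ^ L =
      starEnd (dilate s Φ) * ∑ i ∈ Finset.range L, diffEnd Φ s ^ i := by
  rw [← mul_neg_geom_sum]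
  congr 1
  unfold diffEnd
  abel

/-- Telescoping sum of `D_s^L` over the dyadic scales down to `2^{-K}`; the last term is the
remainder, which disappears as `K` grows when paired with a distribution. -/
theorem reproducing_formula (Φ : 𝓢(Rn n, ℂ)) (L K : ℕ) (φ : 𝓢(Rn n, ℂ)) :
    φ = star ((∑ i ∈ Finset.range L, diffEnd Φ (dyad 0) ^ i) φ) (dilate (dyad 0) Φ) +
      ∑ k ∈ Finset.range K,
        (star (thetaEnd Φ L (dyad k) (dyad (k + 1)) φ) (dilate (dyad (k + 1)) Φ) -
          star (thetaEnd Φ L (dyad k) (dyad (k + 1)) φ) (dilate (dyad k) Φ)) +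
      (diffEnd Φ (dyad K) ^ L) φ := by
  have h1 := congrArg (fun T : Module.End ℂ 𝓢(Rn n, ℂ) => T φ)
    (one_sub_diffEnd_pow Φ L (dyad 0))
  have h2 : ∀ k, (diffEnd Φ (dyad k) ^ L) φ - (diffEnd Φ (dyad (k + 1)) ^ L) φ =
      star (thetaEnd Φ L (dyad k) (dyad (k + 1)) φ) (dilate (dyad (k + 1)) Φ) -
          star (thetaEnd Φ L (dyad k) (dyad (k + 1)) φ) (dilate (dyad k) Φ) := by
    intro k
    have := congrArg (fun T : Module.End ℂ 𝓢(Rn n, ℂ) => T φ)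
      (diffEnd_pow_sub Φ L (dyad k) (dyad (k + 1)))
    simpa only [LinearMap.sub_apply, Module.End.mul_apply, starEnd_apply] using this
  simp only [LinearMap.sub_apply, Module.End.mul_apply, starEnd_apply, Module.End.one_apply] at h1
  simp only [← h2, Finset.sum_range_sub']
  rw [← h1]
  abel

/-- Convolution powers. -/
def starPow (Φ : 𝓢(Rn n, ℂ)) : ℕ → 𝓢(Rn n, ℂ)
  | 0 => Φ
  | i + 1 => star (starPow Φ i) Φ

theorem integral_star (φ ψ : 𝓢(Rn n, ℂ)) : ∫ x, star φ ψ x = (∫ x, φ x) * ∫ x, ψ x := by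
  have h := fourier_star_apply φ ψ 0
  simpa [fourier_coe, Real.fourier_eq] using h

theorem integral_starPow (Φ : 𝓢(Rn n, ℂ)) (hΦ : ∫ z, Φ z = 1) (i : ℕ) :
    ∫ x, starPow Φ i x = 1 := by
  induction i with
  | zero => exact hΦ
  | succ i ih => rw [starPow, integral_star, ih, hΦ, one_mul]

theorem starEnd_pow_apply (Φ φ : 𝓢(Rn n, ℂ)) (s : {t : ℝ // 0 < t}) (i : ℕ) :
    (starEnd (dilate s Φ) ^ (i + 1)) φ = star φ (dilate s (starPow Φ i)) := by
  induction i with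
  | zero => rw [zero_add, pow_one, starEnd_apply, starPow]
  | succ i ih =>
    rw [pow_succ', Module.End.mul_apply, ih, starEnd_apply, star_assoc, starPow, dilate_star]

/-- Repeated convolution with `Φ_s` is one convolution with the dilate of a convolution power of
`Φ`, which still has integral one and is therefore an approximate identity. -/
theorem tendsto_conv_starEnd_pow (Φ φ : 𝓢(Rn n, ℂ)) (hΦ : ∫ z, Φ z = 1) (f : 𝓢'(Rn n, ℂ))
    (t : {t : ℝ // 0 < t}) (y : Rn n) (i : ℕ) :
    Filter.Tendsto (fun k => conv (dilate t ((starEnd (dilate (dyad k) Φ) ^ i) φ)) f y)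
      Filter.atTop (nhds (conv (dilate t φ) f y)) := by
  cases i with
  | zero => simp
  | succ i =>
    simp only [starEnd_pow_apply, dilate_star, dilate_dilate]
    have h := tendsto_conv_star_dilate (dilate t φ) (starPow Φ i) f y (fun k => t * dyad k) (by
      simpa using tendsto_dyad.const_mul (t : ℝ))
    rwa [integral_starPow Φ hΦ, one_mul] at h

theorem tendsto_conv_diffEnd_pow (Φ φ : 𝓢(Rn n, ℂ)) (hΦ : ∫ z, Φ z = 1) (f : 𝓢'(Rn n, ℂ))
    (t : {t : ℝ // 0 < t}) (y : Rn n) {L : ℕ} (hL : L ≠ 0) :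
    Filter.Tendsto (fun k => conv (dilate t ((diffEnd Φ (dyad k) ^ L) φ)) f y)
      Filter.atTop (nhds 0) := by
  -- The extra power `j` makes the induction close: raising `L` by one subtracts the cases `j` and
  -- `j + 1`, which have the same limit.
  have key : ∀ L j : ℕ, Filter.Tendsto (fun k => conv (dilate t
      ((starEnd (dilate (dyad k) Φ) ^ j * diffEnd Φ (dyad k) ^ L) φ)) f y)
      Filter.atTop (nhds (if L = 0 then conv (dilate t φ) f y else 0)) := by
    intro L
    induction L with
    | zero => intro j; simpa using tendsto_conv_starEnd_pow Φ φ hΦ f t y j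
    | succ L ih =>
      intro j
      have h := (ih j).sub (ih (j + 1))
      rw [sub_self] at h
      simp only [Nat.add_one_ne_zero, if_false]
      refine h.congr fun k => ?_
      rw [← conv_sub, ← dilateLM_apply, ← dilateLM_apply, ← dilateLM_apply, ← map_sub,
        ← LinearMap.sub_apply]
      congr 3
      rw [pow_succ (starEnd _), pow_succ' (diffEnd _ _), mul_assoc, ← mul_sub]
      congr 1
  have := key L 0
  simpa [hL] using this

theorem sobNorm_sum_geom_le (w N : ℕ) (Φ : 𝓢(Rn n, ℂ)) (hΦ : ∫ z, Φ z = 1) (φ : 𝓢(Rn n, ℂ)) :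
    wNorm w ((∑ i ∈ Finset.range (N + 1), diffEnd Φ (dyad 0) ^ i) φ) ≤
      (N + 1) * (1 + wNorm (w + 1) Φ * n) ^ N * sobNorm w N φ := by
  rw [LinearMap.sum_apply]
  refine (wNorm_sum_le _ _ _).trans ?_
  calc ∑ i ∈ Finset.range (N + 1), wNorm w ((diffEnd Φ (dyad 0) ^ i) φ)
      ≤ ∑ _i ∈ Finset.range (N + 1), (1 + wNorm (w + 1) Φ * n) ^ N * sobNorm w N φ := by
        refine Finset.sum_le_sum fun i hi => ?_
        have hi' : i ≤ N := Nat.lt_succ_iff.1 (Finset.mem_range.1 hi)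
        refine (wNorm_le_sobNorm w 0 _).trans
          ((sobNorm_diffEnd_pow_le w 0 Φ hΦ (dyad 0) (dyad_le_one 0) i φ).trans ?_)
        rw [zero_add]
        refine mul_le_mul' ?_ (sobNorm_mono hi' φ)
        calc (ENNReal.ofReal (dyad 0) * (wNorm (w + 1) Φ * n)) ^ i
            ≤ (1 + wNorm (w + 1) Φ * n) ^ i := by
              refine pow_le_pow_left' ?_ i
              simp [dyad_val]
          _ ≤ _ := pow_le_pow_right₀ (by simp) hi'
    _ = _ := by simp; ring

/-- With exponent `N + 1`, each product in the coefficient contains exactly `N` factors `D`, each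
worth `2^{-k}` and one derivative. This is why only derivatives of order `N` appear. -/
theorem wNorm_thetaEnd_le (w N : ℕ) (Φ : 𝓢(Rn n, ℂ)) (hΦ : ∫ z, Φ z = 1) (φ : 𝓢(Rn n, ℂ)) (k : ℕ) :
    wNorm w (thetaEnd Φ (N + 1) (dyad k) (dyad (k + 1)) φ) ≤
      ENNReal.ofReal ((1 / 2) ^ (k * N)) *
        ((N + 1) * (1 + wNorm (w + 1) Φ * n) ^ N * sobNorm w N φ) := by
  unfold thetaEnd
  rw [LinearMap.sum_apply]
  refine (wNorm_sum_le _ _ _).trans ?_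
  calc ∑ i ∈ Finset.range (N + 1), wNorm w
        ((diffEnd Φ (dyad k) ^ i * diffEnd Φ (dyad (k + 1)) ^ (N + 1 - 1 - i)) φ)
      ≤ ∑ _i ∈ Finset.range (N + 1), ENNReal.ofReal ((1 / 2) ^ (k * N)) *
          ((1 + wNorm (w + 1) Φ * n) ^ N * sobNorm w N φ) := by
        refine Finset.sum_le_sum fun i hi => ?_
        have hi' : i ≤ N := Nat.lt_succ_iff.1 (Finset.mem_range.1 hi)
        rw [Module.End.mul_apply, Nat.add_sub_cancel]
        refine (wNorm_le_sobNorm w 0 _).trans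
          ((sobNorm_diffEnd_pow_le w 0 Φ hΦ (dyad k) (dyad_le_one k) i _).trans ?_)
        rw [zero_add]
        refine (mul_le_mul' le_rfl (sobNorm_diffEnd_pow_le w i Φ hΦ (dyad (k + 1))
          (dyad_le_one _) (N - i) φ)).trans ?_
        rw [Nat.add_sub_cancel' hi']
        refine (mul_assoc _ _ _).ge.trans (le_trans (mul_le_mul' ?_ le_rfl) (mul_assoc _ _ _).le)
        calc (ENNReal.ofReal (dyad k) * (wNorm (w + 1) Φ * n)) ^ i *
              (ENNReal.ofReal (dyad (k + 1)) * (wNorm (w + 1) Φ * n)) ^ (N - i)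
            ≤ (ENNReal.ofReal (dyad k) * (1 + wNorm (w + 1) Φ * n)) ^ i *
              (ENNReal.ofReal (dyad k) * (1 + wNorm (w + 1) Φ * n)) ^ (N - i) := by
              gcongr
              · exact le_add_self
              · exact dyad_succ_le k
              · exact le_add_self
          _ = ENNReal.ofReal ((1 / 2) ^ (k * N)) * (1 + wNorm (w + 1) Φ * n) ^ N := by
              rw [← pow_add, Nat.add_sub_cancel' hi', mul_pow, dyad_val,
                ← ENNReal.ofReal_pow (by positivity), ← pow_mul]
    _ = _ := by simp; ring

/-- A pointwise bound for convolution with `θ * Φ_s`. -/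
theorem enorm_conv_star_dilate_le (N : ℕ) {r : ℝ} (Φ θ : 𝓢(Rn n, ℂ)) (f : 𝓢'(Rn n, ℂ))
    (s t : {t : ℝ // 0 < t}) (hs : (s : ℝ) ≤ 1) (y : Rn n) (B : ℝ≥0)
    (hB : ∀ s : {t : ℝ // 0 < t}, (s : ℝ) ≤ t → ∀ z,
      ‖conv (dilate s Φ) f z‖ ≤ B * ((t : ℝ) / s) ^ r * (1 + ‖z - y‖ / t) ^ N) :
    ‖conv (dilate t (star θ (dilate s Φ))) f y‖ₑ ≤
      B * ENNReal.ofReal ((s : ℝ)⁻¹ ^ r) * wNorm N θ := by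
  have ht := t.2
  have hs0 := s.2
  rw [dilate_star, dilate_dilate, star_comm, conv_star]
  refine (enorm_integral_le_lintegral_enorm _).trans ?_
  simp only [enorm_mul]
  calc ∫⁻ z, ‖dilate t θ z‖ₑ * ‖conv (dilate (t * s) Φ) f (y - z)‖ₑ
      ≤ ∫⁻ z, ‖dilate t θ z‖ₑ *
          ENNReal.ofReal (B * (s : ℝ)⁻¹ ^ r * (1 + ‖(t : ℝ)⁻¹ • z‖) ^ N) := by
        refine lintegral_mono fun z => ?_
        simp only
        gcongr
        rw [← ofReal_norm]
        refine ENNReal.ofReal_le_ofReal ((hB (t * s) ?_ (y - z)).trans (le_of_eq ?_))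
        · rw [Positive.val_mul]
          nlinarith
        · rw [Positive.val_mul, norm_smul, Real.norm_of_nonneg (by positivity)]
          have h1 : (t : ℝ) / (t * s) = (s : ℝ)⁻¹ := by field_simp
          have h2 : y - z - y = -z := by abel
          rw [h1, h2, norm_neg, div_eq_inv_mul]
    _ = ∫⁻ w, ‖θ w‖ₑ * ENNReal.ofReal (B * (s : ℝ)⁻¹ ^ r * (1 + ‖w‖) ^ N) := by
        rw [lintegral_dilate t (F := fun z =>
          ENNReal.ofReal (B * (s : ℝ)⁻¹ ^ r * (1 + ‖(t : ℝ)⁻¹ • z‖) ^ N)) (by fun_prop)]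
        simp only [smul_smul, inv_mul_cancel₀ ht.ne', one_smul]
    _ = _ := by
        unfold wNorm
        rw [← lintegral_const_mul _ (wNorm_measurable _ _)]
        refine lintegral_congr fun w => ?_
        rw [ENNReal.ofReal_mul (by positivity), ENNReal.ofReal_mul (by positivity),
          ENNReal.ofReal_coe_nnreal]
        ring

/-- Bounds for `Φ_s * f` at all scales `s ≤ t` control `φ_t * f` for every Schwartz function. -/
theorem exists_enorm_conv_le (Φ : 𝓢(Rn n, ℂ)) (hΦ : ∫ z, Φ z = 1) (w N : ℕ) {r : ℝ} (hr0 : 0 ≤ r)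
    (hr : r < N) :
    ∃ C : ℝ≥0, ∀ (φ : 𝓢(Rn n, ℂ)) (f : 𝓢'(Rn n, ℂ)) (t : {t : ℝ // 0 < t}) (y : Rn n) (B : ℝ≥0),
      (∀ s : {t : ℝ // 0 < t}, (s : ℝ) ≤ t → ∀ z,
        ‖conv (dilate s Φ) f z‖ ≤ B * ((t : ℝ) / s) ^ r * (1 + ‖z - y‖ / t) ^ w) →
      ‖conv (dilate t φ) f y‖ₑ ≤ C * sobNorm w N φ * B := by
  -- The `k`-th term grows by `2^{kr}` from the assumed bound on `Φ_s * f` and decays by `2^{-kN}`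
  -- from its coefficient.
  set ρ : ℝ := 2 ^ (r - N) with hρ
  have hρ0 : 0 < ρ := by positivity
  have hρ1 : ρ < 1 := Real.rpow_lt_one_of_one_lt_of_neg one_lt_two (by linarith)
  set c : ℝ≥0∞ := (N + 1) * (1 + wNorm (w + 1) Φ * n) ^ N with hc
  have hctop : c ≠ ∞ := by
    refine ENNReal.mul_ne_top (by simp) (ENNReal.pow_ne_top ?_)
    exact ENNReal.add_ne_top.2 ⟨by simp, ENNReal.mul_ne_top (wNorm_ne_top _ _) (by simp)⟩
  set D : ℝ≥0∞ := 1 + ENNReal.ofReal (∑' k : ℕ, 2 * 2 ^ r * ρ ^ k) with hD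
  have hDtop : D ≠ ∞ := by simp [hD]
  have hsum : ∀ K, ∑ k ∈ Finset.range K, ENNReal.ofReal (2 * 2 ^ r * ρ ^ k) ≤
      ENNReal.ofReal (∑' k : ℕ, 2 * 2 ^ r * ρ ^ k) := by
    intro K
    rw [← ENNReal.ofReal_sum_of_nonneg fun _ _ => by positivity]
    exact ENNReal.ofReal_le_ofReal (((summable_geometric_of_lt_one hρ0.le hρ1).mul_left
      _).sum_le_tsum _ fun _ _ => by positivity)
  refine ⟨(c * D).toNNReal, fun φ f t y B hB => ?_⟩
  rw [ENNReal.coe_toNNReal (ENNReal.mul_ne_top hctop hDtop)]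
  have hest := fun (s : {t : ℝ // 0 < t}) (hs : (s : ℝ) ≤ 1) (θ : 𝓢(Rn n, ℂ)) =>
    enorm_conv_star_dilate_le w Φ θ f s t hs y B hB
  have hk : ∀ k, ‖conv (dilate t
      (star (thetaEnd Φ (N + 1) (dyad k) (dyad (k + 1)) φ) (dilate (dyad (k + 1)) Φ) -
          star (thetaEnd Φ (N + 1) (dyad k) (dyad (k + 1)) φ) (dilate (dyad k) Φ))) f y‖ₑ ≤
      (c * sobNorm w N φ * B) * ENNReal.ofReal (2 * 2 ^ r * ρ ^ k) := by
    intro k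
    rw [← dilateLM_apply, map_sub, conv_sub]
    set θ := thetaEnd Φ (N + 1) (dyad k) (dyad (k + 1)) φ with hθ
    have e0 : ∀ k : ℕ, (dyad k : ℝ)⁻¹ ^ r = ((2 : ℝ) ^ r) ^ k := by
      intro k
      rw [dyad_val, one_div, inv_pow, inv_inv, ← Real.rpow_natCast, ← Real.rpow_mul (by norm_num),
        ← Real.rpow_natCast, ← Real.rpow_mul (by norm_num), mul_comm]
    have h2r : (1 : ℝ) ≤ 2 ^ r := Real.one_le_rpow (by norm_num) hr0
    calc ‖conv (dilate t (star θ (dilate (dyad (k + 1)) Φ))) f y -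
          conv (dilate t (star θ (dilate (dyad k) Φ))) f y‖ₑ
        ≤ B * ENNReal.ofReal ((dyad (k + 1) : ℝ)⁻¹ ^ r) * wNorm w θ +
          B * ENNReal.ofReal ((dyad k : ℝ)⁻¹ ^ r) * wNorm w θ :=
          enorm_sub_le.trans (add_le_add (hest _ (dyad_le_one _) θ) (hest _ (dyad_le_one _) θ))
      _ = B * ENNReal.ofReal ((dyad (k + 1) : ℝ)⁻¹ ^ r + (dyad k : ℝ)⁻¹ ^ r) * wNorm w θ := by
          have h1 := (dyad k).2
          have h2 := (dyad (k + 1)).2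
          rw [ENNReal.ofReal_add (by positivity) (by positivity)]
          ring
      _ ≤ B * ENNReal.ofReal (2 * 2 ^ r * ((2 : ℝ) ^ r) ^ k) *
          (ENNReal.ofReal ((1 / 2) ^ (k * N)) * (c * sobNorm w N φ)) := by
          have h1 := wNorm_thetaEnd_le w N Φ hΦ φ k
          have h2 : (dyad (k + 1) : ℝ)⁻¹ ^ r + (dyad k : ℝ)⁻¹ ^ r ≤
              2 * 2 ^ r * ((2 : ℝ) ^ r) ^ k := by
            rw [e0, e0, pow_succ]
            have : (0 : ℝ) ≤ ((2 : ℝ) ^ r) ^ k := by positivity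
            nlinarith
          gcongr
      _ = (c * sobNorm w N φ * B) * (ENNReal.ofReal (2 * 2 ^ r * ((2 : ℝ) ^ r) ^ k) *
            ENNReal.ofReal ((1 / 2) ^ (k * N))) := by ring
      _ = _ := by
          rw [← ENNReal.ofReal_mul (by positivity)]
          congr 2
          have e1 : ρ ^ k = ((2 : ℝ) ^ r) ^ k * (1 / 2) ^ (k * N) := by
            rw [hρ, Real.rpow_sub (by norm_num), Real.rpow_natCast, div_pow ((2 : ℝ) ^ r),
              ← pow_mul, mul_comm N k, one_div, inv_pow, div_eq_mul_inv]
          rw [e1]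
          ring
  have hlim := (tendsto_conv_diffEnd_pow Φ φ hΦ f t y (L := N + 1) (Nat.succ_ne_zero N)).enorm
  rw [enorm_zero] at hlim
  have hbound : ∀ K, ‖conv (dilate t φ) f y‖ₑ ≤ c * D * sobNorm w N φ * B +
      ‖conv (dilate t ((diffEnd Φ (dyad K) ^ (N + 1)) φ)) f y‖ₑ := by
    intro K
    conv_lhs => rw [reproducing_formula Φ (N + 1) K φ]
    rw [← dilateLM_apply, map_add, map_add, map_sum, conv_add, conv_add, conv_sum]
    refine (enorm_add_le _ _).trans (add_le_add ?_ le_rfl)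
    refine (enorm_add_le _ _).trans ?_
    have h0 := (hest (dyad 0) (dyad_le_one 0)
      ((∑ i ∈ Finset.range (N + 1), diffEnd Φ (dyad 0) ^ i) φ)).trans
      (mul_le_mul' le_rfl (sobNorm_sum_geom_le w N Φ hΦ φ))
    calc _ ≤ B * ENNReal.ofReal ((dyad 0 : ℝ)⁻¹ ^ r) * (c * sobNorm w N φ) +
          ∑ k ∈ Finset.range K, (c * sobNorm w N φ * B) * ENNReal.ofReal (2 * 2 ^ r * ρ ^ k) :=
          add_le_add h0 ((enorm_sum_le _ _).trans (Finset.sum_le_sum fun k _ => hk k))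
      _ ≤ (c * sobNorm w N φ * B) * 1 +
          (c * sobNorm w N φ * B) * ENNReal.ofReal (∑' k : ℕ, 2 * 2 ^ r * ρ ^ k) := by
          rw [← Finset.mul_sum]
          refine add_le_add (le_of_eq ?_) (mul_le_mul' le_rfl (hsum K))
          simp only [dyad_val, pow_zero, inv_one, Real.one_rpow, ENNReal.ofReal_one]
          ring
      _ = _ := by rw [hD]; ring
  -- The partial sums are bounded independently of `K`, so letting `K` tend to infinity removes the
  -- remainder.
  have hlim2 := hlim.const_add (c * D * sobNorm w N φ * B)
  rw [add_zero] at hlim2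
  exact ge_of_tendsto' hlim2 hbound

/-! ### Maximal function estimates -/

theorem ell2_conv_smul (c : ℂ) (φ : 𝓢(Rn n, ℂ)) (f : ℤ → 𝓢'(Rn n, ℂ)) (x : Rn n) :
    ell2 (fun j => conv (c • φ) (f j) x) = ‖c‖ₑ * ell2 (fun j => conv φ (f j) x) := by
  simp only [conv_smul, ell2_const_mul]

theorem ell2_conv_dilate_smul (c : ℂ) (φ : 𝓢(Rn n, ℂ)) (f : ℤ → 𝓢'(Rn n, ℂ))
    (t : {t : ℝ // 0 < t}) (x : Rn n) :
    ell2 (fun j => conv (dilate t (c • φ)) (f j) x) =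
      ‖c‖ₑ * ell2 (fun j => conv (dilate t φ) (f j) x) := by
  rw [← ell2_conv_smul]
  simp only [← dilateLM_apply, map_smul]

/-- The vector-valued form of `exists_enorm_conv_le`. -/
theorem exists_ell2_conv_le (Φ : 𝓢(Rn n, ℂ)) (hΦ : ∫ z, Φ z ≠ 0) (w N : ℕ) {r : ℝ} (hr0 : 0 ≤ r)
    (hr : r < N) :
    ∃ C : ℝ≥0, ∀ (φ : 𝓢(Rn n, ℂ)) (f : ℤ → 𝓢'(Rn n, ℂ)) (t : {t : ℝ // 0 < t}) (y : Rn n)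
      (B : ℝ≥0),
      (∀ s : {t : ℝ // 0 < t}, (s : ℝ) ≤ t → ∀ z, ell2 (fun j => conv (dilate s Φ) (f j) z) ≤
        B * ENNReal.ofReal (((t : ℝ) / s) ^ r * (1 + ‖z - y‖ / t) ^ w)) →
      ell2 (fun j => conv (dilate t φ) (f j) y) ≤ C * sobNorm w N φ * B := by
  set c : ℂ := (∫ z, Φ z)⁻¹ with hc
  obtain ⟨C, hC⟩ := exists_enorm_conv_le (c • Φ) (by
    simp only [smul_apply, smul_eq_mul]
    rw [integral_const_mul, hc, inv_mul_cancel₀ hΦ]) w N hr0 hr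
  refine ⟨C * ‖c‖₊, fun φ f t y B hB => ell2_le_of_forall fun s l hl => ?_⟩
  -- The scalar bound is applied to the single distribution `∑ l_j f_j`, whose mollifications
  -- satisfy the hypothesis by Cauchy–Schwarz.
  rw [← conv_linComb]
  refine (hC φ (∑ j ∈ s, l j • f j) t y (‖c‖₊ * B) fun u hu z => ?_).trans (le_of_eq ?_)
  · have ht := t.2
    have hu0 := u.2
    rw [conv_linComb]
    have h1 := (enorm_sum_mul_le_ell2 (fun j => conv (dilate u (c • Φ)) (f j) z) l s hl).trans
      ((ell2_conv_dilate_smul c Φ f u z).le.trans (mul_le_mul' le_rfl (hB u hu z)))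
    rw [← ENNReal.ofReal_coe_nnreal, ← ofReal_norm, ← ofReal_norm,
      ← ENNReal.ofReal_mul (by positivity), ← ENNReal.ofReal_mul (by positivity),
      ENNReal.ofReal_le_ofReal_iff (by positivity)] at h1
    refine h1.trans (le_of_eq ?_)
    push_cast
    ring
  · push_cast
    ring

/-- `1 + |x - z| / s ≤ (1 + a) (t / s) (1 + |z - y| / t)` when `|y - x| ≤ a t` and `s ≤ t`. -/
theorem one_add_norm_div_le {a s t : ℝ} (hs : 0 < s) (hst : s ≤ t) {x y z : Rn n}
    (h : ‖y - x‖ ≤ a * t) :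
    1 + s⁻¹ * ‖x - z‖ ≤ (1 + a) * (t / s * (1 + ‖z - y‖ / t)) := by
  have ht : 0 < t := hs.trans_le hst
  have ha : 0 ≤ a := nonneg_of_mul_nonneg_left ((norm_nonneg _).trans h) ht
  have h1 : ‖x - z‖ ≤ a * t + ‖z - y‖ := by
    calc ‖x - z‖ = ‖(y - x) + (z - y)‖ := by rw [← norm_neg]; congr 1; abel
      _ ≤ _ := (norm_add_le _ _).trans (by gcongr)
  have h2 : (1 + a) * (t / s * (1 + ‖z - y‖ / t)) = s⁻¹ * ((1 + a) * (t + ‖z - y‖)) := by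
    field_simp
  rw [h2]
  have h3 : (1 : ℝ) = s⁻¹ * s := by field_simp
  calc 1 + s⁻¹ * ‖x - z‖ = s⁻¹ * (s + ‖x - z‖) := by rw [mul_add, ← h3]
    _ ≤ _ := by
      gcongr
      nlinarith [norm_nonneg (z - y)]

theorem rpow_one_add_norm_div_le {a b s t : ℝ} (hb : 0 ≤ b) (hs : 0 < s) (hst : s ≤ t)
    {x y z : Rn n} (h : ‖y - x‖ ≤ a * t) :
    (1 + s⁻¹ * ‖x - z‖) ^ b ≤ (1 + a) ^ b * ((t / s) ^ b * (1 + ‖z - y‖ / t) ^ b) := by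
  have ht : 0 < t := hs.trans_le hst
  have ha : 0 ≤ a := nonneg_of_mul_nonneg_left ((norm_nonneg _).trans h) ht
  rw [← Real.mul_rpow (by positivity) (by positivity), ← Real.mul_rpow (by positivity)
    (by positivity)]
  exact Real.rpow_le_rpow (by positivity) (one_add_norm_div_le hs hst h) hb

theorem auxMax_eq (b : ℝ) (Φ : 𝓢(Rn n, ℂ)) (f : ℤ → 𝓢'(Rn n, ℂ)) :
    auxMax b Φ f = auxSup b fun t y => ell2 fun j => conv (dilate t Φ) (f j) y := rfl

theorem nontangMax_eq (a : ℝ) (Φ : 𝓢(Rn n, ℂ)) (f : ℤ → 𝓢'(Rn n, ℂ)) :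
    nontangMax a Φ f = ntSup a fun t y => ell2 fun j => conv (dilate t Φ) (f j) y := rfl

/-- The grand maximal function is controlled pointwise by the auxiliary maximal function. -/
theorem exists_grandMax_le (b : ℝ) (hb : 0 < b) (Φ : 𝓢(Rn n, ℂ)) (hΦ : ∫ x, Φ x ≠ 0) :
    ∃ C : ℝ≥0, ∀ (f : ℤ → 𝓢'(Rn n, ℂ)) x, grandMax (⌊b⌋₊ + 1) f x ≤ C * auxMax b Φ f x := by
  set N := ⌊b⌋₊ + 1 with hN
  have hbN : b < N := by rw [hN]; push_cast; exact Nat.lt_floor_add_one b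
  obtain ⟨C, hC⟩ := exists_ell2_conv_le Φ hΦ N N hb.le hbN
  -- Adding `1` keeps the constant nonzero, so the bound is trivial where the auxiliary maximal
  -- function is infinite.
  refine ⟨C * 2 ^ b + 1, fun f x => ?_⟩
  rcases eq_or_ne (auxMax b Φ f x) ∞ with hA | hA
  · rw [hA, ENNReal.mul_top (by simp)]
    exact le_top
  obtain ⟨A, hA⟩ : ∃ A : ℝ≥0, (A : ℝ≥0∞) = auxMax b Φ f x :=
    ⟨_, ENNReal.coe_toNNReal hA⟩
  refine iSup_le fun φ => iSup_le fun t => iSup_le fun y => iSup_le fun hy => ?_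
  have ht := t.2
  refine (hC φ f t y (2 ^ b * A) fun s hs z => ?_).trans ?_
  · have hs0 := s.2
    refine (le_auxSup b (fun t y => ell2 fun j => conv (dilate t Φ) (f j) y) x z s).trans ?_
    rw [← auxMax_eq, ← hA, ENNReal.coe_mul, mul_comm ((2 ^ b : ℝ≥0) : ℝ≥0∞), mul_assoc]
    refine mul_le_mul' le_rfl ?_
    rw [← ENNReal.ofReal_coe_nnreal, ← ENNReal.ofReal_mul (by positivity)]
    refine ENNReal.ofReal_le_ofReal ?_
    refine (rpow_one_add_norm_div_le hb.le hs0 hs hy).trans ?_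
    push_cast
    norm_num only [one_add_one_eq_two]
    have h1 : (1 + ‖z - y‖ / t) ^ b ≤ (1 + ‖z - y‖ / t) ^ N := by
      rw [← Real.rpow_natCast]
      exact Real.rpow_le_rpow_of_exponent_le (by simp; positivity) hbN.le
    gcongr
  · have h1 : sobNorm N N (φ : 𝓢(Rn n, ℂ)) ≤ 1 := by
      refine (sobNorm_mono (Nat.le_succ N) _).trans ?_
      rw [sobNorm_eq_frakN]
      simpa using φ.2
    calc (C : ℝ≥0∞) * sobNorm N N (φ : 𝓢(Rn n, ℂ)) * ((2 ^ b * A : ℝ≥0) : ℝ≥0∞)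
        ≤ C * 1 * ((2 ^ b * A : ℝ≥0) : ℝ≥0∞) := by gcongr
      _ = ((C * 2 ^ b : ℝ≥0) : ℝ≥0∞) * A := by push_cast; ring
      _ ≤ _ := by
        rw [hA]
        exact mul_le_mul' (ENNReal.coe_le_coe.2 le_self_add) le_rfl

/-- The weight condition in the comparison of the nontangential with the smooth maximal function. -/
def IsScaleWeight (k : ℕ) (w : {t : ℝ // 0 < t} → Rn n → ℝ≥0) : Prop :=
  (∀ t y, w t y ≤ 1) ∧ ∀ s t : {t : ℝ // 0 < t}, (s : ℝ) ≤ t → ∀ y z,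
    (w t y : ℝ) ≤ ((t : ℝ) / s) ^ k * (1 + ‖z - y‖ / t) ^ k * w s z

theorem ofReal_one_add_rpow {a b : ℝ} (ha : 0 ≤ a) :
    ENNReal.ofReal ((1 + a) ^ b) = ((1 + a).toNNReal ^ b : ℝ≥0) := by
  rw [ENNReal.ofReal, Real.toNNReal_rpow_of_nonneg (by positivity)]

/-- The increment of `Φ_t * f` under a small shift is controlled by the auxiliary maximal
function. -/
theorem exists_weight_mul_conv_le (Φ : 𝓢(Rn n, ℂ)) (hΦ : ∫ x, Φ x ≠ 0) (k : ℕ) {a b : ℝ}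
    (ha : 0 < a) (hb : 0 < b) {ε : ℝ≥0} (hε : 0 < ε) :
    ∃ c : ℝ, 0 < c ∧ ∀ (f : ℤ → 𝓢'(Rn n, ℂ)) (w : {t : ℝ // 0 < t} → Rn n → ℝ≥0),
      IsScaleWeight k w → ∀ (t : {t : ℝ // 0 < t}) (x y h : Rn n), ‖y - x‖ ≤ a * t → ‖h‖ ≤ c →
        w t y * ell2 (fun j => conv (dilate t Φ) (f j) y) ≤
          ell2 (fun j => conv (dilate t Φ) (f j) (y + (t : ℝ) • h)) +
            ε * auxSup b (fun t y => w t y * ell2 fun j => conv (dilate t Φ) (f j) y) x := by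
  set N := ⌊b⌋₊ + 1 + k with hN
  have hbN : b + k < N := by
    rw [hN]; push_cast; linarith [Nat.lt_floor_add_one b]
  obtain ⟨C, hC⟩ := exists_ell2_conv_le Φ hΦ N N (by positivity) hbN
  set S : ℝ≥0 := (sobNorm N (N + 1) Φ).toNNReal with hS
  have hS' : (S : ℝ≥0∞) = sobNorm N (N + 1) Φ := ENNReal.coe_toNNReal (sobNorm_ne_top _ _ _)
  -- The displayed quantity is the final bound for the increment; it contains a factor `c` and so
  -- tends to zero with it.
  obtain ⟨c, hc, hcε⟩ : ∃ c : ℝ, 0 < c ∧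
      C * (c * (1 + c) ^ N * (n * S)) * (1 + a) ^ b < ε := by
    have hcont : Filter.Tendsto (fun c : ℝ => C * (c * (1 + c) ^ N * (n * S)) * (1 + a) ^ b)
        (nhdsWithin 0 (Set.Ioi 0)) (nhds (C * (0 * (1 + 0) ^ N * (n * S)) * (1 + a) ^ b)) :=
      ((by fun_prop : Continuous fun c : ℝ =>
        C * (c * (1 + c) ^ N * (n * S)) * (1 + a) ^ b).tendsto 0).mono_left nhdsWithin_le_nhds
    rw [zero_mul, zero_mul, mul_zero, zero_mul] at hcont
    have h1 := (hcont.eventually_lt_const (NNReal.coe_pos.2 hε)).and self_mem_nhdsWithin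
    obtain ⟨c, hc⟩ := h1.exists
    exact ⟨c, hc.2, hc.1⟩
  refine ⟨c, hc, fun f w hw t x y h hy hh => ?_⟩
  have ht := t.2
  set g : {t : ℝ // 0 < t} → Rn n → ℝ≥0∞ := fun t y => ell2 fun j => conv (dilate t Φ) (f j) y
    with hg
  set G := auxSup b (fun t y => w t y * g t y) x with hG
  rcases eq_or_ne (w t y) 0 with hw0 | hw0
  · rw [hw0]; simp
  rcases eq_or_ne G ∞ with hGt | hGt
  · rw [hGt, ENNReal.mul_top (by simpa using hε.ne')]
    simp
  -- Mollifying with the dilates of this function gives exactly the increment between `y` and `y + t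
  -- h`, and its Sobolev norm is of order `‖h‖`.
  set φ := Φ - translate (-h) Φ with hφ
  have hdec : g t y ≤ ell2 (fun j => conv (dilate t Φ) (f j) (y + (t : ℝ) • h)) +
      ell2 (fun j => conv (dilate t φ) (f j) y) := by
    refine ell2_le_add_of_norm_le fun j => ?_
    rw [hφ, ← dilateLM_apply (φ := Φ - _), map_sub, conv_sub, dilateLM_apply, dilateLM_apply,
      dilate_translate, conv_translate]
    simp
  -- The weight condition replaces `w t y` by `w s z` at the price of `k` powers of `t/s` and of `1
  -- + |z - y|/t`, hence the growth exponent `b + k`. The factor `(w t y)⁻¹` cancels when the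
  -- increment is multiplied by the weight.
  have hest := hC φ f t y ((1 + a).toNNReal ^ b * G.toNNReal * (w t y)⁻¹) (fun s hs z => by
    have hs0 := s.2
    have h1 := le_auxSup b (fun t y => w t y * g t y) x z s
    rw [← hG] at h1
    have hw0' : (w t y : ℝ≥0∞) ≠ 0 := by simpa using hw0
    set R : ℝ := t / s with hR
    set Q : ℝ := 1 + ‖z - y‖ / t with hQ
    have hR0 : 0 < R := by positivity
    have hQ1 : 1 ≤ Q := by simp [hQ]; positivity
    have h2 : (w t y : ℝ≥0∞) ≤ ENNReal.ofReal (R ^ k * Q ^ k) * w s z := by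
      rw [← ENNReal.ofReal_coe_nnreal, ← ENNReal.ofReal_coe_nnreal,
        ← ENNReal.ofReal_mul (by positivity)]
      exact ENNReal.ofReal_le_ofReal (hw.2 s t hs y z)
    have h3 : R ^ k * Q ^ k * ((1 + a) ^ b * (R ^ b * Q ^ b)) ≤
        (1 + a) ^ b * (R ^ (b + k) * Q ^ N) := by
      have e1 : Q ^ k * Q ^ b ≤ Q ^ N := by
        rw [← Real.rpow_natCast, ← Real.rpow_natCast, ← Real.rpow_add (by positivity)]
        exact Real.rpow_le_rpow_of_exponent_le hQ1 (by linarith)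
      have e2 : R ^ (b + k) = R ^ k * R ^ b := by
        rw [Real.rpow_add hR0, Real.rpow_natCast, mul_comm]
      calc R ^ k * Q ^ k * ((1 + a) ^ b * (R ^ b * Q ^ b))
          = (1 + a) ^ b * (R ^ k * R ^ b) * (Q ^ k * Q ^ b) := by ring
        _ ≤ (1 + a) ^ b * (R ^ k * R ^ b) * Q ^ N := by gcongr
        _ = _ := by rw [e2]; ring
    calc g s z = (w t y : ℝ≥0∞)⁻¹ * (w t y * g s z) := by
          rw [← mul_assoc, ENNReal.inv_mul_cancel hw0' ENNReal.coe_ne_top, one_mul]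
      _ ≤ (w t y : ℝ≥0∞)⁻¹ * (ENNReal.ofReal (R ^ k * Q ^ k) * w s z * g s z) := by gcongr
      _ = (w t y : ℝ≥0∞)⁻¹ * (ENNReal.ofReal (R ^ k * Q ^ k) * (w s z * g s z)) := by ring
      _ ≤ (w t y : ℝ≥0∞)⁻¹ * (ENNReal.ofReal (R ^ k * Q ^ k) *
          (G * ENNReal.ofReal ((1 + a) ^ b * (R ^ b * Q ^ b)))) := by
          refine mul_le_mul' le_rfl (mul_le_mul' le_rfl (h1.trans (mul_le_mul' le_rfl ?_)))
          exact ENNReal.ofReal_le_ofReal (rpow_one_add_norm_div_le hb.le hs0 hs hy)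
      _ = (w t y : ℝ≥0∞)⁻¹ * G *
          ENNReal.ofReal (R ^ k * Q ^ k * ((1 + a) ^ b * (R ^ b * Q ^ b))) := by
          rw [ENNReal.ofReal_mul (p := R ^ k * Q ^ k) (by positivity)]
          ring
      _ ≤ (w t y : ℝ≥0∞)⁻¹ * G * ENNReal.ofReal ((1 + a) ^ b * (R ^ (b + k) * Q ^ N)) :=
          mul_le_mul' le_rfl (ENNReal.ofReal_le_ofReal h3)
      _ = _ := by
          rw [ENNReal.ofReal_mul (by positivity), ENNReal.coe_mul, ENNReal.coe_mul,
            ENNReal.coe_inv hw0, ENNReal.coe_toNNReal hGt, ofReal_one_add_rpow ha.le]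
          ring)
  have hsob : sobNorm N N φ ≤ ENNReal.ofReal (c * (1 + c) ^ N) * (n * S) := by
    refine (sobNorm_sub_translate_le N N (-h) Φ).trans ?_
    rw [hS', norm_neg]
    gcongr
  have hCe : C * sobNorm N N φ * ((1 + a).toNNReal ^ b : ℝ≥0) ≤ ε := by
    refine (mul_le_mul' (mul_le_mul' le_rfl hsob) le_rfl).trans ?_
    rw [← ofReal_one_add_rpow ha.le, ← ENNReal.ofReal_coe_nnreal (p := C),
      ← ENNReal.ofReal_coe_nnreal (p := S), ← ENNReal.ofReal_coe_nnreal (p := ε),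
      ← ENNReal.ofReal_natCast, ← ENNReal.ofReal_mul (by positivity),
      ← ENNReal.ofReal_mul (by positivity), ← ENNReal.ofReal_mul (by positivity),
      ← ENNReal.ofReal_mul (by positivity)]
    exact ENNReal.ofReal_le_ofReal hcε.le
  calc w t y * g t y ≤ w t y * (ell2 (fun j => conv (dilate t Φ) (f j) (y + (t : ℝ) • h)) +
      ell2 (fun j => conv (dilate t φ) (f j) y)) := by gcongr
    _ ≤ 1 * ell2 (fun j => conv (dilate t Φ) (f j) (y + (t : ℝ) • h)) +
        w t y * (C * sobNorm N N φ *
          (((1 + a).toNNReal ^ b * G.toNNReal * (w t y)⁻¹ : ℝ≥0) : ℝ≥0∞)) := by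
        rw [mul_add]
        refine add_le_add (mul_le_mul' ?_ le_rfl) (mul_le_mul' le_rfl hest)
        exact ENNReal.coe_le_one_iff.2 (hw.1 t y)
    _ = ell2 (fun j => conv (dilate t Φ) (f j) (y + (t : ℝ) • h)) +
        (C * sobNorm N N φ * ((1 + a).toNNReal ^ b : ℝ≥0)) * G := by
        have hw0' : (w t y : ℝ≥0∞) ≠ 0 := by simpa using hw0
        rw [ENNReal.coe_mul, ENNReal.coe_mul, ENNReal.coe_inv hw0, ENNReal.coe_toNNReal hGt, one_mul]
        congr 1
        calc _ = ((w t y : ℝ≥0∞) * (w t y : ℝ≥0∞)⁻¹) *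
              (C * sobNorm N N φ * ((1 + a).toNNReal ^ b : ℝ≥0) * G) := by ring
          _ = _ := by rw [ENNReal.mul_inv_cancel hw0' ENNReal.coe_ne_top, one_mul]
    _ ≤ _ := by gcongr

/-! ### The nontangential and the smooth maximal functions -/

/-- Where the nontangential supremum exceeds `s`, either the tangential one exceeds `K s`, or the
unweighted values exceed `s/2` on a ball of radius `c t`. The first set is absorbed, the second is
handled by covering. Finiteness is assumed because half of the left side is subtracted; the constant
depends on the weight only through `k`. -/
theorem exists_weakLpNorm_ntSup_weight_le (hn : 0 < n) {p a : ℝ} (hp : 0 < p) (ha : 0 < a)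
    (Φ : 𝓢(Rn n, ℂ)) (hΦ : ∫ x, Φ x ≠ 0) (k : ℕ) :
    ∃ C : ℝ≥0, ∀ (f : ℤ → 𝓢'(Rn n, ℂ)) (w : {t : ℝ // 0 < t} → Rn n → ℝ≥0), IsScaleWeight k w →
      weakLpNorm p (ntSup a fun t y => w t y * ell2 fun j => conv (dilate t Φ) (f j) y) < ∞ →
      weakLpNorm p (ntSup a fun t y => w t y * ell2 fun j => conv (dilate t Φ) (f j) y) ≤
        C * weakLpNorm p (smoothMax Φ f) := by
  have hb : 0 < (n : ℝ) / p + 1 := by positivity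
  obtain ⟨CR, hCR⟩ := exists_weakLpNorm_auxSup_le hn hp ha (lt_add_one ((n : ℝ) / p))
  set b := (n : ℝ) / p + 1 with hbdef
  -- This gives `K^p ≥ 2 CR^p`, so the tangential level set costs at most half of the left side;
  -- with `ε = 1/(2K)` the increment is at most `s/2` off that set.
  set K : ℝ≥0 := (CR + 1) * 2 ^ (1 / p) with hK
  have hK0 : 0 < K := by positivity
  obtain ⟨c, hc, hcC⟩ := exists_weight_mul_conv_le Φ hΦ k ha hb (ε := 1 / (2 * K)) (by positivity)
  set D : ℝ≥0∞ := ENNReal.ofReal (((2 * a + 3 * c) / c) ^ n) with hD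
  refine ⟨(2 * (D * 2 ^ p)).toNNReal ^ (1 / p), fun f w hw hfin => ?_⟩
  set g : {t : ℝ // 0 < t} → Rn n → ℝ≥0∞ := fun t y => ell2 fun j => conv (dilate t Φ) (f j) y
    with hg
  set F := ntSup a fun t y => w t y * g t y with hF
  set G := auxSup b fun t y => w t y * g t y with hG
  set M := smoothMax Φ f with hM
  have hpt : ∀ s : ℝ≥0, {x | (s : ℝ≥0∞) < F x} ⊆ {x | ((K * s : ℝ≥0) : ℝ≥0∞) < G x} ∪
      {x | ∃ q ∈ {q : {t : ℝ // 0 < t} × Rn n |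
        Metric.closedBall q.2 (c * q.1) ⊆ {x | ((s / 2 : ℝ≥0) : ℝ≥0∞) < M x}},
        ‖q.2 - x‖ ≤ a * q.1} := by
    intro s x hx
    rw [Set.mem_union]
    by_contra! hcon
    obtain ⟨h1, h2⟩ := hcon
    have h1' : G x ≤ ((K * s : ℝ≥0) : ℝ≥0∞) := not_lt.1 h1
    obtain ⟨t, y, hy, hs⟩ := (lt_ntSup_iff _).1 hx
    refine h2 ⟨(t, y), fun z hz => ?_, hy⟩
    have ht := t.2
    have hz' : ‖z - y‖ ≤ c * t := by simpa [dist_eq_norm] using hz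
    have hh : ‖(t : ℝ)⁻¹ • (z - y)‖ ≤ c := by
      rw [norm_smul, norm_inv, Real.norm_of_nonneg ht.le, inv_mul_le_iff₀ ht]
      linarith
    have key := hcC f w hw t x y _ hy hh
    rw [smul_smul, mul_inv_cancel₀ ht.ne', one_smul, add_sub_cancel] at key
    have h3 : (s : ℝ≥0∞) < g t z + (s / 2 : ℝ≥0) := by
      refine (hs.trans_le key).trans_le ?_
      gcongr
      refine (mul_le_mul' le_rfl h1').trans ?_
      rw [← ENNReal.coe_mul]
      refine ENNReal.coe_le_coe.2 (le_of_eq ?_)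
      field_simp
    have h4 : (s : ℝ≥0∞) = ((s / 2 : ℝ≥0) : ℝ≥0∞) + (s / 2 : ℝ≥0) := by
      rw [← ENNReal.coe_add, add_halves]
    rw [h4] at h3
    have h5 := (ENNReal.add_lt_add_iff_right ENNReal.coe_ne_top).1 h3
    exact h5.trans_le (le_iSup (fun t : {t : ℝ // 0 < t} => g t z) t)
  have hvol : weakLpNorm p F ^ p ≤ weakLpNorm p F ^ p / 2 + D * 2 ^ p * weakLpNorm p M ^ p := by
    have : weakLpNorm p F ≤
        (weakLpNorm p F ^ p / 2 + D * 2 ^ p * weakLpNorm p M ^ p) ^ (1 / p) := by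
      rw [weakLpNorm_le_iff hp]
      intro s
      rw [← ENNReal.rpow_mul, one_div_mul_cancel hp.ne', ENNReal.rpow_one]
      refine (mul_le_mul' le_rfl ((measure_mono (hpt s)).trans (measure_union_le _ _))).trans ?_
      rw [mul_add]
      refine add_le_add ?_ ?_
      · have h1 := volume_mul_le_weakLpNorm hp G (K * s)
        have h2 : weakLpNorm p G ^ p ≤ (CR : ℝ≥0∞) ^ p * weakLpNorm p F ^ p := by
          rw [← ENNReal.mul_rpow_of_nonneg _ _ hp.le]
          exact ENNReal.rpow_le_rpow (hCR _) hp.le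
        have h3 : 2 * (CR : ℝ≥0∞) ^ p ≤ (K : ℝ≥0∞) ^ p := by
          rw [hK, ENNReal.coe_mul, ENNReal.mul_rpow_of_nonneg _ _ hp.le,
            ENNReal.coe_rpow_of_nonneg _ (by positivity), ← ENNReal.rpow_mul,
            one_div_mul_cancel hp.ne', ENNReal.rpow_one, mul_comm, ENNReal.coe_ofNat]
          gcongr
          exact le_self_add
        have hKp : (K : ℝ≥0∞) ^ p ≠ 0 := by
          simp [hK0.ne', hp, hp.not_gt]
        have hKp' : (K : ℝ≥0∞) ^ p ≠ ∞ := ENNReal.rpow_ne_top_of_nonneg hp.le ENNReal.coe_ne_top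
        rw [ENNReal.le_div_iff_mul_le (by simp) (by simp)]
        set V := volume {x | ((K * s : ℝ≥0) : ℝ≥0∞) < G x}
        have h4 : (K : ℝ≥0∞) ^ p * (s ^ p * V * 2) ≤ (K : ℝ≥0∞) ^ p * weakLpNorm p F ^ p := by
          calc (K : ℝ≥0∞) ^ p * (s ^ p * V * 2) = 2 * (((K * s : ℝ≥0) : ℝ≥0∞) ^ p * V) := by
                rw [ENNReal.coe_mul K s, ENNReal.mul_rpow_of_nonneg _ _ hp.le]; ring
            _ ≤ 2 * ((CR : ℝ≥0∞) ^ p * weakLpNorm p F ^ p) := mul_le_mul' le_rfl (h1.trans h2)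
            _ = 2 * (CR : ℝ≥0∞) ^ p * weakLpNorm p F ^ p := by ring
            _ ≤ _ := mul_le_mul' h3 le_rfl
        exact (ENNReal.mul_le_mul_iff_right hKp hKp').1 h4
      · have h1 := volume_setOf_near_le hn ha.le hc {x | ((s / 2 : ℝ≥0) : ℝ≥0∞) < M x}
          {q | Metric.closedBall q.2 (c * q.1) ⊆ {x | ((s / 2 : ℝ≥0) : ℝ≥0∞) < M x}}
          (fun q hq => hq)
        have h2 := volume_mul_le_weakLpNorm hp M (s / 2)
        set V := volume {x | ((s / 2 : ℝ≥0) : ℝ≥0∞) < M x}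
        calc _ ≤ (s : ℝ≥0∞) ^ p * (D * V) := mul_le_mul' le_rfl h1
          _ = D * 2 ^ p * (((s / 2 : ℝ≥0) : ℝ≥0∞) ^ p * V) := by
            have : (s : ℝ≥0∞) = 2 * ((s / 2 : ℝ≥0) : ℝ≥0∞) := by
              rw [← ENNReal.coe_ofNat, ← ENNReal.coe_mul, mul_div_cancel₀ _ two_ne_zero]
            rw [this, ENNReal.mul_rpow_of_nonneg _ _ hp.le]
            ring
          _ ≤ _ := mul_le_mul' le_rfl h2
    have := ENNReal.rpow_le_rpow this hp.le
    rwa [← ENNReal.rpow_mul, one_div_mul_cancel hp.ne', ENNReal.rpow_one] at this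
  have hFp : weakLpNorm p F ^ p ≠ ∞ := ENNReal.rpow_ne_top_of_nonneg hp.le hfin.ne
  have hD0 : 2 * (D * 2 ^ p) ≠ ∞ := by
    refine ENNReal.mul_ne_top (by simp) (ENNReal.mul_ne_top (by simp [hD]) ?_)
    exact ENNReal.rpow_ne_top_of_nonneg hp.le (by simp)
  have h2 : weakLpNorm p F ^ p ≤ 2 * (D * 2 ^ p) * weakLpNorm p M ^ p := by
    set X := weakLpNorm p F ^ p
    -- The only use of finiteness: `X/2` is cancelled from both sides.
    have h3 : X / 2 ≤ D * 2 ^ p * weakLpNorm p M ^ p := by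
      have h4 : X / 2 + X / 2 ≤ X / 2 + D * 2 ^ p * weakLpNorm p M ^ p := by
        rwa [ENNReal.add_halves]
      exact (ENNReal.add_le_add_iff_left (ENNReal.div_ne_top hFp (by simp))).1 h4
    calc X = 2 * (X / 2) := (ENNReal.mul_div_cancel (by simp) (by simp)).symm
      _ ≤ 2 * (D * 2 ^ p * weakLpNorm p M ^ p) := by gcongr
      _ = _ := by ring
  rw [ENNReal.coe_rpow_of_nonneg _ (by positivity), ENNReal.coe_toNNReal hD0]
  calc weakLpNorm p F = (weakLpNorm p F ^ p) ^ (1 / p) := by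
        rw [← ENNReal.rpow_mul, mul_one_div_cancel hp.ne', ENNReal.rpow_one]
    _ ≤ (2 * (D * 2 ^ p) * weakLpNorm p M ^ p) ^ (1 / p) :=
        ENNReal.rpow_le_rpow h2 (by positivity)
    _ = _ := by
        rw [ENNReal.mul_rpow_of_nonneg _ _ (by positivity), ← ENNReal.rpow_mul _ p,
          mul_one_div_cancel hp.ne', ENNReal.rpow_one]

/-! ### Growth of the mollified distributions -/

theorem seminorm_dilate_le (k l : ℕ) (t : {t : ℝ // 0 < t}) (φ : 𝓢(Rn n, ℂ)) :
    SchwartzMap.seminorm ℂ k l (dilate t φ) ≤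
      (t : ℝ)⁻¹ ^ n * (t : ℝ)⁻¹ ^ l * (t : ℝ) ^ k * SchwartzMap.seminorm ℂ k l φ := by
  have ht := t.2
  have h0 := apply_nonneg (SchwartzMap.seminorm ℂ k l) φ
  refine seminorm_le_bound ℂ k l _ (by positivity) fun x => ?_
  set A : Rn n →L[ℝ] Rn n := (t : ℝ)⁻¹ • ContinuousLinearMap.id ℝ (Rn n) with hA
  have hAn : ‖A‖ ≤ (t : ℝ)⁻¹ := by
    refine (norm_smul_le (t : ℝ)⁻¹ (ContinuousLinearMap.id ℝ (Rn n))).trans ?_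
    rw [Real.norm_of_nonneg (by positivity)]
    exact mul_le_of_le_one_right (by positivity) ContinuousLinearMap.norm_id_le
  have hfun : ⇑(dilate t φ) = (((t : ℝ) ^ n)⁻¹ : ℝ) • (φ ∘ A) := by
    ext y
    simp [dilate_apply, hA]
  have hcd : ContDiff ℝ l (φ ∘ A) := (φ.smooth l).comp A.contDiff
  rw [hfun, iteratedFDeriv_const_smul_apply hcd.contDiffAt, norm_smul,
    Real.norm_of_nonneg (by positivity),
    A.iteratedFDeriv_comp_right (φ.smooth l) x le_rfl]
  have h1 : ‖(iteratedFDeriv ℝ l φ (A x)).compContinuousLinearMap fun _ => A‖ ≤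
      ‖iteratedFDeriv ℝ l φ (A x)‖ * (t : ℝ)⁻¹ ^ l := by
    refine (ContinuousMultilinearMap.norm_compContinuousLinearMap_le _ _).trans ?_
    simp only [Finset.prod_const, Finset.card_univ, Fintype.card_fin]
    gcongr
  have h2 : ‖A x‖ ^ k * ‖iteratedFDeriv ℝ l φ (A x)‖ ≤ SchwartzMap.seminorm ℂ k l φ :=
    le_seminorm ℂ k l φ (A x)
  have h3 : ‖x‖ ^ k = (t : ℝ) ^ k * ‖A x‖ ^ k := by
    rw [← mul_pow]
    congr 1
    simp only [hA, smul_apply, ContinuousLinearMap.id_apply, norm_smul,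
      norm_inv, Real.norm_of_nonneg ht.le]
    field_simp
  calc ‖x‖ ^ k * (((t : ℝ) ^ n)⁻¹ * ‖(iteratedFDeriv ℝ l φ (A x)).compContinuousLinearMap
        fun _ => A‖)
      ≤ ‖x‖ ^ k * (((t : ℝ) ^ n)⁻¹ * (‖iteratedFDeriv ℝ l φ (A x)‖ * (t : ℝ)⁻¹ ^ l)) := by gcongr
    _ = (t : ℝ)⁻¹ ^ n * (t : ℝ)⁻¹ ^ l * (t : ℝ) ^ k *
        (‖A x‖ ^ k * ‖iteratedFDeriv ℝ l φ (A x)‖) := by rw [h3, inv_pow]; ring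
    _ ≤ _ := by gcongr

/-- For bounded `t`, the seminorms of `φ_t` grow at most like a power of `t⁻¹`. -/
theorem exists_supSeminorm_dilate_le (m : ℕ × ℕ) (φ : 𝓢(Rn n, ℂ)) {T : ℝ} (hT : 1 ≤ T) :
    ∃ C : ℝ, 0 ≤ C ∧ ∀ t : {t : ℝ // 0 < t}, (t : ℝ) ≤ T →
      supSeminorm m (dilate t φ) ≤ C * (t : ℝ)⁻¹ ^ (n + m.2) := by
  have h0 := apply_nonneg (supSeminorm m) φ
  refine ⟨T ^ m.2 * T ^ m.1 * supSeminorm m φ, by positivity, fun t ht => ?_⟩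
  have ht0 := t.2
  refine Seminorm.finset_sup_apply_le (by positivity) fun i hi => ?_
  have hi' := Finset.mem_Iic.1 hi
  have h1 : SchwartzMap.seminorm ℂ i.1 i.2 φ ≤ supSeminorm m φ :=
    Seminorm.le_def.1 (Finset.le_sup (f := fun m : ℕ × ℕ => SchwartzMap.seminorm ℂ m.1 m.2) hi) φ
  have h2 : (t : ℝ)⁻¹ ^ i.2 ≤ (t : ℝ)⁻¹ ^ m.2 * T ^ m.2 := by
    calc (t : ℝ)⁻¹ ^ i.2 ≤ (t : ℝ)⁻¹ ^ i.2 * ((t : ℝ)⁻¹ * T) ^ (m.2 - i.2) := by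
          refine le_mul_of_one_le_right (by positivity) (one_le_pow₀ ?_)
          rw [inv_mul_eq_div, one_le_div ht0]
          exact ht
      _ = (t : ℝ)⁻¹ ^ m.2 * T ^ (m.2 - i.2) := by
          rw [mul_pow, ← mul_assoc, ← pow_add, Nat.add_sub_cancel' hi'.2]
      _ ≤ _ := by
          exact mul_le_mul_of_nonneg_left (pow_le_pow_right₀ hT (Nat.sub_le _ _)) (by positivity)
  have h3 : (t : ℝ) ^ i.1 ≤ T ^ m.1 := by
    calc (t : ℝ) ^ i.1 ≤ T ^ i.1 := by gcongr
      _ ≤ _ := pow_le_pow_right₀ hT hi'.1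
  calc SchwartzMap.seminorm ℂ i.1 i.2 (dilate t φ)
      ≤ (t : ℝ)⁻¹ ^ n * (t : ℝ)⁻¹ ^ i.2 * (t : ℝ) ^ i.1 * SchwartzMap.seminorm ℂ i.1 i.2 φ :=
        seminorm_dilate_le _ _ _ _
    _ ≤ (t : ℝ)⁻¹ ^ n * ((t : ℝ)⁻¹ ^ m.2 * T ^ m.2) * T ^ m.1 * supSeminorm m φ := by gcongr
    _ = _ := by rw [pow_add]; ring

/-- The exponent is chosen before the range of scales `T`, and only the constant depends on `T`.
Hence one weight exponent serves all truncation parameters. -/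
theorem exists_conv_dilate_growth (Φ : 𝓢(Rn n, ℂ)) (f : 𝓢'(Rn n, ℂ)) :
    ∃ k : ℕ, ∀ T : ℝ, 1 ≤ T → ∃ C : ℝ, 0 ≤ C ∧ ∀ (t : {t : ℝ // 0 < t}), (t : ℝ) ≤ T →
      ∀ y, ‖conv (dilate t Φ) f y‖ ≤ C * (1 + ‖y‖) ^ k * ((t : ℝ)⁻¹ + 1) ^ k := by
  obtain ⟨m, C, hC, h⟩ := exists_norm_conv_le f
  refine ⟨m.1 + (n + m.2), fun T hT => ?_⟩
  obtain ⟨C', hC', h'⟩ := exists_supSeminorm_dilate_le m Φ hT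
  refine ⟨C * C', by positivity, fun t ht y => (h _ _).trans ?_⟩
  have ht0 := t.2
  calc C * (1 + ‖y‖) ^ m.1 * supSeminorm m (dilate t Φ)
      ≤ C * (1 + ‖y‖) ^ m.1 * (C' * (t : ℝ)⁻¹ ^ (n + m.2)) :=
        mul_le_mul_of_nonneg_left (h' t ht) (by positivity)
    _ = C * C' * (1 + ‖y‖) ^ m.1 * (t : ℝ)⁻¹ ^ (n + m.2) := by ring
    _ ≤ C * C' * (1 + ‖y‖) ^ (m.1 + (n + m.2)) * ((t : ℝ)⁻¹ + 1) ^ (m.1 + (n + m.2)) := by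
        have h1 : (1 + ‖y‖) ^ m.1 ≤ (1 + ‖y‖) ^ (m.1 + (n + m.2)) :=
          pow_le_pow_right₀ (by simp) (Nat.le_add_right _ _)
        have h2 : (t : ℝ)⁻¹ ^ (n + m.2) ≤ ((t : ℝ)⁻¹ + 1) ^ (m.1 + (n + m.2)) :=
          (pow_le_pow_left₀ (by positivity) (by simp) _).trans
            (pow_le_pow_right₀ (by simp; positivity) (Nat.le_add_left _ _))
        exact mul_le_mul (mul_le_mul_of_nonneg_left h1 (by positivity)) h2 (by positivity)
          (by positivity)

theorem ell2_le_sum (c : ℤ → ℂ) (J : Finset ℤ) (hJ : ∀ j, j ∉ J → c j = 0) :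
    ell2 c ≤ ∑ j ∈ J, ‖c j‖ₑ := by
  classical
  refine ell2_le_of_forall fun s l hl => ?_
  calc ‖∑ j ∈ s, l j * c j‖ₑ ≤ ∑ j ∈ s, ‖l j * c j‖ₑ := enorm_sum_le _ _
    _ ≤ ∑ j ∈ s, ‖c j‖ₑ := by
        refine Finset.sum_le_sum fun j hj => ?_
        rw [enorm_mul]
        refine mul_le_of_le_one_left' ?_
        have h1 : ‖l j‖ ^ 2 ≤ 1 := (Finset.single_le_sum (f := fun j => ‖l j‖ ^ 2)
          (fun _ _ => by positivity) hj).trans hl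
        have h2 : ‖l j‖ ≤ 1 := (sq_le_one_iff₀ (norm_nonneg _)).1 h1
        rw [← ofReal_norm]
        exact ENNReal.ofReal_le_one.2 h2
    _ ≤ ∑ j ∈ s ∪ J, ‖c j‖ₑ := Finset.sum_le_sum_of_subset Finset.subset_union_left
    _ = _ := (Finset.sum_subset Finset.subset_union_right fun j _ hj => by simp [hJ j hj]).symm

/-- Growth of finitely supported sequences of mollified distributions. -/
theorem exists_ell2_conv_dilate_growth (Φ : 𝓢(Rn n, ℂ)) (f : ℤ → 𝓢'(Rn n, ℂ)) (J : Finset ℤ)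
    (hJ : ∀ j, j ∉ J → f j = 0) :
    ∃ k : ℕ, ∀ T : ℝ, 1 ≤ T → ∃ C : ℝ, 0 ≤ C ∧ ∀ (t : {t : ℝ // 0 < t}), (t : ℝ) ≤ T →
      ∀ y, ell2 (fun j => conv (dilate t Φ) (f j) y) ≤
        ENNReal.ofReal (C * (1 + ‖y‖) ^ k * ((t : ℝ)⁻¹ + 1) ^ k) := by
  choose k hk using fun j => exists_conv_dilate_growth Φ (f j)
  refine ⟨J.sup k, fun T hT => ?_⟩
  choose C hC0 hC using fun j => hk j T hT
  refine ⟨∑ j ∈ J, C j, Finset.sum_nonneg fun j _ => hC0 j, fun t ht y => ?_⟩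
  have ht0 := t.2
  refine (ell2_le_sum _ J fun j hj => by rw [hJ j hj]; rfl).trans ?_
  rw [Finset.sum_mul, Finset.sum_mul, ENNReal.ofReal_sum_of_nonneg fun j _ => by
    have := hC0 j; positivity]
  refine Finset.sum_le_sum fun j hj => ?_
  rw [← ofReal_norm]
  refine ENNReal.ofReal_le_ofReal ((hC j t ht y).trans ?_)
  have hkj : k j ≤ J.sup k := Finset.le_sup hj
  have h1 : (1 + ‖y‖) ^ k j ≤ (1 + ‖y‖) ^ J.sup k := pow_le_pow_right₀ (by simp) hkj
  have h2 : ((t : ℝ)⁻¹ + 1) ^ k j ≤ ((t : ℝ)⁻¹ + 1) ^ J.sup k :=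
    pow_le_pow_right₀ (by simp; positivity) hkj
  exact mul_le_mul (mul_le_mul_of_nonneg_left h1 (hC0 j)) h2 (by positivity)
    (mul_nonneg (hC0 j) (by positivity))

/-- The truncation weights `1_{t < 1/ε} (t / (t + ε))^k (1 + ε |y|)^{-k}`. -/
def truncWeight (k : ℕ) (ε : ℝ) (t : {t : ℝ // 0 < t}) (y : Rn n) : ℝ≥0 :=
  if (t : ℝ) * ε < 1 then (((t : ℝ) / (t + ε)) ^ k * ((1 + ε * ‖y‖) ^ k)⁻¹).toNNReal else 0

theorem isScaleWeight_one : IsScaleWeight (n := n) 0 fun _ _ => 1 := by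
  simp [IsScaleWeight]

/-- The cutoff passes from `t` to smaller scales, `t/(t + ε) ≤ (t/s) · s/(s + ε)`, and on the
support `ε |z - y| ≤ |z - y|/t`, so the decay in `y` transfers to `z`. -/
theorem isScaleWeight_truncWeight (k : ℕ) {ε : ℝ} (hε : 0 < ε) :
    IsScaleWeight (n := n) k (truncWeight k ε) := by
  refine ⟨fun t y => ?_, fun s t hst y z => ?_⟩
  · have ht := t.2
    unfold truncWeight
    split_ifs
    · rw [Real.toNNReal_le_one]
      refine mul_le_one₀ (pow_le_one₀ (by positivity) ?_) (by positivity)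
        (inv_le_one_of_one_le₀ (one_le_pow₀ ?_))
      · rw [div_le_one (by positivity)]; linarith
      · have : 0 ≤ ε * ‖y‖ := by positivity
        linarith
    · exact zero_le_one
  · have ht := t.2
    have hs := s.2
    unfold truncWeight
    split_ifs with h1 h2
    · rw [Real.coe_toNNReal _ (by positivity), Real.coe_toNNReal _ (by positivity)]
      rw [← inv_pow, ← inv_pow, ← mul_pow, ← mul_pow, ← mul_pow, ← mul_pow]
      refine pow_le_pow_left₀ (by positivity) ?_ k
      have e1 : (t : ℝ) / (t + ε) ≤ t / s * (s / (s + ε)) := by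
        rw [div_mul_div_cancel₀ hs.ne']
        gcongr
      have e2 : (1 + ε * ‖y‖)⁻¹ ≤ (1 + ‖z - y‖ / t) * (1 + ε * ‖z‖)⁻¹ := by
        rw [inv_le_iff_one_le_mul₀' (by positivity), ← mul_assoc, ← div_eq_mul_inv,
          one_le_div (by positivity)]
        have e3 : ‖z‖ ≤ ‖y‖ + ‖z - y‖ := by simpa using norm_add_le y (z - y)
        have e4 : ε * ‖z - y‖ ≤ ‖z - y‖ / t := by
          rw [div_eq_mul_inv, mul_comm]
          refine mul_le_mul_of_nonneg_left ?_ (norm_nonneg _)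
          rw [le_inv_comm₀ hε ht, ← one_div, le_div_iff₀ hε]
          exact h1.le
        have e5 : 0 ≤ ε * ‖y‖ * (‖z - y‖ / t) := by positivity
        nlinarith
      calc _ ≤ (t / s * (s / (s + ε))) * ((1 + ‖z - y‖ / t) * (1 + ε * ‖z‖)⁻¹) :=
            mul_le_mul e1 e2 (by positivity) (by positivity)
        _ = _ := by ring
    · exact absurd ((mul_le_mul_of_nonneg_right hst hε.le).trans_lt h1) h2
    · positivity
    · simp

theorem truncWeight_lt_of_lt (k : ℕ) (t : {t : ℝ // 0 < t}) (y : Rn n) {s v : ℝ≥0∞} (h : s < v) :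
    ∃ i : ℕ, s < truncWeight k (1 / ((i : ℝ) + 1)) t y * v := by
  have ht := t.2
  have h0 := tendsto_one_div_add_atTop_nhds_zero_nat (𝕜 := ℝ)
  have h1 : Filter.Tendsto (fun i : ℕ => truncWeight k (1 / ((i : ℝ) + 1)) t y) Filter.atTop
      (nhds 1) := by
    have hc : ContinuousAt (fun ε : ℝ => (((t : ℝ) / (t + ε)) ^ k *
        ((1 + ε * ‖y‖) ^ k)⁻¹).toNNReal) 0 := by
      refine continuous_real_toNNReal.continuousAt.comp (ContinuousAt.mul (ContinuousAt.pow
        (ContinuousAt.div (by fun_prop) (by fun_prop) ?_) k) (ContinuousAt.inv₀ (by fun_prop) ?_))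
      · simpa using ht.ne'
      · simp
    have h2 := hc.tendsto.comp h0
    simp only [add_zero, div_self ht.ne', one_pow, zero_mul, inv_one, mul_one,
      Real.toNNReal_one] at h2
    refine h2.congr' ?_
    have h3 := h0.const_mul (t : ℝ)
    rw [mul_zero] at h3
    filter_upwards [h3.eventually_lt_const one_pos] with i hi
    rw [truncWeight, if_pos hi]
    rfl
  have h2 := ENNReal.Tendsto.mul_const (b := v) (ENNReal.tendsto_coe.2 h1)
    (Or.inl (by simp))
  rw [ENNReal.coe_one, one_mul] at h2
  exact (h2.eventually_const_lt h).exists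

theorem truncWeight_anti (k : ℕ) {ε δ : ℝ} (hε : 0 < ε) (h : ε ≤ δ) (t : {t : ℝ // 0 < t})
    (y : Rn n) : truncWeight k δ t y ≤ truncWeight k ε t y := by
  have ht := t.2
  unfold truncWeight
  split_ifs with h1 h2
  · have hδ := hε.trans_le h
    exact Real.toNNReal_le_toNNReal (by gcongr)
  · exact absurd ((mul_le_mul_of_nonneg_left h ht.le).trans_lt h1) h2
  · exact zero_le
  · exact le_rfl

/-- Chebyshev's inequality for the `p`-th power of the majorant, which is integrable because `q p >
n`. -/
theorem weakLpNorm_lt_top_of_decay {p q : ℝ} (hp : 0 < p) (hq : n < q * p) (C : ℝ≥0)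
    {g : Rn n → ℝ≥0∞} (hg : ∀ x, g x ≤ ENNReal.ofReal (C * (1 + ‖x‖) ^ (-q))) :
    weakLpNorm p g < ∞ := by
  set h : Rn n → ℝ≥0∞ := fun x => ENNReal.ofReal (C * (1 + ‖x‖) ^ (-q)) ^ p with hh
  have hh' : ∀ x, h x = (C : ℝ≥0∞) ^ p * ENNReal.ofReal ((1 + ‖x‖) ^ (-(q * p))) := by
    intro x
    rw [hh]
    simp only
    rw [ENNReal.ofReal_mul (by positivity), ENNReal.mul_rpow_of_nonneg _ _ hp.le,
      ENNReal.ofReal_coe_nnreal, ENNReal.ofReal_rpow_of_nonneg (by positivity) hp.le,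
      ← Real.rpow_mul (by positivity), neg_mul]
  have hfin : ∫⁻ x, h x < ∞ := by
    simp only [hh']
    rw [lintegral_const_mul' _ _ (ENNReal.rpow_ne_top_of_nonneg hp.le ENNReal.coe_ne_top)]
    refine ENNReal.mul_lt_top (ENNReal.rpow_lt_top_of_nonneg hp.le ENNReal.coe_ne_top) ?_
    exact finite_integral_one_add_norm (by simpa using hq)
  have hle : weakLpNorm p g ≤ (∫⁻ x, h x) ^ (1 / p) := by
    rw [weakLpNorm_le_iff hp]
    intro s
    rw [← ENNReal.rpow_mul, one_div_mul_cancel hp.ne', ENNReal.rpow_one]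
    refine (mul_le_mul' le_rfl (measure_mono fun x (hx : (s : ℝ≥0∞) < g x) => ?_)).trans
      (mul_meas_ge_le_lintegral₀ (by fun_prop) ((s : ℝ≥0∞) ^ p))
    exact ENNReal.rpow_le_rpow (hx.le.trans (hg x)) hp.le
  exact hle.trans_lt (ENNReal.rpow_lt_top_of_nonneg (by positivity) hfin.ne)

/-- The truncated nontangential maximal function of a finitely supported sequence has finite
weak norm. -/
theorem exists_weakLpNorm_truncWeight_lt_top {p a : ℝ} (hp : 0 < p) (ha : 0 < a) (Φ : 𝓢(Rn n, ℂ))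
    (f : ℤ → 𝓢'(Rn n, ℂ)) (J : Finset ℤ) (hJ : ∀ j, j ∉ J → f j = 0) :
    ∃ k : ℕ, ∀ ε : ℝ, 0 < ε → weakLpNorm p (ntSup a fun t y =>
      truncWeight k ε t y * ell2 fun j => conv (dilate t Φ) (f j) y) < ∞ := by
  obtain ⟨m, hm⟩ := exists_ell2_conv_dilate_growth Φ f J hJ
  set q : ℕ := ⌊(n : ℝ) / p⌋₊ + 1 with hq
  have hqp : (n : ℝ) < q * p := by
    rw [← div_lt_iff₀ hp, hq]
    push_cast
    exact Nat.lt_floor_add_one _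
  -- The first `m` powers compensate the growth of the mollified distributions, the further `q >
  -- n/p` give decay in the weak `L^p` range.
  refine ⟨m + q, fun ε hε => ?_⟩
  obtain ⟨C, hC0, hC⟩ := hm (1 / ε + 1) (by simp; positivity)
  set E : ℝ := ε⁻¹ + 1 with hE
  have hE1 : 1 ≤ E := by simp [hE]; positivity
  refine weakLpNorm_lt_top_of_decay hp hqp
    (C * (E * (1 + E)) ^ (m + q) * E ^ (m + q) * (1 + a * E) ^ q).toNNReal fun x => ?_
  rw [Real.coe_toNNReal _ (by positivity)]
  refine iSup_le fun t => iSup_le fun y => iSup_le fun hy => ?_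
  have ht := t.2
  beta_reduce
  unfold truncWeight
  split_ifs with h1
  swap
  · simp
  have htε : (t : ℝ) ≤ ε⁻¹ := by
    rw [← one_div, le_div_iff₀ hε]
    exact h1.le
  refine (mul_le_mul' le_rfl (hC t (by rw [one_div]; linarith) y)).trans ?_
  change ENNReal.ofReal _ * _ ≤ _
  rw [← ENNReal.ofReal_mul (by positivity)]
  refine ENNReal.ofReal_le_ofReal ?_
  have e1 : ((t : ℝ) / (t + ε)) ^ (m + q) * ((t : ℝ)⁻¹ + 1) ^ m ≤ (E * (1 + E)) ^ (m + q) := by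
    have e : ((t : ℝ)⁻¹ + 1) ^ m ≤ ((t : ℝ)⁻¹ + 1) ^ (m + q) :=
      pow_le_pow_right₀ (by simp; positivity) (Nat.le_add_right _ _)
    refine (mul_le_mul_of_nonneg_left e (by positivity)).trans ?_
    rw [← mul_pow]
    refine pow_le_pow_left₀ (by positivity) ?_ _
    have e' : (t : ℝ) / (t + ε) * ((t : ℝ)⁻¹ + 1) = (1 + t) / (t + ε) := by field_simp
    rw [e', div_eq_inv_mul]
    refine mul_le_mul ?_ (by linarith) (by positivity) (by positivity)
    rw [hE]
    have : ((t : ℝ) + ε)⁻¹ ≤ ε⁻¹ := inv_anti₀ hε (by linarith)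
    linarith
  have e2 : ((1 + ε * ‖y‖) ^ (m + q))⁻¹ * (1 + ‖y‖) ^ m ≤ E ^ (m + q) * ((1 + ‖y‖) ^ q)⁻¹ := by
    have e : (1 + ε * ‖y‖)⁻¹ ≤ E * (1 + ‖y‖)⁻¹ := by
      rw [← div_eq_mul_inv, inv_eq_one_div, div_le_div_iff₀ (by positivity) (by positivity), hE]
      have : ε⁻¹ * ε = 1 := inv_mul_cancel₀ hε.ne'
      nlinarith [inv_pos.2 hε, mul_nonneg hε.le (norm_nonneg y)]
    have e' := pow_le_pow_left₀ (by positivity) e (m + q)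
    rw [inv_pow, mul_pow, inv_pow] at e'
    refine (mul_le_mul_of_nonneg_right e' (by positivity)).trans (le_of_eq ?_)
    rw [pow_add (1 + ‖y‖)]
    field_simp
  have e3 : ((1 + ‖y‖) ^ q)⁻¹ ≤ (1 + a * E) ^ q * (1 + ‖x‖) ^ (-(q : ℝ)) := by
    rw [Real.rpow_neg (by positivity), Real.rpow_natCast, ← inv_pow, ← inv_pow, ← mul_pow]
    refine pow_le_pow_left₀ (by positivity) ?_ _
    rw [← div_eq_mul_inv, inv_eq_one_div, div_le_div_iff₀ (by positivity) (by positivity)]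
    have h2 : ‖x‖ ≤ ‖y‖ + a * E := by
      have h3 : ‖x‖ ≤ ‖y‖ + ‖y - x‖ := by
        rw [norm_sub_rev]; simpa using norm_add_le y (x - y)
      have h4 : a * (t : ℝ) ≤ a * E := mul_le_mul_of_nonneg_left (by linarith) ha.le
      linarith
    nlinarith [norm_nonneg y, mul_nonneg (mul_nonneg ha.le (zero_le_one.trans hE1)) (norm_nonneg y)]
  calc _ = C * (((t : ℝ) / (t + ε)) ^ (m + q) * ((t : ℝ)⁻¹ + 1) ^ m) *
        (((1 + ε * ‖y‖) ^ (m + q))⁻¹ * (1 + ‖y‖) ^ m) := by ring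
    _ ≤ C * (E * (1 + E)) ^ (m + q) * (E ^ (m + q) * ((1 + a * E) ^ q * (1 + ‖x‖) ^ (-(q : ℝ)))) :=
        mul_le_mul (mul_le_mul_of_nonneg_left e1 hC0)
          (e2.trans (mul_le_mul_of_nonneg_left e3 (by positivity))) (by positivity) (by positivity)
    _ = _ := by ring

/-! ### Parts (c), (d) and (b) -/

theorem exists_weakLpNorm_auxMax_le (hn : 0 < n) {p a b : ℝ} (hp : 0 < p) (ha : 0 < a)
    (hb : (n : ℝ) / p < b) (Φ : 𝓢(Rn n, ℂ)) :
    ∃ C : ℝ≥0, ∀ f : ℤ → 𝓢'(Rn n, ℂ),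
      weakLpNorm p (auxMax b Φ f) ≤ C * weakLpNorm p (nontangMax a Φ f) := by
  obtain ⟨C, hC⟩ := exists_weakLpNorm_auxSup_le hn hp ha hb
  refine ⟨C, fun f => ?_⟩
  rw [auxMax_eq, nontangMax_eq]
  exact hC fun t y => ell2 fun j => conv (dilate t Φ) (f j) y

theorem exists_weakLpNorm_grandMax_le {b : ℝ} (hb : 0 < b) (Φ : 𝓢(Rn n, ℂ)) (hΦ : ∫ x, Φ x ≠ 0) :
    ∃ C : ℝ≥0, ∀ p : ℝ, 0 < p → ∀ f : ℤ → 𝓢'(Rn n, ℂ),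
      weakLpNorm p (grandMax (⌊b⌋₊ + 1) f) ≤ C * weakLpNorm p (auxMax b Φ f) := by
  obtain ⟨C, hC⟩ := exists_grandMax_le b hb Φ hΦ
  exact ⟨C, fun p hp f => weakLpNorm_le_const_mul hp (hC f)⟩

/-- Two passes for each finite set of components: truncation weights give finiteness with a constant
depending on the growth of `f`, then the trivial weight gives the uniform constant. The components
are finally exhausted by monotonicity. -/
theorem exists_weakLpNorm_nontangMax_le (hn : 0 < n) {p a : ℝ} (hp : 0 < p) (ha : 0 < a)
    (Φ : 𝓢(Rn n, ℂ)) (hΦ : ∫ x, Φ x ≠ 0) :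
    ∃ C : ℝ≥0, ∀ f : ℤ → 𝓢'(Rn n, ℂ),
      weakLpNorm p (nontangMax a Φ f) ≤ C * weakLpNorm p (smoothMax Φ f) := by
  obtain ⟨C, hC⟩ := exists_weakLpNorm_ntSup_weight_le hn hp ha Φ hΦ 0
  refine ⟨C + 1, fun f => ?_⟩
  rcases eq_or_ne (weakLpNorm p (smoothMax Φ f)) ∞ with hM | hM
  · rw [hM, ENNReal.mul_top (by simp)]
    exact le_top
  set fJ : Finset ℤ → ℤ → 𝓢'(Rn n, ℂ) := fun J j => if j ∈ J then f j else 0 with hfJ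
  have hconv : ∀ (J : Finset ℤ) (φ : 𝓢(Rn n, ℂ)) x, (fun j => conv φ (fJ J j) x) =
      fun j => if j ∈ J then conv φ (f j) x else 0 := by
    intro J φ x
    funext j
    simp only [hfJ]
    split_ifs <;> rfl
  have hle : ∀ (J : Finset ℤ) (φ : 𝓢(Rn n, ℂ)) x, ell2 (fun j => conv φ (fJ J j) x) ≤
      ell2 (fun j => conv φ (f j) x) := by
    intro J φ x
    rw [hconv]
    refine ell2_mono fun j => ?_
    split_ifs <;> simp
  have hMJ : ∀ J, weakLpNorm p (smoothMax Φ (fJ J)) ≤ weakLpNorm p (smoothMax Φ f) :=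
    fun J => weakLpNorm_mono hp fun x => iSup_mono fun t => hle J _ _
  have hfin : ∀ J, weakLpNorm p (nontangMax a Φ (fJ J)) < ∞ := by
    intro J
    obtain ⟨k, hk⟩ := exists_weakLpNorm_truncWeight_lt_top hp ha Φ (fJ J) J
      (fun j hj => by simp [hfJ, hj])
    -- This constant depends on `f` through `k` and serves only to prove finiteness.
    obtain ⟨C', hC'⟩ := exists_weakLpNorm_ntSup_weight_le hn hp ha Φ hΦ k
    refine lt_of_le_of_lt (b := C' * weakLpNorm p (smoothMax Φ (fJ J))) ?_
      (ENNReal.mul_lt_top ENNReal.coe_lt_top ((hMJ J).trans_lt hM.lt_top))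
    refine weakLpNorm_le_of_directed hp (ι := ℕ) (G := fun i => ntSup a fun t y =>
      truncWeight k (1 / ((i : ℝ) + 1)) t y * ell2 fun j => conv (dilate t Φ) (fJ J j) y)
      (directed_of_isDirected_le fun i i' h x => ?_) (fun i => ?_) (fun x s hs => ?_)
    · refine iSup_mono fun t => iSup_mono fun y => iSup_mono fun _ => mul_le_mul' ?_ le_rfl
      refine ENNReal.coe_le_coe.2 (truncWeight_anti k (by positivity) ?_ t y)
      gcongr
    · exact hC' _ _ (isScaleWeight_truncWeight k (by positivity)) (hk _ (by positivity))
    · rw [nontangMax_eq] at hs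
      obtain ⟨t, y, hy, hs'⟩ := (lt_ntSup_iff _).1 hs
      obtain ⟨i, hi⟩ := truncWeight_lt_of_lt k t y hs'
      exact ⟨i, (lt_ntSup_iff _).2 ⟨t, y, hy, hi⟩⟩
  have hJ : ∀ J, weakLpNorm p (nontangMax a Φ (fJ J)) ≤ C * weakLpNorm p (smoothMax Φ f) := by
    intro J
    -- With finiteness known, the unweighted inequality applies and its constant no longer sees the
    -- growth of `f`.
    have := hC (fJ J) (fun _ _ => 1) isScaleWeight_one
    simp only [ENNReal.coe_one, one_mul] at this
    exact (this (hfin J)).trans (mul_le_mul' le_rfl (hMJ J))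
  have hfinal : weakLpNorm p (nontangMax a Φ f) ≤ C * weakLpNorm p (smoothMax Φ f) := by
    refine weakLpNorm_le_of_directed hp (G := fun J => nontangMax a Φ (fJ J))
      (directed_of_isDirected_le fun J J' h x => ?_) hJ (fun x s hs => ?_)
    · refine iSup_mono fun t => iSup_mono fun y => iSup_mono fun _ => ?_
      rw [hconv, hconv]
      refine ell2_mono fun j => ?_
      by_cases h1 : j ∈ J
      · simp [h1, h h1]
      · simp [h1]
    · rw [nontangMax_eq] at hs
      obtain ⟨t, y, hy, hs'⟩ := (lt_ntSup_iff _).1 hs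
      obtain ⟨J, hJ⟩ := exists_finset_lt_ell2 hs'
      refine ⟨J, ?_⟩
      rw [nontangMax_eq]
      refine (lt_ntSup_iff _).2 ⟨t, y, hy, ?_⟩
      rw [hconv]
      exact hJ
  refine hfinal.trans (mul_le_mul' ?_ le_rfl)
  exact ENNReal.coe_le_coe.2 le_self_add

/-! ### Completeness of the Schwartz space and bounded distributions -/

theorem seminorm_le_supSeminorm {m i : ℕ × ℕ} (h : i ≤ m) (φ : 𝓢(Rn n, ℂ)) :
    SchwartzMap.seminorm ℂ i.1 i.2 φ ≤ supSeminorm m φ :=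
  Seminorm.le_def.1 (Finset.le_sup (f := fun m : ℕ × ℕ => SchwartzMap.seminorm ℂ m.1 m.2)
    (Finset.mem_Iic.2 h)) φ

theorem exists_tsum_schwartz (φ : ℕ → 𝓢(Rn n, ℂ))
    (h : ∀ k l, Summable fun i => SchwartzMap.seminorm ℂ k l (φ i)) :
    ∃ Φ : 𝓢(Rn n, ℂ), (∀ x, Φ x = ∑' i, φ i x) ∧
      ∀ k l, SchwartzMap.seminorm ℂ k l Φ ≤ ∑' i, SchwartzMap.seminorm ℂ k l (φ i) := by
  have hb : ∀ (k i : ℕ) (x : Rn n),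
      ‖iteratedFDeriv ℝ k (φ i) x‖ ≤ SchwartzMap.seminorm ℂ 0 k (φ i) := by
    intro k i x
    simpa using le_seminorm ℂ 0 k (φ i) x
  have hc : ∀ N : ℕ∞, ContDiff ℝ N fun x => ∑' i, φ i x := fun N =>
    contDiff_tsum (fun i => (φ i).smooth N) (fun k _ => h 0 k) (fun k i x _ => hb k i x)
  have hd : ∀ (k l : ℕ) (x : Rn n), ‖x‖ ^ k * ‖iteratedFDeriv ℝ l (fun x => ∑' i, φ i x) x‖ ≤
      ∑' i, SchwartzMap.seminorm ℂ k l (φ i) := by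
    intro k l x
    rw [iteratedFDeriv_tsum_apply (N := (⊤ : ℕ∞)) (fun i => (φ i).smooth _) (fun k _ => h 0 k)
      (fun k i x _ => hb k i x) le_top]
    have hs : Summable fun i => ‖iteratedFDeriv ℝ l (φ i) x‖ :=
      (h 0 l).of_nonneg_of_le (fun _ => norm_nonneg _) fun i => hb l i x
    refine (mul_le_mul_of_nonneg_left (norm_tsum_le_tsum_norm hs) (by positivity)).trans ?_
    rw [← tsum_mul_left]
    exact (hs.mul_left _).tsum_le_tsum (fun i => le_seminorm ℂ k l (φ i) x) (h k l)
  refine ⟨⟨fun x => ∑' i, φ i x, hc ⊤, fun k l => ⟨_, hd k l⟩⟩, fun x => rfl, fun k l => ?_⟩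
  exact seminorm_le_bound ℂ k l _ (tsum_nonneg fun i => apply_nonneg _ _) (hd k l)

theorem exists_tendsto_sum_schwartz (φ : ℕ → 𝓢(Rn n, ℂ))
    (h : ∀ k l, Summable fun i => SchwartzMap.seminorm ℂ k l (φ i)) :
    ∃ Φ : 𝓢(Rn n, ℂ), Filter.Tendsto (fun K => ∑ i ∈ Finset.range K, φ i) Filter.atTop
      (nhds Φ) := by
  obtain ⟨Φ, hΦ, -⟩ := exists_tsum_schwartz φ h
  have hpt : ∀ x, Summable fun i => φ i x := fun x =>
    (Summable.of_nonneg_of_le (fun _ => norm_nonneg _)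
      (fun i => norm_le_seminorm ℂ (φ i) x) (h 0 0)).of_norm
  refine ⟨Φ, ?_⟩
  rw [(schwartz_withSeminorms ℂ (Rn n) ℂ).tendsto_nhds]
  rintro ⟨k, l⟩ ε hε
  have ht := tendsto_sum_nat_add fun i => SchwartzMap.seminorm ℂ k l (φ i)
  filter_upwards [ht.eventually_lt_const hε] with K hK
  obtain ⟨Ψ, hΨ, hΨ'⟩ := exists_tsum_schwartz (fun i => φ (i + K))
    fun k l => (summable_nat_add_iff K).2 (h k l)
  have : ∑ i ∈ Finset.range K, φ i - Φ = -Ψ := by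
    ext x
    have h1 := (hpt x).sum_add_tsum_nat_add K
    rw [sub_apply, neg_apply, sum_apply, hΦ, hΨ, ← h1]
    ring
  rw [schwartzSeminormFamily_apply, this, map_neg_eq_map]
  exact (hΨ' k l).trans_lt hK

/-- It suffices to sum sequences whose `i`-th increment is below `2^{-i}` in the `i`-th seminorm.
Such increments are summable in every fixed seminorm, and the series is summed termwise with all
derivatives. -/
instance instCompleteSpaceSchwartz : CompleteSpace 𝓢(Rn n, ℂ) := by
  have hcg : (uniformity 𝓢(Rn n, ℂ)).IsCountablyGenerated :=
    IsUniformAddGroup.uniformity_countably_generated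
  refine UniformSpace.complete_of_convergent_controlled_sequences
    (fun i => {p : 𝓢(Rn n, ℂ) × 𝓢(Rn n, ℂ) | supSeminorm (i, i) (p.2 - p.1) < (1 / 2) ^ i})
    (fun i => ?_) (fun u hu => ?_)
  · rw [uniformity_eq_comap_nhds_zero]
    refine ⟨{φ | supSeminorm (i, i) φ < (1 / 2) ^ i}, ?_, fun p hp => hp⟩
    refine (continuous_supSeminorm (i, i)).tendsto' 0 0 (map_zero _) |>.eventually_lt_const
      (by positivity)
  · have hs : ∀ k l, Summable fun i => SchwartzMap.seminorm ℂ k l (u (i + 1) - u i) := by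
      intro k l
      refine Summable.of_norm_bounded_eventually_nat (g := fun i => (1 / 2 : ℝ) ^ i)
        (summable_geometric_of_lt_one (by norm_num) (by norm_num)) ?_
      filter_upwards [Filter.eventually_ge_atTop (max k l)] with i hi
      rw [Real.norm_of_nonneg (apply_nonneg _ _)]
      have h1 : ((k, l) : ℕ × ℕ) ≤ (i, i) := ⟨(le_max_left _ _).trans hi, (le_max_right _ _).trans hi⟩
      exact (seminorm_le_supSeminorm h1 _).trans (hu i i (i + 1) le_rfl (Nat.le_succ i)).le
    obtain ⟨Φ, hΦ⟩ := exists_tendsto_sum_schwartz _ hs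
    refine ⟨Φ + u 0, ?_⟩
    have := hΦ.add_const (u 0)
    simpa only [Finset.sum_range_sub, sub_add_cancel] using this

/-- A complete space with countably generated uniformity is Baire, hence barrelled. This makes the
uniform boundedness principle available on Schwartz functions. -/
instance instBarrelledSpaceSchwartz : BarrelledSpace ℂ 𝓢(Rn n, ℂ) := by
  have hcg : (uniformity 𝓢(Rn n, ℂ)).IsCountablyGenerated :=
    IsUniformAddGroup.uniformity_countably_generated
  have : BaireSpace 𝓢(Rn n, ℂ) := inferInstance
  infer_instance

/-- The seminorm `φ ↦ |φ * f (x)|`. -/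
def convSeminorm (f : 𝓢'(Rn n, ℂ)) (x : Rn n) : Seminorm ℂ 𝓢(Rn n, ℂ) :=
  Seminorm.of (fun φ => ‖conv φ f x‖)
    (fun φ ψ => by rw [conv_add]; exact norm_add_le _ _)
    (fun c φ => by rw [conv_smul, norm_mul])

theorem continuous_convSeminorm (f : 𝓢'(Rn n, ℂ)) (x : Rn n) : Continuous (convSeminorm f x) := by
  change Continuous fun φ => ‖conv φ f x‖
  refine continuous_norm.comp (f.continuous.comp ?_)
  exact (SchwartzMap.compSubConstCLM ℂ x).continuous.comp
    (SchwartzMap.compCLMOfContinuousLinearEquiv ℂ (ContinuousLinearEquiv.neg ℝ)).continuous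

/-- Uniform boundedness principle for bounded distributions. -/
theorem IsBoundedDist.exists_norm_conv_le {f : 𝓢'(Rn n, ℂ)} (hf : IsBoundedDist f) :
    ∃ (m : ℕ × ℕ) (C : ℝ), 0 ≤ C ∧ ∀ φ x, ‖conv φ f x‖ ≤ C * supSeminorm m φ := by
  have hbdd : BddAbove (Set.range (convSeminorm f)) := by
    rw [Seminorm.bddAbove_range_iff]
    intro φ
    obtain ⟨C, hC⟩ := hf φ
    exact ⟨C, by rintro _ ⟨x, rfl⟩; exact hC x⟩
  have hcont : Continuous (⨆ x, convSeminorm f x : Seminorm ℂ 𝓢(Rn n, ℂ)) := by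
    have := Seminorm.continuous_iSup (convSeminorm f) (continuous_convSeminorm f) hbdd
    rwa [← Seminorm.coe_iSup_eq hbdd] at this
  obtain ⟨s, C, -, hC⟩ := Seminorm.bound_of_continuous (schwartz_withSeminorms ℂ (Rn n) ℂ) _ hcont
  refine ⟨s.sup id, C, C.2, fun φ x => ?_⟩
  have h1 : ‖conv φ f x‖ ≤ (⨆ x, convSeminorm f x : Seminorm ℂ 𝓢(Rn n, ℂ)) φ := by
    rw [Seminorm.iSup_apply hbdd]
    exact le_ciSup (f := fun x => convSeminorm f x φ)
      (Seminorm.bddAbove_range_iff.1 hbdd φ) x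
  refine h1.trans ((Seminorm.le_def.1 hC φ).trans ?_)
  rw [smul_apply]
  refine mul_le_mul_of_nonneg_left ?_ C.2
  refine Seminorm.finset_sup_apply_le (apply_nonneg _ _) fun i hi => ?_
  exact seminorm_le_supSeminorm (Finset.le_sup (f := id) hi) φ

theorem dilate_one (t : {t : ℝ // 0 < t}) (ht : (t : ℝ) = 1) (φ : 𝓢(Rn n, ℂ)) : dilate t φ = φ := by
  ext x
  simp [dilate_apply, ht]

/-- Convolutions with a bounded distribution are bounded in terms of finitely many `L¹` norms of
derivatives. -/
theorem IsBoundedDist.exists_enorm_conv_le {f : 𝓢'(Rn n, ℂ)} (hf : IsBoundedDist f)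
    (Φ : 𝓢(Rn n, ℂ)) (hΦ : ∫ x, Φ x = 1) :
    ∃ (N : ℕ) (C : ℝ≥0), ∀ φ x, ‖conv φ f x‖ₑ ≤ C * sobNorm 0 N φ := by
  obtain ⟨m, C, hC, h⟩ := hf.exists_norm_conv_le
  obtain ⟨C', hC', h'⟩ := exists_supSeminorm_dilate_le m Φ le_rfl
  have hr : ((n + m.2 : ℕ) : ℝ) < ((n + m.2 + 1 : ℕ) : ℝ) := by exact_mod_cast Nat.lt_succ_self _
  -- For scales `s ≤ 1` the seminorm bound grows like `s^{-(n + m.2)}`, uniformly in space; so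
  -- weight zero and one derivative more than this exponent suffice.
  obtain ⟨D, hD⟩ := WeakHardy.exists_enorm_conv_le Φ hΦ 0 (n + m.2 + 1) (Nat.cast_nonneg _) hr
  refine ⟨n + m.2 + 1, D * (C * C').toNNReal, fun φ x => ?_⟩
  have := hD φ f ⟨1, one_pos⟩ x (C * C').toNNReal (fun s hs z => by
    have hs0 := s.2
    rw [Real.coe_toNNReal _ (by positivity), pow_zero, mul_one, Real.rpow_natCast, one_div]
    refine (h _ z).trans ?_
    rw [mul_assoc]
    exact mul_le_mul_of_nonneg_left (h' s hs) hC)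
  rw [dilate_one _ rfl] at this
  refine this.trans (le_of_eq ?_)
  push_cast
  ring

/-! ### Bounds for a bounded distribution at all scales -/

theorem wNorm_zero_dilate (t : {t : ℝ // 0 < t}) (φ : 𝓢(Rn n, ℂ)) :
    wNorm 0 (dilate t φ) = wNorm 0 φ := by
  have := lintegral_dilate t (F := fun _ => 1) measurable_const φ
  simpa [wNorm] using this

/-- Unweighted `L¹` norms are invariant under dilation and each derivative costs `1/t`, so nothing
grows at large scales, unlike weighted Schwartz seminorms. The Gaussian means as `μ → 0` need
precisely this. -/
theorem sobNorm_zero_dilate_le (N : ℕ) (t : {t : ℝ // 0 < t}) (φ : 𝓢(Rn n, ℂ)) :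
    sobNorm 0 N (dilate t φ) ≤ ENNReal.ofReal ((1 + (t : ℝ)⁻¹) ^ N) * sobNorm 0 N φ := by
  have ht := t.2
  unfold sobNorm
  rw [Finset.mul_sum]
  refine Finset.sum_le_sum fun α hα => ?_
  rw [mixedDeriv_dilate, wNorm_smul, wNorm_zero_dilate]
  refine mul_le_mul' ?_ le_rfl
  rw [← ofReal_norm]
  refine ENNReal.ofReal_le_ofReal ?_
  rw [norm_pow, norm_inv, Complex.norm_real, Real.norm_of_nonneg ht.le]
  refine (pow_le_pow_left₀ (by positivity) (by linarith) _).trans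
    (pow_le_pow_right₀ (by simp; positivity) ((mem_multiIdx α).1 hα))

/-- Uniform bounds for `φ_s * f`, for a bounded distribution `f`. -/
theorem IsBoundedDist.exists_norm_conv_dilate_le {f : 𝓢'(Rn n, ℂ)} (hf : IsBoundedDist f)
    (φ Φ : 𝓢(Rn n, ℂ)) (hΦ : ∫ x, Φ x = 1) :
    ∃ (N : ℕ) (C : ℝ), 0 ≤ C ∧ ∀ (s : {t : ℝ // 0 < t}) x,
      ‖conv (dilate s φ) f x‖ ≤ C * (1 + (s : ℝ)⁻¹) ^ N := by
  obtain ⟨N, C, h⟩ := hf.exists_enorm_conv_le Φ hΦ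
  refine ⟨N, C * (sobNorm 0 N φ).toReal, by positivity, fun s x => ?_⟩
  have hs := s.2
  have h1 := (h (dilate s φ) x).trans (mul_le_mul' le_rfl (sobNorm_zero_dilate_le N s φ))
  rw [← ofReal_norm, ← ENNReal.ofReal_toReal (sobNorm_ne_top 0 N φ), ← ENNReal.ofReal_coe_nnreal,
    ← ENNReal.ofReal_mul (by positivity), ← ENNReal.ofReal_mul (by positivity),
    ENNReal.ofReal_le_ofReal_iff (by positivity)] at h1
  refine h1.trans (le_of_eq (by ring))

/-! ### Radial Schwartz functions -/

theorem contDiffOn_of_hasDerivAt_chain {F : ℕ → ℝ → ℂ}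
    (hF : ∀ j u, -1 < u → HasDerivAt (F j) (F (j + 1) u) u) (m j : ℕ) : ContDiffOn ℝ m (F j) (Set.Ioi (-1)) := by
  induction m generalizing j with
  | zero =>
    refine contDiffOn_zero.2 fun u hu => (hF j u hu).continuousAt.continuousWithinAt
  | succ m ih =>
    push_cast
    rw [contDiffOn_succ_iff_deriv_of_isOpen isOpen_Ioi]
    refine ⟨fun u hu => (hF j u hu).differentiableAt.differentiableWithinAt, by simp, ?_⟩
    exact (ih (j + 1)).congr fun u hu => (hF j u hu).deriv

theorem iteratedDeriv_of_hasDerivAt_chain {F : ℕ → ℝ → ℂ}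
    (hF : ∀ j u, -1 < u → HasDerivAt (F j) (F (j + 1) u) u) (l j : ℕ) {u : ℝ} (hu : -1 < u) :
    iteratedDeriv l (F j) u = F (j + l) u := by
  induction l generalizing j with
  | zero => simp
  | succ l ih =>
    rw [iteratedDeriv_succ', show j + (l + 1) = j + 1 + l by omega, ← ih]
    refine Filter.EventuallyEq.iteratedDeriv_eq l ?_
    filter_upwards [isOpen_Ioi.mem_nhds hu] with v hv
    exact (hF j v hv).deriv

/-- A function of `|x|²` which is smooth and rapidly decreasing on the half line is a Schwartz
function. -/
theorem exists_schwartz_radial {F : ℕ → ℝ → ℂ}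
    (hF : ∀ j u, -1 < u → HasDerivAt (F j) (F (j + 1) u) u) (hb : ∀ j k, ∃ C : ℝ, ∀ u, 0 ≤ u → u ^ k * ‖F j u‖ ≤ C) :
    ∃ φ : 𝓢(Rn n, ℂ), ∀ x, φ x = F 0 (‖x‖ ^ 2) := by
  -- Only `u ≥ 0` matters for `|x|²`; the cutoff, zero below `-1/2` and one above `-1/4`, extends
  -- the profile to a Schwartz function on the whole line.
  set G : ℝ → ℂ := fun u => Real.smoothTransition (4 * u + 2) • F 0 u with hG
  have hG0 : ∀ u : ℝ, u < -1 / 2 → G =ᶠ[nhds u] fun _ => 0 := by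
    intro u hu
    filter_upwards [isOpen_Iio.mem_nhds hu] with v hv
    have hv' : v < -1 / 2 := hv
    simp only [hG]
    rw [Real.smoothTransition.zero_of_nonpos (by linarith), zero_smul]
  have hG1 : ∀ u : ℝ, -1 / 4 < u → G =ᶠ[nhds u] F 0 := by
    intro u hu
    filter_upwards [isOpen_Ioi.mem_nhds hu] with v hv
    have hv' : -1 / 4 < v := hv
    simp only [hG]
    rw [Real.smoothTransition.one_of_one_le (by linarith), one_smul]
  have hcd : ∀ m : ℕ, ContDiff ℝ m G := by
    intro m
    rw [contDiff_iff_contDiffAt]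
    intro u
    rcases lt_or_ge u (-1 / 2) with hu | hu
    · exact (contDiffAt_const (c := (0 : ℂ))).congr_of_eventuallyEq (hG0 u hu)
    · have h1 : ContDiffAt ℝ m (F 0) u := (contDiffOn_of_hasDerivAt_chain hF m 0).contDiffAt
        (isOpen_Ioi.mem_nhds (by simp only [Set.mem_Ioi]; linarith))
      have h2 : ContDiff ℝ m fun u : ℝ => Real.smoothTransition (4 * u + 2) :=
        Real.smoothTransition.contDiff.comp (by fun_prop)
      exact h2.contDiffAt.smul h1
  have hdec : ∀ k l : ℕ, ∃ C : ℝ, ∀ u, ‖u‖ ^ k * ‖iteratedFDeriv ℝ l G u‖ ≤ C := by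
    intro k l
    simp only [norm_iteratedFDeriv_eq_norm_iteratedDeriv]
    obtain ⟨C, hC⟩ := hb l k
    have hcont : Continuous fun u : ℝ => ‖u‖ ^ k * ‖iteratedDeriv l G u‖ :=
      (continuous_norm.pow k).mul ((hcd l).continuous_iteratedDeriv l le_rfl).norm
    obtain ⟨D, hD⟩ := (isCompact_Icc (a := (-1 : ℝ)) (b := 0)).bddAbove_image hcont.continuousOn
    refine ⟨max (max C D) 0, fun u => ?_⟩
    rcases lt_or_ge u (-1 / 2) with hu | hu
    · rw [Filter.EventuallyEq.iteratedDeriv_eq l (hG0 u hu)]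
      simp
    · rcases lt_or_ge u 0 with hu0 | hu0
      · exact (hD ⟨u, ⟨by linarith, hu0.le⟩, rfl⟩).trans ((le_max_right _ _).trans (le_max_left _ _))
      · rw [Filter.EventuallyEq.iteratedDeriv_eq l (hG1 u (by linarith)),
          iteratedDeriv_of_hasDerivAt_chain hF l 0 (by linarith), zero_add,
          Real.norm_of_nonneg hu0]
        exact (hC u hu0).trans ((le_max_left _ _).trans (le_max_left _ _))
  set g : 𝓢(ℝ, ℂ) := ⟨G, contDiff_infty.2 hcd, hdec⟩ with hg
  refine ⟨SchwartzMap.compCLM ℂ (g := fun x : Rn n => ‖x‖ ^ 2)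
    (Function.hasTemperateGrowth_norm_sq (H := Rn n)) ⟨1, 1, fun x => ?_⟩ g, fun x => ?_⟩
  · rw [Real.norm_of_nonneg (by positivity)]
    nlinarith [norm_nonneg x, sq_nonneg (‖x‖ - 1)]
  · change G (‖x‖ ^ 2) = _
    exact (hG1 _ (by linarith [sq_nonneg ‖x‖])).self_of_nhds

theorem exists_gaussian : ∃ γ : 𝓢(Rn n, ℂ), ∀ x, γ x = (Real.exp (-‖x‖ ^ 2) : ℝ) := by
  obtain ⟨γ, hγ⟩ := exists_schwartz_radial (n := n)
    (F := fun j u => (((-1) ^ j * Real.exp (-u) : ℝ) : ℂ)) (fun j u _ => by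
      have h : HasDerivAt (fun u : ℝ => (-1) ^ j * Real.exp (-u)) ((-1) ^ (j + 1) * Real.exp (-u))
          u := by
        have := ((Real.hasDerivAt_exp (-u)).comp u (hasDerivAt_neg u)).const_mul ((-1 : ℝ) ^ j)
        refine this.congr_deriv ?_
        ring
      exact h.ofReal_comp) (fun j k => ⟨(k.factorial : ℝ), fun u hu => by
        rw [Complex.norm_real, norm_mul, norm_pow, norm_neg, norm_one, one_pow, one_mul,
          Real.norm_of_nonneg (Real.exp_pos _).le, Real.exp_neg, ← div_eq_mul_inv,
          div_le_iff₀ (Real.exp_pos _), ← div_le_iff₀' (by positivity)]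
        exact Real.pow_div_factorial_le_exp u hu k⟩)
  exact ⟨γ, fun x => by rw [hγ]; simp⟩

/-- The Gaussian `e^{-|x|²}`. -/
def gaussian (n : ℕ) : 𝓢(Rn n, ℂ) := (exists_gaussian (n := n)).choose

theorem gaussian_apply (x : Rn n) : gaussian n x = (Real.exp (-‖x‖ ^ 2) : ℝ) :=
  exists_gaussian.choose_spec x

theorem norm_gaussian (x : Rn n) : ‖gaussian n x‖ = Real.exp (-‖x‖ ^ 2) := by
  rw [gaussian_apply, Complex.norm_real, Real.norm_of_nonneg (Real.exp_pos _).le]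

theorem exists_integral_eq_one : ∃ Φ : 𝓢(Rn n, ℂ), ∫ x, Φ x = 1 := by
  have h : ∫ x, gaussian n x ≠ 0 := by
    simp only [gaussian_apply]
    rw [integral_complex_ofReal]
    have : 0 < ∫ x : Rn n, Real.exp (-‖x‖ ^ 2) := by
      have hi : Integrable fun x : Rn n => Real.exp (-‖x‖ ^ 2) := by
        simpa only [norm_gaussian] using (gaussian n).integrable.norm
      rw [integral_pos_iff_support_of_nonneg (fun x => (Real.exp_pos _).le) hi]
      have hs : Function.support (fun x : Rn n => Real.exp (-‖x‖ ^ 2)) = Set.univ := by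
        ext x; simp [Real.exp_ne_zero]
      rw [hs]
      exact isOpen_univ.measure_pos _ Set.univ_nonempty
    exact_mod_cast this.ne'
  refine ⟨(∫ x, gaussian n x)⁻¹ • gaussian n, ?_⟩
  simp only [smul_apply, smul_eq_mul]
  rw [integral_const_mul, inv_mul_cancel₀ h]

/-! ### Poisson integrals as superpositions of Gaussians -/

theorem continuous_dilate_uncurry (φ : 𝓢(Rn n, ℂ)) :
    Continuous fun q : {t : ℝ // 0 < t} × Rn n => dilate q.1 φ q.2 := by
  simp only [dilate_apply]
  have h2 : Continuous fun q : {t : ℝ // 0 < t} × Rn n => (q.1 : ℝ) := by fun_prop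
  have h3 : ∀ q : {t : ℝ // 0 < t} × Rn n, (q.1 : ℝ) ≠ 0 := fun q => q.1.2.ne'
  refine Continuous.smul ((h2.pow n).inv₀ fun q => pow_ne_zero n (h3 q)) ?_
  exact φ.continuous.comp ((h2.inv₀ h3).smul continuous_snd)

/-- A pointwise limit of mollified versions, each of which is an integral depending on the scale
through a jointly continuous integrand. -/
theorem measurable_conv_dilate (φ : 𝓢(Rn n, ℂ)) (f : 𝓢'(Rn n, ℂ)) (x : Rn n) :
    Measurable fun s : {t : ℝ // 0 < t} => conv (dilate s φ) f x := by
  obtain ⟨Φ, hΦ⟩ := exists_integral_eq_one (n := n)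
  refine measurable_of_tendsto_metrizable (f := fun (k : ℕ) (s : {t : ℝ // 0 < t}) =>
    conv (star (dilate s φ) (dilate (dyad k) Φ)) f x) (fun k => ?_) ?_
  · simp only [star_comm (dilate _ φ), conv_star]
    have h1 : Continuous fun q : {t : ℝ // 0 < t} × Rn n =>
        dilate q.1 φ q.2 * conv (dilate (dyad k) Φ) f (x - q.2) :=
      (continuous_dilate_uncurry φ).mul ((conv_continuous _ f).comp (by fun_prop))
    exact (h1.stronglyMeasurable.integral_prod_right').measurable
  · refine tendsto_pi_nhds.2 fun s => ?_
    simpa [hΦ] using tendsto_conv_star_dilate (dilate s φ) Φ f x dyad tendsto_dyad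

open Classical in
/-- The scale `t / μ`, for `μ > 0`. -/
def divScale (t : {t : ℝ // 0 < t}) (μ : ℝ) : {t : ℝ // 0 < t} :=
  if h : 0 < μ then ⟨t / μ, div_pos t.2 h⟩ else t

theorem divScale_of_pos (t : {t : ℝ // 0 < t}) {μ : ℝ} (h : 0 < μ) : (divScale t μ : ℝ) = t / μ := by
  rw [divScale, dif_pos h]

theorem measurable_divScale (t : {t : ℝ // 0 < t}) : Measurable (divScale t) := by
  have h : (fun μ => (divScale t μ : ℝ)) = fun μ => if 0 < μ then (t : ℝ) / μ else t := by
    funext μ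
    unfold divScale
    split_ifs <;> rfl
  refine (MeasurableEmbedding.subtype_coe measurableSet_Ioi).measurable_comp_iff.1 ?_
  change Measurable fun μ => (divScale t μ : ℝ)
  rw [h]
  exact Measurable.ite measurableSet_Ioi (by fun_prop) measurable_const

/-- The Gaussian means appearing in the subordination formula. -/
def gaussMean (t : {t : ℝ // 0 < t}) (f : 𝓢'(Rn n, ℂ)) (μ : ℝ) (x : Rn n) : ℂ :=
  conv (dilate (divScale t μ) (gaussian n)) f x

theorem measurable_gaussMean (t : {t : ℝ // 0 < t}) (f : 𝓢'(Rn n, ℂ)) :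
    Measurable fun q : Rn n × ℝ => gaussMean t f q.2 q.1 :=
  measurable_uncurry_of_continuous_of_measurable (u := fun x μ => gaussMean t f μ x)
    (fun _ => conv_continuous _ f)
    (fun x => (measurable_conv_dilate (gaussian n) f x).comp (measurable_divScale t))

/-- The normalising constant in the subordination formula. -/
def subConst (n : ℕ) : ℝ := 2 / Real.pi ^ (((n : ℝ) + 1) / 2)

theorem subConst_nonneg (n : ℕ) : 0 ≤ subConst n := by unfold subConst; positivity

/-- The Gaussian superposition representing the Poisson integral. -/
def poissonInt (t : {t : ℝ // 0 < t}) (f : 𝓢'(Rn n, ℂ)) (x : Rn n) : ℂ :=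
  subConst n * ∫ μ in Set.Ioi (0 : ℝ), (Real.exp (-μ ^ 2) : ℂ) * gaussMean t f μ x

theorem integrableOn_exp_mul_pow (c : ℝ) (N : ℕ) :
    IntegrableOn (fun μ : ℝ => Real.exp (-μ ^ 2) * (1 + c * μ) ^ N) (Set.Ioi 0) := by
  have : (fun μ : ℝ => Real.exp (-μ ^ 2) * (1 + c * μ) ^ N) = fun μ =>
      ∑ i ∈ Finset.range (N + 1), (c ^ i * N.choose i) * (μ ^ (i : ℝ) * Real.exp (-1 * μ ^ 2)) := by
    funext μ
    rw [add_comm (1 : ℝ), add_pow, Finset.mul_sum]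
    refine Finset.sum_congr rfl fun i _ => ?_
    rw [Real.rpow_natCast, mul_pow, one_pow, neg_one_mul]
    ring
  rw [this]
  refine integrable_finsetSum _ fun i _ => Integrable.const_mul ?_ _
  exact integrableOn_rpow_mul_exp_neg_mul_sq one_pos (by linarith [Nat.cast_nonneg (α := ℝ) i])

/-- Uniform bounds for the Gaussian means of a bounded distribution. -/
theorem IsBoundedDist.exists_norm_gaussMean_le {f : 𝓢'(Rn n, ℂ)} (hf : IsBoundedDist f) :
    ∃ (N : ℕ) (C : ℝ), 0 ≤ C ∧ ∀ (t : {t : ℝ // 0 < t}) (μ : ℝ), 0 < μ → ∀ x,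
      ‖(Real.exp (-μ ^ 2) : ℂ) * gaussMean t f μ x‖ ≤
        C * (Real.exp (-μ ^ 2) * (1 + (t : ℝ)⁻¹ * μ) ^ N) := by
  obtain ⟨Φ, hΦ⟩ := exists_integral_eq_one (n := n)
  obtain ⟨N, C, hC, h⟩ := hf.exists_norm_conv_dilate_le (gaussian n) Φ hΦ
  refine ⟨N, C, hC, fun t μ hμ x => ?_⟩
  rw [norm_mul, Complex.norm_real, Real.norm_of_nonneg (Real.exp_pos _).le]
  have h1 := h (divScale t μ) x
  rw [divScale_of_pos t hμ, inv_div, div_eq_inv_mul] at h1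
  calc _ ≤ Real.exp (-μ ^ 2) * (C * (1 + (t : ℝ)⁻¹ * μ) ^ N) :=
        mul_le_mul_of_nonneg_left h1 (Real.exp_pos _).le
    _ = _ := by ring

theorem aestronglyMeasurable_gaussMean (t : {t : ℝ // 0 < t}) (f : 𝓢'(Rn n, ℂ)) (x : Rn n)
    (ν : Measure ℝ) :
    AEStronglyMeasurable (fun μ => (Real.exp (-μ ^ 2) : ℂ) * gaussMean t f μ x) ν := by
  have h := (measurable_gaussMean t f).comp (measurable_prodMk_left (x := x))
  have h2 : Measurable fun μ : ℝ => (Real.exp (-μ ^ 2) : ℂ) := by fun_prop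
  exact (h2.mul h).aestronglyMeasurable

theorem IsBoundedDist.integrableOn_gaussMean {f : 𝓢'(Rn n, ℂ)} (hf : IsBoundedDist f)
    (t : {t : ℝ // 0 < t}) (x : Rn n) :
    IntegrableOn (fun μ => (Real.exp (-μ ^ 2) : ℂ) * gaussMean t f μ x) (Set.Ioi 0) := by
  obtain ⟨N, C, hC, h⟩ := hf.exists_norm_gaussMean_le
  refine Integrable.mono' ((integrableOn_exp_mul_pow (t : ℝ)⁻¹ N).const_mul C)
    (aestronglyMeasurable_gaussMean t f x _) ?_
  filter_upwards [ae_restrict_mem measurableSet_Ioi] with μ hμ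
  exact h t μ hμ x

theorem IsBoundedDist.continuous_poissonInt {f : 𝓢'(Rn n, ℂ)} (hf : IsBoundedDist f)
    (t : {t : ℝ // 0 < t}) : Continuous (poissonInt t f) := by
  obtain ⟨N, C, hC, h⟩ := hf.exists_norm_gaussMean_le
  refine continuous_const.mul (continuous_of_dominated
    (bound := fun μ => C * (Real.exp (-μ ^ 2) * (1 + (t : ℝ)⁻¹ * μ) ^ N))
    (fun x => aestronglyMeasurable_gaussMean t f x _) (fun x => ?_)
    ((integrableOn_exp_mul_pow (t : ℝ)⁻¹ N).const_mul C) (.of_forall fun μ => ?_))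
  · filter_upwards [ae_restrict_mem measurableSet_Ioi] with μ hμ
    exact h t μ hμ x
  · exact continuous_const.mul (conv_continuous _ f)

/-- Poisson integrals are bounded uniformly at large scales. -/
theorem IsBoundedDist.exists_norm_poissonInt_le {f : 𝓢'(Rn n, ℂ)} (hf : IsBoundedDist f)
    {δ : ℝ} (hδ : 0 < δ) :
    ∃ C : ℝ, ∀ t : {t : ℝ // 0 < t}, δ ≤ t → ∀ x, ‖poissonInt t f x‖ ≤ C := by
  obtain ⟨N, C, hC, h⟩ := hf.exists_norm_gaussMean_le
  refine ⟨subConst n * ∫ μ in Set.Ioi (0 : ℝ), C * (Real.exp (-μ ^ 2) * (1 + δ⁻¹ * μ) ^ N),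
    fun t ht x => ?_⟩
  rw [poissonInt, norm_mul, Complex.norm_real, Real.norm_of_nonneg (subConst_nonneg n)]
  refine mul_le_mul_of_nonneg_left (norm_integral_le_of_norm_le
    ((integrableOn_exp_mul_pow δ⁻¹ N).const_mul C) ?_) (subConst_nonneg n)
  filter_upwards [ae_restrict_mem measurableSet_Ioi] with μ hμ
  have hμ' : 0 < μ := hμ
  refine (h t μ hμ x).trans ?_
  have ht0 := t.2
  gcongr

/-- The subordination formula for the Poisson kernel. -/
theorem integral_exp_mul_gaussian (t : {t : ℝ // 0 < t}) (z : Rn n) :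
    subConst n * ∫ μ in Set.Ioi (0 : ℝ), (Real.exp (-μ ^ 2) : ℂ) *
      dilate (divScale t μ) (gaussian n) z = (poissonKernelDil t z : ℂ) := by
  have ht := t.2
  set b : ℝ := 1 + ‖(t : ℝ)⁻¹ • z‖ ^ 2 with hb
  have hb0 : 0 < b := by positivity
  -- The dilation factor supplies `μ^n` and the exponents combine into `e^{-bμ²}`. The resulting
  -- integral is `Γ((n+1)/2) b^{-(n+1)/2} / 2`, which explains the `2` in `subConst`.
  have h1 : ∫ μ in Set.Ioi (0 : ℝ), (Real.exp (-μ ^ 2) : ℂ) *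
      dilate (divScale t μ) (gaussian n) z =
      ∫ μ in Set.Ioi (0 : ℝ), ((((t : ℝ) ^ n)⁻¹ * (μ ^ (n : ℝ) * Real.exp (-b * μ ^ (2 : ℝ))) : ℝ) : ℂ) := by
    refine setIntegral_congr_fun measurableSet_Ioi fun μ hμ => ?_
    have hμ' : 0 < μ := hμ
    simp only [dilate_apply, divScale_of_pos t hμ', gaussian_apply]
    rw [Complex.real_smul, ← Complex.ofReal_mul, ← Complex.ofReal_mul]
    congr 1
    have h2 : ‖((t : ℝ) / μ)⁻¹ • z‖ ^ 2 = μ ^ 2 * ‖(t : ℝ)⁻¹ • z‖ ^ 2 := by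
      rw [norm_smul, norm_smul, norm_inv, norm_inv, norm_div, Real.norm_of_nonneg hμ'.le]
      field_simp
    rw [h2, Real.rpow_natCast, Real.rpow_two]
    have h3 : Real.exp (-b * μ ^ 2) = Real.exp (-μ ^ 2) *
        Real.exp (-(μ ^ 2 * ‖(t : ℝ)⁻¹ • z‖ ^ 2)) := by
      rw [← Real.exp_add, hb]
      ring_nf
    rw [h3, div_pow, inv_div]
    ring
  rw [h1, integral_complex_ofReal, integral_const_mul,
    integral_rpow_mul_exp_neg_mul_rpow two_pos (by linarith [Nat.cast_nonneg (α := ℝ) n]) hb0,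
    ← Complex.ofReal_mul]
  congr 1
  rw [poissonKernelDil, poissonKernel, subConst, neg_div, Real.rpow_neg hb0.le]
  rw [← hb]
  ring

theorem integral_norm_dilate (s : {t : ℝ // 0 < t}) (φ : 𝓢(Rn n, ℂ)) :
    ∫ z, ‖dilate s φ z‖ = ∫ z, ‖φ z‖ := by
  have h := wNorm_zero_dilate s φ
  rw [wNorm_eq, wNorm_eq, ENNReal.ofReal_eq_ofReal_iff (integral_nonneg fun x => by positivity)
    (integral_nonneg fun x => by positivity)] at h
  simpa using h

theorem measurable_dilate_gaussian (t : {t : ℝ // 0 < t}) :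
    Measurable fun q : ℝ × Rn n => dilate (divScale t q.1) (gaussian n) (-q.2) := by
  have h1 : Measurable fun q : ℝ × Rn n => (divScale t q.1, -q.2) :=
    ((measurable_divScale t).comp measurable_fst).prodMk (measurable_neg.comp measurable_snd)
  have h := (continuous_dilate_uncurry (gaussian n)).measurable.comp h1
  simpa only [Function.comp_def] using h

theorem integrable_exp_mul_dilate_gaussian (t : {t : ℝ // 0 < t}) :
    Integrable (fun q : ℝ × Rn n => (Real.exp (-q.1 ^ 2) : ℂ) *
      dilate (divScale t q.1) (gaussian n) (-q.2))
      ((volume.restrict (Set.Ioi (0 : ℝ))).prod volume) := by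
  have hexp : Measurable fun q : ℝ × Rn n => (Real.exp (-q.1 ^ 2) : ℂ) := by fun_prop
  have h0 : ∀ μ : ℝ, Integrable fun y : Rn n => (Real.exp (-μ ^ 2) : ℂ) *
      dilate (divScale t μ) (gaussian n) (-y) := fun μ =>
    Integrable.const_mul (Integrable.comp_neg (SchwartzMap.integrable _)) _
  have h1 : (fun μ : ℝ => ∫ y : Rn n, ‖(Real.exp (-μ ^ 2) : ℂ) *
      dilate (divScale t μ) (gaussian n) (-y)‖) = fun μ =>
      (Real.exp (-μ ^ 2) * (1 + 0 * μ) ^ 0) * ∫ z, ‖gaussian n z‖ := by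
    funext μ
    simp only [norm_mul, Complex.norm_real, Real.norm_of_nonneg (Real.exp_pos _).le]
    rw [integral_const_mul, integral_neg_eq_self (fun y => ‖dilate (divScale t μ) (gaussian n) y‖),
      integral_norm_dilate, pow_zero, mul_one]
  have h2 : Measurable fun q : ℝ × Rn n => (Real.exp (-q.1 ^ 2) : ℂ) *
    dilate (divScale t q.1) (gaussian n) (-q.2) := hexp.mul (measurable_dilate_gaussian t)
  rw [integrable_prod_iff h2.aestronglyMeasurable]
  refine ⟨Filter.Eventually.of_forall h0, ?_⟩
  simp only at h1 ⊢
  rw [h1]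
  exact (integrableOn_exp_mul_pow 0 0).mul_const _

/-- The Gaussian superposition represents `P_t * f`. -/
theorem IsBoundedDist.integral_poissonInt_mul {f : 𝓢'(Rn n, ℂ)} (hf : IsBoundedDist f)
    (t : {t : ℝ // 0 < t}) (ψ : 𝓢(Rn n, ℂ)) :
    ∫ x, poissonInt t f x * ψ x = ∫ y, conv (reflect ψ) f y * (poissonKernelDil t (-y) : ℂ) := by
  obtain ⟨N, C, hC, h⟩ := hf.exists_norm_gaussMean_le
  obtain ⟨D, hD⟩ := hf (reflect ψ)
  set ν := volume.restrict (Set.Ioi (0 : ℝ)) with hν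
  have hexp : Measurable fun q : Rn n × ℝ => (Real.exp (-q.2 ^ 2) : ℂ) := by fun_prop
  have hpos : ∀ᵐ μ ∂ν, 0 < μ := ae_restrict_mem measurableSet_Ioi
  have hi1 : Integrable (Function.uncurry fun (x : Rn n) (μ : ℝ) =>
      ((Real.exp (-μ ^ 2) : ℂ) * gaussMean t f μ x) * ψ x) (volume.prod ν) := by
    have hb := (ψ.integrable (μ := volume)).norm.mul_prod
      ((integrableOn_exp_mul_pow (t : ℝ)⁻¹ N).const_mul C)
    refine hb.mono' ?_ ?_
    · exact ((hexp.mul (measurable_gaussMean t f)).mul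
        (ψ.continuous.measurable.comp measurable_fst)).aestronglyMeasurable
    · have : ∀ᵐ q ∂(volume : Measure (Rn n)).prod ν, 0 < q.2 :=
        Measure.quasiMeasurePreserving_snd.ae hpos
      filter_upwards [this] with q hq
      simp only [Function.uncurry]
      rw [norm_mul, mul_comm]
      exact mul_le_mul_of_nonneg_left (h t q.2 hq q.1) (norm_nonneg _)
  have hi2 : Integrable (Function.uncurry fun (μ : ℝ) (y : Rn n) =>
      (Real.exp (-μ ^ 2) : ℂ) * (conv (reflect ψ) f y * dilate (divScale t μ) (gaussian n) (-y)))
      (ν.prod volume) := by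
    have hk := integrable_exp_mul_dilate_gaussian (n := n) t
    have hexp' : Measurable fun q : ℝ × Rn n => (Real.exp (-q.1 ^ 2) : ℂ) := by fun_prop
    refine (hk.norm.const_mul D).mono' ?_ (.of_forall fun q => ?_)
    · exact (hexp'.mul (((conv_continuous _ f).measurable.comp measurable_snd).mul
        (measurable_dilate_gaussian t))).aestronglyMeasurable
    · simp only [Function.uncurry]
      rw [mul_left_comm, norm_mul]
      exact mul_le_mul_of_nonneg_right (hD _) (norm_nonneg _)
  -- Fubini, then the pairing symmetry for each Gaussian to move `f` onto `ψ̃`, then Fubini again to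
  -- reassemble the Poisson kernel.
  calc ∫ x, poissonInt t f x * ψ x
      = ∫ x, subConst n * ∫ μ, ((Real.exp (-μ ^ 2) : ℂ) * gaussMean t f μ x) * ψ x ∂ν := by
        refine integral_congr_ae (.of_forall fun x => ?_)
        simp only [poissonInt]
        rw [integral_mul_const, mul_assoc]
    _ = subConst n * ∫ μ, (∫ x, ((Real.exp (-μ ^ 2) : ℂ) * gaussMean t f μ x) * ψ x) ∂ν := by
        rw [integral_const_mul, integral_integral_swap hi1]
    _ = subConst n * ∫ μ, (∫ y, (Real.exp (-μ ^ 2) : ℂ) *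
          (conv (reflect ψ) f y * dilate (divScale t μ) (gaussian n) (-y))) ∂ν := by
        congr 1
        refine integral_congr_ae (.of_forall fun μ => ?_)
        simp only [mul_assoc, gaussMean]
        rw [integral_const_mul, integral_const_mul, integral_conv_mul]
    _ = subConst n * ∫ y, (∫ μ, (Real.exp (-μ ^ 2) : ℂ) *
          (conv (reflect ψ) f y * dilate (divScale t μ) (gaussian n) (-y)) ∂ν) := by
        rw [integral_integral_swap hi2]
    _ = _ := by
        rw [← integral_const_mul]
        refine integral_congr_ae (.of_forall fun y => ?_)
        simp only
        rw [← integral_exp_mul_gaussian t (-y)]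
        simp only [mul_left_comm _ (conv (reflect ψ) f y)]
        rw [integral_const_mul, mul_left_comm]

/-- Compactly supported smooth tests give equality almost everywhere, and continuity gives it
everywhere. This makes the chosen representative of `P_t * f` unique. -/
theorem eq_of_integral_mul_eq {u v : Rn n →ᵇ ℂ}
    (h : ∀ ψ : 𝓢(Rn n, ℂ), ∫ x, u x * ψ x = ∫ x, v x * ψ x) : u = v := by
  have hae : ∀ᵐ x, u x = v x := by
    refine ae_eq_of_integral_contDiff_smul_eq u.continuous.locallyIntegrable
      v.continuous.locallyIntegrable fun g hg hgs => ?_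
    have h1 : HasCompactSupport fun x => (g x : ℂ) := hgs.comp_left (g := fun r : ℝ => (r : ℂ))
      Complex.ofReal_zero
    have h2 : ContDiff ℝ (⊤ : ℕ∞) fun x => (g x : ℂ) := Complex.ofRealCLM.contDiff.comp hg
    have h3 := h (h1.toSchwartzMap h2)
    simp only [Complex.real_smul]
    simpa [mul_comm] using h3
  ext x
  exact congrFun (Continuous.ae_eq_iff_eq volume u.continuous v.continuous |>.1 hae) x

/-- The Poisson integral of a bounded distribution is the Gaussian superposition. -/
theorem IsBoundedDist.poissonConv_eq {f : 𝓢'(Rn n, ℂ)} (hf : IsBoundedDist f)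
    (t : {t : ℝ // 0 < t}) : poissonConv t f = poissonInt t f := by
  obtain ⟨C, hC⟩ := hf.exists_norm_poissonInt_le t.2
  set u : Rn n →ᵇ ℂ := BoundedContinuousFunction.ofNormedAddCommGroup (poissonInt t f)
    (hf.continuous_poissonInt t) C (hC t le_rfl) with hu
  have hex : ∃ u : Rn n →ᵇ ℂ, IsPoissonConv t f u := ⟨u, fun ψ => hf.integral_poissonInt_mul t ψ⟩
  rw [poissonConv, dif_pos hex]
  have : hex.choose = u := eq_of_integral_mul_eq fun ψ =>
    (hex.choose_spec ψ).trans (hf.integral_poissonInt_mul t ψ).symm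
  rw [this]
  rfl

/-- The total mass of the subordination measure. -/
def subMass (n : ℕ) : ℝ≥0∞ :=
  ENNReal.ofReal (subConst n) * ∫⁻ μ in Set.Ioi (0 : ℝ), ENNReal.ofReal (Real.exp (-μ ^ 2))

theorem subMass_ne_top (n : ℕ) : subMass n ≠ ∞ := by
  refine ENNReal.mul_ne_top ENNReal.ofReal_ne_top ?_
  have h := integrableOn_exp_mul_pow 0 0
  simp only [pow_zero, mul_one] at h
  rw [← ofReal_integral_eq_lintegral_ofReal h (.of_forall fun μ => (Real.exp_pos _).le)]
  exact ENNReal.ofReal_ne_top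

/-- Minkowski's inequality in dual form: the Poisson integral averages Gaussian means against a
positive measure of finite mass, and that mass does not depend on the scale. -/
theorem ell2_poissonConv_le {f : ℤ → 𝓢'(Rn n, ℂ)} (hf : ∀ j, IsBoundedDist (f j))
    (t : {t : ℝ // 0 < t}) (x : Rn n) {B : ℝ≥0∞}
    (hB : ∀ s, ell2 (fun j => conv (dilate s (gaussian n)) (f j) x) ≤ B) :
    ell2 (fun j => poissonConv t (f j) x) ≤ subMass n * B := by
  refine ell2_le_of_forall fun s l hl => ?_
  have h1 : ∑ j ∈ s, l j * poissonConv t (f j) x = subConst n * ∫ μ in Set.Ioi (0 : ℝ),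
      (Real.exp (-μ ^ 2) : ℂ) * ∑ j ∈ s, l j * gaussMean t (f j) μ x := by
    have hi : ∀ j ∈ s, IntegrableOn (fun μ => l j * ((Real.exp (-μ ^ 2) : ℂ) *
        gaussMean t (f j) μ x)) (Set.Ioi 0) := fun j _ =>
      ((hf j).integrableOn_gaussMean t x).const_mul (l j)
    simp only [Finset.mul_sum, (hf _).poissonConv_eq, poissonInt, mul_left_comm _ (l _)]
    rw [integral_finsetSum _ hi, Finset.mul_sum]
    refine Finset.sum_congr rfl fun j _ => ?_
    rw [integral_const_mul]
    ring
  rw [h1, enorm_mul, subMass, mul_assoc]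
  refine mul_le_mul' (le_of_eq ?_) ?_
  · rw [← ofReal_norm, Complex.norm_real, Real.norm_of_nonneg (subConst_nonneg n)]
  · refine (enorm_integral_le_lintegral_enorm _).trans ?_
    rw [← lintegral_mul_const _ (by fun_prop)]
    refine lintegral_mono fun μ => ?_
    simp only
    rw [enorm_mul, ← ofReal_norm ((Real.exp _ : ℝ) : ℂ), Complex.norm_real,
      Real.norm_of_nonneg (Real.exp_pos _).le]
    exact mul_le_mul' le_rfl ((enorm_sum_mul_le_ell2 _ l s hl).trans (hB _))

/-! ### From the grand maximal function to the Poisson maximal function -/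

theorem frakN_smul (N : ℕ) (c : ℝ) (hc : 0 ≤ c) (φ : 𝓢(Rn n, ℂ)) :
    frakN N ((c : ℂ) • φ) = c * frakN N φ := by
  unfold frakN
  rw [← integral_const_mul]
  refine integral_congr_ae (.of_forall fun x => ?_)
  simp only [mixedDeriv_smul, smul_apply, norm_smul, Complex.norm_real, Real.norm_of_nonneg hc,
    ← Finset.mul_sum]
  ring

theorem frakN_nonneg (N : ℕ) (φ : 𝓢(Rn n, ℂ)) : 0 ≤ frakN N φ :=
  integral_nonneg fun x => by positivity

theorem ell2_conv_le_grandMax (N : ℕ) (φ : 𝓢(Rn n, ℂ)) (f : ℤ → 𝓢'(Rn n, ℂ)) {c : ℝ} (hc : 0 < c)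
    (hφ : frakN N φ ≤ c) (t : {t : ℝ // 0 < t}) {x y : Rn n} (h : ‖y - x‖ ≤ t) :
    ell2 (fun j => conv (dilate t φ) (f j) y) ≤ ENNReal.ofReal c * grandMax N f x := by
  have h1 : frakN N (((c⁻¹ : ℝ) : ℂ) • φ) ≤ 1 := by
    rw [frakN_smul _ _ (by positivity), inv_mul_le_iff₀ hc, mul_one]
    exact hφ
  have h2 : ell2 (fun j => conv (dilate t (((c⁻¹ : ℝ) : ℂ) • φ)) (f j) y) ≤ grandMax N f x := by
    refine le_trans ?_ (le_iSup (fun φ : {φ : 𝓢(Rn n, ℂ) // frakN N φ ≤ 1} =>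
      nontangMax 1 (φ : 𝓢(Rn n, ℂ)) f x) ⟨_, h1⟩)
    exact le_ntSup (a := 1) (fun t y => ell2 fun j => conv (dilate t _) (f j) y) (by simpa using h)
  rw [ell2_conv_dilate_smul, ← ofReal_norm, Complex.norm_real,
    Real.norm_of_nonneg (by positivity)] at h2
  calc _ = ENNReal.ofReal c * (ENNReal.ofReal c⁻¹ *
        ell2 (fun j => conv (dilate t φ) (f j) y)) := by
        rw [← mul_assoc, ← ENNReal.ofReal_mul hc.le, mul_inv_cancel₀ hc.ne', ENNReal.ofReal_one,
          one_mul]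
    _ ≤ _ := mul_le_mul' le_rfl h2

/-- One value of `φ * f` at `y` is a lower bound, after normalisation, for the grand maximal
function on the whole unit ball about `y`. A finite weak norm therefore bounds that value. -/
theorem exists_ell2_conv_le_of_grandMax {p : ℝ} (hp : 0 < p) (N : ℕ) (f : ℤ → 𝓢'(Rn n, ℂ))
    (hA : weakLpNorm p (grandMax N f) < ∞) :
    ∃ K : ℝ≥0, ∀ φ y, ell2 (fun j => conv φ (f j) y) ≤ sobNorm N (N + 1) φ * K := by
  set A := weakLpNorm p (grandMax N f) with hAdef
  set V := volume (Metric.closedBall (0 : Rn n) 1) with hV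
  have hV0 : V ^ (1 / p) ≠ 0 := by
    have : 0 < V := Metric.measure_closedBall_pos _ _ one_pos
    have hVt : V ≠ ∞ := measure_closedBall_lt_top.ne
    exact (ENNReal.rpow_pos this hVt).ne'
  have hVt : V ^ (1 / p) ≠ ∞ :=
    ENNReal.rpow_ne_top_of_nonneg (by positivity) measure_closedBall_lt_top.ne
  set K := A / V ^ (1 / p) with hK
  have hKt : K ≠ ∞ := ENNReal.div_ne_top hA.ne hV0
  have key : ∀ (φ : 𝓢(Rn n, ℂ)) y (c : ℝ), 0 < c → frakN N φ ≤ c →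
      ell2 (fun j => conv φ (f j) y) ≤ ENNReal.ofReal c * K := by
    intro φ y c hc hφ
    have h1 : ∀ x ∈ Metric.closedBall y 1,
        ell2 (fun j => conv φ (f j) y) / ENNReal.ofReal c ≤ grandMax N f x := by
      intro x hx
      have h2 := ell2_conv_le_grandMax N φ f hc hφ ⟨1, one_pos⟩ (x := x) (y := y) (by
        rw [norm_sub_rev]; simpa [dist_eq_norm] using hx)
      rw [dilate_one _ rfl] at h2
      refine ENNReal.div_le_of_le_mul ?_
      rwa [mul_comm]
    have h3 : ell2 (fun j => conv φ (f j) y) / ENNReal.ofReal c ≤ K := by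
      refine ENNReal.le_of_forall_nnreal_lt fun s hs => ?_
      rw [hK, ENNReal.le_div_iff_mul_le (Or.inl hV0) (Or.inl hVt)]
      refine le_trans (mul_le_mul' le_rfl (ENNReal.rpow_le_rpow ?_ (by positivity)))
        (le_iSup (fun s : ℝ≥0 => (s : ℝ≥0∞) * volume {x | (s : ℝ≥0∞) < grandMax N f x} ^ (1 / p)) s)
      rw [hV, ← Measure.addHaar_closedBall_center volume y 1]
      exact measure_mono fun x hx => hs.trans_le (h1 x hx)
    rw [ENNReal.div_le_iff (by simpa using hc) (by simp)] at h3
    rwa [mul_comm]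
  refine ⟨K.toNNReal, fun φ y => ?_⟩
  rw [ENNReal.coe_toNNReal hKt]
  -- The normalising constant must be positive although `frakN N φ` may vanish, so it is approached
  -- from above.
  have hlim : Filter.Tendsto (fun k : ℕ => ENNReal.ofReal (frakN N φ + 1 / ((k : ℝ) + 1)) * K)
      Filter.atTop (nhds (sobNorm N (N + 1) φ * K)) := by
    refine ENNReal.Tendsto.mul_const ?_ (Or.inr hKt)
    rw [sobNorm_eq_frakN]
    refine ENNReal.tendsto_ofReal ?_
    simpa using tendsto_one_div_add_atTop_nhds_zero_nat.const_add (frakN N φ)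
  exact ge_of_tendsto' hlim fun k => key φ y _
    (add_pos_of_nonneg_of_pos (frakN_nonneg N φ) (by positivity)) (by simp; positivity)

/-! ### From weighted `L¹` norms to Schwartz seminorms, and the bound (e) -/

theorem one_add_norm_pow_le (M : ℕ) (y : Rn n) :
    ∃ β ∈ multiIdx n M, (1 + ‖y‖) ^ M ≤ (n + 1) ^ M * ∏ i, |y i| ^ β i := by
  have h0 : ‖y‖ ≤ ∑ i, |y i| := by
    rw [EuclideanSpace.norm_eq, Real.sqrt_le_left (Finset.sum_nonneg fun _ _ => abs_nonneg _)]
    simpa using Finset.sum_sq_le_sq_sum_of_nonneg (s := Finset.univ) (f := fun i => |y i|) fun i _ => abs_nonneg _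
  by_cases h : ∀ i, |y i| ≤ 1
  · refine ⟨0, by simp [mem_multiIdx], ?_⟩
    simp only [Pi.zero_apply, pow_zero, Finset.prod_const_one, mul_one]
    refine pow_le_pow_left₀ (by positivity) ?_ M
    have : ∑ i, |y i| ≤ ∑ _i : Fin n, (1 : ℝ) := Finset.sum_le_sum fun i _ => h i
    simp at this
    linarith
  · push Not at h
    obtain ⟨i₀, hi₀⟩ := h
    obtain ⟨i, -, hi⟩ := Finset.exists_max_image Finset.univ (fun i => |y i|) ⟨i₀, Finset.mem_univ _⟩
    have h1 : 1 ≤ |y i| := hi₀.le.trans (hi i₀ (Finset.mem_univ _))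
    refine ⟨Pi.single i M, by simp [mem_multiIdx], ?_⟩
    have h2 : ∏ j, |y j| ^ (Pi.single i M : Fin n → ℕ) j = |y i| ^ M := by
      rw [Finset.prod_eq_single i]
      · simp
      · intro j _ hj; simp [hj]
      · simp
    rw [h2, ← mul_pow]
    refine pow_le_pow_left₀ (by positivity) ?_ M
    have : ∑ j, |y j| ≤ ∑ _j : Fin n, |y i| := Finset.sum_le_sum fun j _ => hi j (Finset.mem_univ _)
    simp at this
    linarith

/-- The extra `n + 1` powers of `1 + |x|` make the remaining weight integrable, and one monomial
dominates the total power: that of the largest coordinate, or the constant one. This converts the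
`L¹` bound into membership in `𝓢'(ℝⁿ, ℓ²)`. -/
theorem exists_wNorm_le (N : ℕ) : ∃ C : ℝ≥0, ∀ ψ : 𝓢(Rn n, ℂ), wNorm N ψ ≤
    C * ∑ β ∈ multiIdx n (N + n + 1), ⨆ y : Rn n, ENNReal.ofReal ((∏ i, |y i| ^ β i) * ‖ψ y‖) := by
  set M := N + n + 1 with hM
  set I : ℝ≥0∞ := ∫⁻ x : Rn n, ENNReal.ofReal ((1 + ‖x‖) ^ (-((n : ℝ) + 1))) with hI
  have hIt : I ≠ ∞ := (finite_integral_one_add_norm (by simp)).ne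
  refine ⟨I.toNNReal * (n + 1) ^ M, fun ψ => ?_⟩
  set T : (Fin n → ℕ) → ℝ≥0∞ := fun β => ⨆ y : Rn n,
    ENNReal.ofReal ((∏ i, |y i| ^ β i) * ‖ψ y‖) with hT
  set S := ∑ β ∈ multiIdx n M, T β with hS
  have h1 : ∀ y : Rn n, ENNReal.ofReal ((1 + ‖y‖) ^ M * ‖ψ y‖) ≤ (n + 1) ^ M * S := by
    intro y
    obtain ⟨β, hβ, h⟩ := one_add_norm_pow_le M y
    calc ENNReal.ofReal ((1 + ‖y‖) ^ M * ‖ψ y‖)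
        ≤ ENNReal.ofReal ((n + 1) ^ M * ((∏ i, |y i| ^ β i) * ‖ψ y‖)) := by
          refine ENNReal.ofReal_le_ofReal ?_
          rw [← mul_assoc]
          exact mul_le_mul_of_nonneg_right h (norm_nonneg _)
      _ = (n + 1) ^ M * ENNReal.ofReal ((∏ i, |y i| ^ β i) * ‖ψ y‖) := by
          rw [ENNReal.ofReal_mul (by positivity), ENNReal.ofReal_pow (by positivity)]
          congr 2
          rw [← Nat.cast_succ, ENNReal.ofReal_natCast, Nat.cast_succ]
      _ ≤ _ := by
          have h2 : ENNReal.ofReal ((∏ i, |y i| ^ β i) * ‖ψ y‖) ≤ T β := le_iSup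
            (fun y : Rn n => ENNReal.ofReal ((∏ i, |y i| ^ β i) * ‖ψ y‖)) y
          have h3 : T β ≤ ∑ β ∈ multiIdx n M, T β :=
            Finset.single_le_sum (f := T) (fun _ _ => zero_le) hβ
          exact mul_le_mul' le_rfl (h2.trans h3)
  calc wNorm N ψ ≤ ∫⁻ x : Rn n, ENNReal.ofReal ((1 + ‖x‖) ^ (-((n : ℝ) + 1))) *
        ((n + 1) ^ M * S) := by
        refine lintegral_mono fun x => ?_
        refine le_trans (le_of_eq ?_) (mul_le_mul' le_rfl (h1 x))
        rw [← ofReal_norm, ← ENNReal.ofReal_mul (by positivity), ← ENNReal.ofReal_mul (by positivity)]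
        congr 1
        have h2 : (1 + ‖x‖) ^ M = (1 + ‖x‖) ^ N * (1 + ‖x‖) ^ (n + 1) := by
          rw [← pow_add]; rfl
        have h3 : (1 + ‖x‖) ^ (-((n : ℝ) + 1)) = ((1 + ‖x‖) ^ (n + 1))⁻¹ := by
          rw [Real.rpow_neg (by positivity), ← Nat.cast_succ, Real.rpow_natCast]
        rw [h2, h3]
        field_simp
    _ = _ := by
        rw [lintegral_mul_const _ (by fun_prop), ENNReal.coe_mul, ENNReal.coe_toNNReal hIt]
        push_cast
        ring

theorem wNorm_reflect (N : ℕ) (φ : 𝓢(Rn n, ℂ)) : wNorm N (reflect φ) = wNorm N φ := by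
  unfold wNorm
  rw [← lintegral_neg_eq_self]
  refine lintegral_congr fun x => ?_
  rw [reflect_apply, norm_neg, neg_neg]

theorem sobNorm_reflect (N m : ℕ) (φ : 𝓢(Rn n, ℂ)) : sobNorm N m (reflect φ) = sobNorm N m φ := by
  refine Finset.sum_congr rfl fun α _ => ?_
  rw [mixedDeriv_reflect, wNorm_smul, wNorm_reflect, enorm_pow, enorm_neg, enorm_one, one_pow,
    one_mul]

theorem apply_eq_conv (f : 𝓢'(Rn n, ℂ)) (φ : 𝓢(Rn n, ℂ)) : f φ = conv (reflect φ) f 0 := by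
  rw [conv_eq, reflect_reflect]
  congr 1
  ext x
  simp [translate_apply]

theorem isBoundedSeq_of_grandMax {p : ℝ} (hp : 0 < p) (N : ℕ) (f : ℤ → 𝓢'(Rn n, ℂ))
    (hA : weakLpNorm p (grandMax N f) < ∞) : IsBoundedSeq f := by
  obtain ⟨K, hK⟩ := exists_ell2_conv_le_of_grandMax hp N f hA
  obtain ⟨C, hC⟩ := exists_wNorm_le (n := n) N
  refine ⟨⟨K * C, N + n + 1, fun φ => ?_⟩, fun φ => ⟨(sobNorm N (N + 1) φ).toNNReal * K, fun x => ?_⟩⟩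
  · simp only [apply_eq_conv]
    refine (hK _ 0).trans ?_
    rw [sobNorm_reflect, mul_comm, ENNReal.coe_mul, mul_assoc]
    refine mul_le_mul' le_rfl ((sobNorm_mono (by omega : N + 1 ≤ N + n + 1) φ).trans ?_)
    rw [Finset.mul_sum]
    exact Finset.sum_le_sum fun α _ => hC _
  · rw [ENNReal.coe_mul, ENNReal.coe_toNNReal (sobNorm_ne_top _ _ _)]
    exact hK φ x

theorem isBoundedDist_of_isBoundedSeq {f : ℤ → 𝓢'(Rn n, ℂ)} (hf : IsBoundedSeq f) (j : ℤ) :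
    IsBoundedDist (f j) := by
  intro φ
  obtain ⟨C, hC⟩ := hf.2 φ
  refine ⟨C, fun x => ?_⟩
  have h := (enorm_le_ell2 (fun j => conv φ (f j) x) j).trans (hC x)
  rw [← ofReal_norm, ← ENNReal.ofReal_coe_nnreal] at h
  exact (ENNReal.ofReal_le_ofReal_iff C.2).1 h

theorem continuous_poissonConv (t : {t : ℝ // 0 < t}) (f : 𝓢'(Rn n, ℂ)) :
    Continuous (poissonConv t f) := by
  unfold poissonConv
  split_ifs with h
  · exact h.choose.continuous
  · exact continuous_const

/-- Supplies the measurability in the definition of the weak Hardy space, although the supremum over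
scales is uncountable. -/
theorem lowerSemicontinuous_poissonMax (f : ℤ → 𝓢'(Rn n, ℂ)) :
    LowerSemicontinuous (poissonMax f) := by
  refine lowerSemicontinuous_iSup fun t => ?_
  have h : LowerSemicontinuous fun x => ∑' j, ‖poissonConv t (f j) x‖ₑ ^ 2 :=
    lowerSemicontinuous_tsum fun j =>
      ((ENNReal.continuous_pow 2).comp (continuous_poissonConv t (f j)).enorm).lowerSemicontinuous
  exact ENNReal.continuous_rpow_const.comp_lowerSemicontinuous h
    (ENNReal.monotone_rpow_of_nonneg (by norm_num))

theorem poissonMax_le_grandMax (N : ℕ) {f : ℤ → 𝓢'(Rn n, ℂ)} (hf : ∀ j, IsBoundedDist (f j))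
    (x : Rn n) :
    poissonMax f x ≤ ((subMass n).toNNReal * (frakN N (gaussian n) + 1).toNNReal : ℝ≥0) *
      grandMax N f x := by
  refine iSup_le fun t => ?_
  refine (ell2_poissonConv_le hf t x fun s => ell2_conv_le_grandMax N (gaussian n) f
    (c := frakN N (gaussian n) + 1) ?_ ?_ s (x := x) (y := x) ?_).trans (le_of_eq ?_)
  · linarith [frakN_nonneg N (gaussian n)]
  · linarith
  · simpa using s.2.le
  · rw [ENNReal.coe_mul, ENNReal.coe_toNNReal (subMass_ne_top n), mul_assoc]
    rfl

theorem exists_weakHardyNorm_le (n N : ℕ) : ∃ C : ℝ≥0, ∀ p : ℝ, 0 < p → ∀ f : ℤ → 𝓢'(Rn n, ℂ),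
    weakLpNorm p (grandMax N f) < ∞ → IsBoundedSeq f ∧ MemWeakHardy p f ∧
      weakHardyNorm p f ≤ C * weakLpNorm p (grandMax N f) := by
  refine ⟨(subMass n).toNNReal * (frakN N (gaussian n) + 1).toNNReal, fun p hp f hA => ?_⟩
  have hb := isBoundedSeq_of_grandMax hp N f hA
  have hbd := isBoundedDist_of_isBoundedSeq hb
  have hle := weakLpNorm_le_const_mul hp (poissonMax_le_grandMax N hbd)
  refine ⟨hb, ⟨hbd, (lowerSemicontinuous_poissonMax f).measurable.aemeasurable,
    hle.trans_lt (ENNReal.mul_lt_top ENNReal.coe_lt_top hA)⟩, ?_⟩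
  rwa [weakHardyNorm, if_pos hbd]

/-! ### Combinations of Poisson kernels that are Schwartz functions -/

/-- The Taylor coefficients of the entire function `∏_{k ≥ 0} (1 - 4^{-k} z)`. -/
def eulerCoeff : ℕ → ℝ
  | 0 => 1
  | k + 1 => -((1 / 4) ^ k / (1 - (1 / 4) ^ (k + 1))) * eulerCoeff k

theorem one_sub_quarter_pow_pos (k : ℕ) : (0 : ℝ) < 1 - (1 / 4) ^ (k + 1) := by
  have : ((1 : ℝ) / 4) ^ (k + 1) < 1 := pow_lt_one₀ (by norm_num) (by norm_num) (Nat.succ_ne_zero k)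
  linarith

theorem eulerCoeff_ne_zero (k : ℕ) : eulerCoeff k ≠ 0 := by
  induction k with
  | zero => simp [eulerCoeff]
  | succ k ih =>
    have := one_sub_quarter_pow_pos k
    exact mul_ne_zero (neg_ne_zero.2 (by positivity)) ih

/-- The coefficient form of `E(z) - E(z/4) = -z E(z/4)`. -/
theorem eulerCoeff_succ_mul (k : ℕ) :
    eulerCoeff (k + 1) * (1 - (1 / 4) ^ (k + 1)) = -(1 / 4) ^ k * eulerCoeff k := by
  have := (one_sub_quarter_pow_pos k).ne'
  rw [eulerCoeff]
  field_simp

/-- Consecutive terms have ratio about `4^{-k} |z|`, tending to zero. Convergence is needed for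
every `z`, since the series is used at all powers of four. -/
theorem summable_norm_eulerCoeff_mul_pow (z : ℝ) : Summable fun k => ‖eulerCoeff k * z ^ k‖ := by
  rcases eq_or_ne z 0 with rfl | hz
  · refine summable_of_ne_finset_zero (s := {0}) fun k hk => ?_
    simp only [Finset.mem_singleton] at hk
    simp [hk]
  refine summable_of_ratio_test_tendsto_lt_one (l := 0) one_pos
    (.of_forall fun k => norm_ne_zero_iff.2 (mul_ne_zero (eulerCoeff_ne_zero k) (pow_ne_zero k hz))) ?_
  have h0 : Filter.Tendsto (fun k : ℕ => ((1 : ℝ) / 4) ^ k) Filter.atTop (nhds 0) :=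
    tendsto_pow_atTop_nhds_zero_of_lt_one (by norm_num) (by norm_num)
  have h1 : Filter.Tendsto (fun k : ℕ => ((1 : ℝ) / 4) ^ k / (1 - (1 / 4) ^ (k + 1)) * ‖z‖)
      Filter.atTop (nhds (0 / (1 - 0) * ‖z‖)) :=
    (h0.div (tendsto_const_nhds.sub (h0.comp (Filter.tendsto_add_atTop_nat 1)))
      (by norm_num)).mul_const _
  rw [zero_div, zero_mul] at h1
  refine h1.congr fun k => ?_
  have h2 := one_sub_quarter_pow_pos k
  have h3 : ‖eulerCoeff k * z ^ k‖ ≠ 0 :=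
    norm_ne_zero_iff.2 (mul_ne_zero (eulerCoeff_ne_zero k) (pow_ne_zero k hz))
  rw [norm_norm, norm_norm, eq_div_iff h3, eulerCoeff, pow_succ z, norm_mul, norm_mul, norm_mul,
    norm_mul, norm_neg, Real.norm_of_nonneg (by positivity :
      0 ≤ ((1 : ℝ) / 4) ^ k / (1 - (1 / 4) ^ (k + 1)))]
  ring

theorem summable_eulerCoeff_mul_pow (z : ℝ) : Summable fun k => eulerCoeff k * z ^ k :=
  (summable_norm_eulerCoeff_mul_pow z).of_norm

/-- The entire function `∏_{k ≥ 0} (1 - 4^{-k} z)`, through its power series. -/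
def euler (z : ℝ) : ℝ := ∑' k, eulerCoeff k * z ^ k

theorem euler_eq (z : ℝ) : euler z = (1 - z) * euler (1 / 4 * z) := by
  have h1 : euler z - euler (1 / 4 * z) = -z * euler (1 / 4 * z) := by
    unfold euler
    rw [← (summable_eulerCoeff_mul_pow z).tsum_sub (summable_eulerCoeff_mul_pow _),
      ← tsum_mul_left]
    have hs : Summable fun k => eulerCoeff k * z ^ k - eulerCoeff k * (1 / 4 * z) ^ k :=
      (summable_eulerCoeff_mul_pow z).sub (summable_eulerCoeff_mul_pow _)
    rw [hs.tsum_eq_zero_add]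
    simp only [pow_zero, sub_self, zero_add]
    refine tsum_congr fun k => ?_
    have := eulerCoeff_succ_mul k
    rw [mul_pow, mul_pow]
    calc eulerCoeff (k + 1) * z ^ (k + 1) - eulerCoeff (k + 1) * ((1 / 4) ^ (k + 1) * z ^ (k + 1))
        = eulerCoeff (k + 1) * (1 - (1 / 4) ^ (k + 1)) * z ^ (k + 1) := by ring
      _ = _ := by rw [this]; ring
  linarith

/-- The functional equation carries the zero at `1` to every `4^i`. These are the moment conditions
`∑ e_k 4^{ki} = 0` behind the rapid decay of the profile. -/
theorem euler_four_pow (i : ℕ) : euler (4 ^ i) = 0 := by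
  induction i with
  | zero => rw [euler_eq]; simp
  | succ i ih =>
    rw [euler_eq]
    have : (1 / 4 * 4 ^ (i + 1) : ℝ) = 4 ^ i := by rw [pow_succ]; ring
    rw [this, ih, mul_zero]

/-- A zero at `1/2` would propagate by the functional equation to `4^{-j}/2`, accumulating at `0`,
where the function is continuous with value one. -/
theorem euler_half_ne_zero : euler (1 / 2) ≠ 0 := by
  intro h
  have h1 : ∀ j : ℕ, euler ((1 / 4) ^ j * (1 / 2)) = 0 := by
    intro j
    induction j with
    | zero => simpa using h
    | succ j ih =>
      rw [euler_eq] at ih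
      have h2 : ((1 : ℝ) / 4) ^ j ≤ 1 := pow_le_one₀ (by norm_num) (by norm_num)
      have h3 : (1 : ℝ) - (1 / 4) ^ j * (1 / 2) ≠ 0 := by linarith
      have := (mul_eq_zero.1 ih).resolve_left h3
      rwa [← mul_assoc, ← pow_succ'] at this
  have h0 : Filter.Tendsto (fun k : ℕ => ((1 : ℝ) / 4) ^ k * (1 / 2)) Filter.atTop (nhds 0) := by
    have := (tendsto_pow_atTop_nhds_zero_of_lt_one (by norm_num : (0 : ℝ) ≤ 1 / 4)
      (by norm_num)).mul_const (1 / 2)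
    rwa [zero_mul] at this
  have hc : ContinuousOn euler (Set.Icc (-1) 1) := by
    refine continuousOn_tsum (u := fun k => ‖eulerCoeff k * 1 ^ k‖) (fun k => by fun_prop)
      (summable_norm_eulerCoeff_mul_pow 1) fun k z hz => ?_
    rw [norm_mul, norm_mul, norm_pow, one_pow, norm_one]
    refine mul_le_mul_of_nonneg_left (pow_le_one₀ (norm_nonneg _) ?_) (norm_nonneg _)
    exact abs_le.2 hz
  have h4 : Filter.Tendsto (fun k : ℕ => euler ((1 / 4) ^ k * (1 / 2))) Filter.atTop
      (nhds (euler 0)) :=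
    ((hc.continuousAt (Icc_mem_nhds (by norm_num) (by norm_num))).tendsto).comp h0
  simp only [h1] at h4
  have h5 : euler 0 = 1 := by
    unfold euler
    rw [tsum_eq_single 0 fun k hk => by simp [hk]]
    simp [eulerCoeff]
  rw [h5] at h4
  exact zero_ne_one (tendsto_nhds_unique tendsto_const_nhds h4)

/-- The Taylor expansion of `(1 + v)^{-γ}` with a remainder controlled on the half line. -/
theorem exists_rpow_expansion {γ : ℝ} (hγ : 0 ≤ γ) (L : ℕ) :
    ∃ (c : ℕ → ℝ) (C : ℝ), 0 ≤ C ∧ ∀ v : ℝ, 0 ≤ v →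
      |(1 + v) ^ (-γ) - ∑ i ∈ Finset.range (L + 1), c i * v ^ i| ≤ C * v ^ (L + 1) := by
  set f : ℝ → ℝ := fun v => (1 + v) ^ (-γ) with hf
  have hcd : ContDiffOn ℝ (L + 1) f (Set.Icc 0 1) := by
    refine ContDiffOn.rpow_const_of_ne (by fun_prop) fun v hv => ?_
    have := hv.1
    positivity
  obtain ⟨C, hC⟩ := exists_taylor_mean_remainder_bound zero_le_one hcd
  set c : ℕ → ℝ := fun i => ((i.factorial : ℝ))⁻¹ * iteratedDerivWithin i f (Set.Icc 0 1) 0 with hc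
  -- The first summand covers `v ≤ 1` by Taylor's theorem; the second covers `v > 1`, where the
  -- function and each retained power are at most `v^(L+1)`.
  refine ⟨c, max C 0 + (1 + ∑ i ∈ Finset.range (L + 1), |c i|), by positivity, fun v hv => ?_⟩
  rcases le_or_gt v 1 with h | h
  · have h1 := hC v ⟨hv, h⟩
    rw [taylor_within_apply] at h1
    simp only [sub_zero, smul_eq_mul] at h1
    have h2 : ∑ i ∈ Finset.range (L + 1), c i * v ^ i = ∑ i ∈ Finset.range (L + 1),
        ((i.factorial : ℝ))⁻¹ * v ^ i * iteratedDerivWithin i f (Set.Icc 0 1) 0 :=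
      Finset.sum_congr rfl fun i _ => by rw [hc]; ring
    rw [h2]
    refine h1.trans (mul_le_mul_of_nonneg_right ?_ (by positivity))
    refine (le_max_left C 0).trans (le_add_of_nonneg_right (by positivity))
  · have hv1 : (1 : ℝ) ≤ v ^ (L + 1) := one_le_pow₀ h.le
    have h1 : |(1 + v) ^ (-γ)| ≤ 1 * v ^ (L + 1) := by
      rw [abs_of_nonneg (by positivity), one_mul]
      exact (Real.rpow_le_one_of_one_le_of_nonpos (by linarith) (by linarith)).trans hv1
    have h2 : |∑ i ∈ Finset.range (L + 1), c i * v ^ i| ≤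
        (∑ i ∈ Finset.range (L + 1), |c i|) * v ^ (L + 1) := by
      rw [Finset.sum_mul]
      refine (Finset.abs_sum_le_sum_abs _ _).trans (Finset.sum_le_sum fun i hi => ?_)
      rw [abs_mul, abs_of_nonneg (by positivity : 0 ≤ v ^ i)]
      exact mul_le_mul_of_nonneg_left (pow_le_pow_right₀ h.le (Finset.mem_range.1 hi).le)
        (abs_nonneg _)
    calc _ ≤ |(1 + v) ^ (-γ)| + |∑ i ∈ Finset.range (L + 1), c i * v ^ i| := abs_sub _ _
      _ ≤ 1 * v ^ (L + 1) + (∑ i ∈ Finset.range (L + 1), |c i|) * v ^ (L + 1) := add_le_add h1 h2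
      _ = (1 + ∑ i ∈ Finset.range (L + 1), |c i|) * v ^ (L + 1) := by ring
      _ ≤ _ := by
        refine mul_le_mul_of_nonneg_right ?_ (by positivity)
        exact le_add_of_nonneg_left (le_max_right _ _)

/-- The profile `∑_k e_k (4^k + u)^{-γ}`. -/
def profile (γ u : ℝ) : ℝ := ∑' k, eulerCoeff k * (4 ^ k + u) ^ (-γ)

theorem summable_norm_eulerCoeff : Summable fun k => ‖eulerCoeff k‖ := by
  simpa using summable_norm_eulerCoeff_mul_pow 1

theorem one_le_four_pow (k : ℕ) : (1 : ℝ) ≤ 4 ^ k := one_le_pow₀ (by norm_num)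

theorem norm_profile_term_le {γ δ u : ℝ} (hγ : 0 ≤ γ) (hδ : 0 < δ) (hu : δ ≤ 1 + u) (k : ℕ) :
    ‖eulerCoeff k * (4 ^ k + u) ^ (-γ)‖ ≤ ‖eulerCoeff k‖ * δ ^ (-γ) := by
  have h1 : δ ≤ 4 ^ k + u := hu.trans (by linarith [one_le_four_pow k])
  rw [norm_mul, Real.norm_of_nonneg (Real.rpow_nonneg (hδ.le.trans h1) _)]
  exact mul_le_mul_of_nonneg_left (Real.rpow_le_rpow_of_nonpos hδ h1 (by linarith)) (norm_nonneg _)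

/-- Termwise differentiation only raises the exponent, so one decay estimate for all exponents
controls every derivative. -/
theorem hasDerivAt_profile {γ u : ℝ} (hγ : 0 ≤ γ) (hu : -1 < u) :
    HasDerivAt (profile γ) (-γ * profile (γ + 1) u) u := by
  set δ := (1 + u) / 2 with hδ
  have hδ0 : 0 < δ := by rw [hδ]; linarith
  have h := hasDerivAt_tsum_of_isPreconnected (u := fun k => γ * (‖eulerCoeff k‖ * δ ^ (-(γ + 1))))
    (g := fun k v => eulerCoeff k * (4 ^ k + v) ^ (-γ))
    (g' := fun k v => -γ * (eulerCoeff k * (4 ^ k + v) ^ (-(γ + 1))))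
    (t := Set.Ioi (δ - 1)) (y₀ := u) (y := u)
    ((summable_norm_eulerCoeff.mul_right _).mul_left _) isOpen_Ioi isPreconnected_Ioi
    (fun k v hv => ?_) (fun k v hv => ?_) ?_ ?_ ?_
  · rw [tsum_mul_left] at h
    exact h
  · have hv' : δ - 1 < v := hv
    have hpos : 0 < 4 ^ k + v := by linarith [one_le_four_pow k]
    have := (((hasDerivAt_id v).const_add ((4 : ℝ) ^ k)).rpow_const (p := -γ)
      (Or.inl hpos.ne')).const_mul (eulerCoeff k)
    refine this.congr_deriv ?_
    simp only [id]
    rw [show -(γ + 1) = -γ - 1 by ring]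
    ring
  · have hv' : δ - 1 < v := hv
    rw [norm_mul, norm_neg, Real.norm_of_nonneg hγ]
    exact mul_le_mul_of_nonneg_left (norm_profile_term_le (by linarith) hδ0 (by linarith) k) hγ
  · simp only [Set.mem_Ioi]; linarith
  · exact Summable.of_norm_bounded (summable_norm_eulerCoeff.mul_right _)
      (norm_profile_term_le hγ hδ0 (by linarith))
  · simp only [Set.mem_Ioi]; linarith

/-- The profile is rapidly decreasing. -/
theorem exists_pow_mul_profile_le {γ : ℝ} (hγ : 0 ≤ γ) (L : ℕ) :
    ∃ C : ℝ, ∀ u, 0 ≤ u → u ^ L * |profile γ u| ≤ C := by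
  obtain ⟨c, C, hC0, hC⟩ := exists_rpow_expansion hγ L
  set S := ∑' k, ‖eulerCoeff k‖ with hS
  set S' := ∑' k, ‖eulerCoeff k * (4 ^ (L + 1)) ^ k‖ with hS'
  have hS0 : 0 ≤ S := tsum_nonneg fun _ => norm_nonneg _
  refine ⟨max S (C * S'), fun u hu => ?_⟩
  rcases le_or_gt u 1 with h | h
  · refine le_trans ?_ (le_max_left _ _)
    have h1 : |profile γ u| ≤ S := by
      have h2 : ∀ k, ‖eulerCoeff k * (4 ^ k + u) ^ (-γ)‖ ≤ ‖eulerCoeff k‖ := by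
        intro k
        simpa using norm_profile_term_le hγ one_pos (by linarith : 1 ≤ 1 + u) k
      exact tsum_of_norm_bounded summable_norm_eulerCoeff.hasSum h2
    calc u ^ L * |profile γ u| ≤ 1 * S :=
          mul_le_mul (pow_le_one₀ hu h) h1 (abs_nonneg _) zero_le_one
      _ = S := one_mul S
  · refine le_trans ?_ (le_max_right _ _)
    have hu0 : 0 < u := by linarith
    set R : ℕ → ℝ := fun k => (1 + 4 ^ k / u) ^ (-γ) -
      ∑ i ∈ Finset.range (L + 1), c i * (4 ^ k / u) ^ i with hR
    have hterm : ∀ k, eulerCoeff k * (4 ^ k + u) ^ (-γ) = u ^ (-γ) * (eulerCoeff k * R k) +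
        ∑ i ∈ Finset.range (L + 1), (u ^ (-γ) * c i * (u⁻¹) ^ i) * (eulerCoeff k * (4 ^ i) ^ k) := by
      intro k
      have h1 : (4 : ℝ) ^ k + u = u * (1 + 4 ^ k / u) := by field_simp; ring
      rw [h1, Real.mul_rpow hu0.le (by positivity), hR]
      simp only [mul_sub]
      rw [Finset.mul_sum, Finset.mul_sum, sub_add, ← Finset.sum_sub_distrib]
      rw [Finset.sum_eq_zero, sub_zero]
      · ring
      · intro i _
        rw [div_pow, inv_pow, ← pow_mul, ← pow_mul, mul_comm k i]
        ring
    have hRb : ∀ k, ‖eulerCoeff k * R k‖ ≤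
        (C * (u⁻¹) ^ (L + 1)) * ‖eulerCoeff k * (4 ^ (L + 1)) ^ k‖ := by
      intro k
      rw [norm_mul, norm_mul, Real.norm_of_nonneg (by positivity : (0 : ℝ) ≤ (4 ^ (L + 1)) ^ k)]
      have h1 := hC (4 ^ k / u) (by positivity)
      calc ‖eulerCoeff k‖ * ‖R k‖ ≤ ‖eulerCoeff k‖ * (C * (4 ^ k / u) ^ (L + 1)) :=
            mul_le_mul_of_nonneg_left h1 (norm_nonneg _)
        _ = _ := by
            rw [div_pow, inv_pow, ← pow_mul, ← pow_mul, mul_comm k]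
            ring
    have hsR : Summable fun k => eulerCoeff k * R k :=
      Summable.of_norm_bounded ((summable_norm_eulerCoeff_mul_pow _).mul_left _) hRb
    -- After summation over `k`, the coefficient of `u^{-γ-i}` is a multiple of `E(4^i) = 0`, so
    -- only the remainders contribute.
    have hprof : profile γ u = u ^ (-γ) * ∑' k, eulerCoeff k * R k := by
      unfold profile
      simp only [hterm]
      rw [Summable.tsum_add (hsR.mul_left _) (summable_sum fun i _ =>
        (summable_eulerCoeff_mul_pow _).mul_left _), tsum_mul_left,
        Summable.tsum_finsetSum fun i _ => (summable_eulerCoeff_mul_pow _).mul_left _]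
      rw [Finset.sum_eq_zero, add_zero]
      intro i _
      rw [tsum_mul_left]
      change _ * euler (4 ^ i) = 0
      rw [euler_four_pow, mul_zero]
    have hRs : |∑' k, eulerCoeff k * R k| ≤ (C * (u⁻¹) ^ (L + 1)) * S' :=
      tsum_of_norm_bounded ((summable_norm_eulerCoeff_mul_pow _).hasSum.mul_left _) hRb
    have hug : u ^ (-γ) ≤ 1 := Real.rpow_le_one_of_one_le_of_nonpos h.le (by linarith)
    have hS'0 : 0 ≤ S' := tsum_nonneg fun _ => norm_nonneg _
    rw [hprof, abs_mul, abs_of_nonneg (by positivity : 0 ≤ u ^ (-γ))]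
    calc u ^ L * (u ^ (-γ) * |∑' k, eulerCoeff k * R k|)
        ≤ u ^ L * (1 * ((C * (u⁻¹) ^ (L + 1)) * S')) := by
          refine mul_le_mul_of_nonneg_left (mul_le_mul hug hRs (abs_nonneg _) zero_le_one)
            (by positivity)
      _ = (C * S') * u⁻¹ := by rw [pow_succ, inv_pow]; field_simp
      _ ≤ (C * S') * 1 := mul_le_mul_of_nonneg_left (inv_le_one_of_one_le₀ h.le) (by positivity)
      _ = C * S' := mul_one _

theorem exists_schwartz_profile {γ : ℝ} (hγ : 0 ≤ γ) :
    ∃ φ : 𝓢(Rn n, ℂ), ∀ x, φ x = (profile γ (‖x‖ ^ 2) : ℝ) := by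
  set d : ℕ → ℝ := fun j => ∏ i ∈ Finset.range j, -(γ + i) with hd
  have hF : ∀ j u, -1 < u → HasDerivAt (fun u => ((d j * profile (γ + j) u : ℝ) : ℂ))
      ((d (j + 1) * profile (γ + (j + 1 : ℕ)) u : ℝ) : ℂ) u := by
    intro j u hu
    have h := (hasDerivAt_profile (by positivity : 0 ≤ γ + j) hu).const_mul (d j)
    have h2 : d j * (-(γ + j) * profile (γ + j + 1) u) =
        d (j + 1) * profile (γ + (j + 1 : ℕ)) u := by
      rw [hd]
      simp only [Finset.prod_range_succ]
      push_cast
      ring_nf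
    rw [h2] at h
    exact h.ofReal_comp
  have hb : ∀ j k : ℕ, ∃ C : ℝ, ∀ u : ℝ, 0 ≤ u →
      u ^ k * ‖((d j * profile (γ + j) u : ℝ) : ℂ)‖ ≤ C := by
    intro j k
    obtain ⟨C, hC⟩ := exists_pow_mul_profile_le (by positivity : 0 ≤ γ + j) k
    refine ⟨|d j| * C, fun u hu => ?_⟩
    rw [Complex.norm_real, norm_mul, Real.norm_eq_abs, Real.norm_eq_abs, mul_left_comm]
    exact mul_le_mul_of_nonneg_left (hC u hu) (abs_nonneg _)
  obtain ⟨φ, hφ⟩ := exists_schwartz_radial (n := n)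
    (F := fun j u => ((d j * profile (γ + j) u : ℝ) : ℂ)) hF hb
  refine ⟨φ, fun x => ?_⟩
  rw [hφ]
  simp [hd]

/-! ### A Schwartz function controlled by Poisson kernels -/

/-- The scales `2^k t`. -/
def twoScale (t : {t : ℝ // 0 < t}) (k : ℕ) : {t : ℝ // 0 < t} :=
  ⟨2 ^ k * t, mul_pos (by positivity) t.2⟩

/-- The superposition uses only scales at least `t`, where Poisson integrals of a bounded
distribution are uniformly bounded; this lets its series converge. -/
theorem le_twoScale (t : {t : ℝ // 0 < t}) (k : ℕ) : (t : ℝ) ≤ twoScale t k :=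
  le_mul_of_one_le_left t.2.le (one_le_pow₀ (by norm_num))

/-- The normalising constant of the Poisson kernel. -/
def poissonConst (n : ℕ) : ℝ :=
  Real.Gamma (((n : ℝ) + 1) / 2) / Real.pi ^ (((n : ℝ) + 1) / 2)

theorem poissonConst_pos (n : ℕ) : 0 < poissonConst n :=
  div_pos (Real.Gamma_pos_of_pos (by positivity)) (by positivity)

theorem poissonKernel_nonneg (x : Rn n) : 0 ≤ poissonKernel x :=
  div_nonneg (poissonConst_pos n).le (by positivity)

theorem poissonKernelDil_nonneg (t : {t : ℝ // 0 < t}) (x : Rn n) : 0 ≤ poissonKernelDil t x :=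
  mul_nonneg (inv_nonneg.2 (pow_nonneg t.2.le n)) (poissonKernel_nonneg _)

theorem integrable_poissonKernel : Integrable (poissonKernel (n := n)) := by
  have h := (integrable_rpow_neg_one_add_norm_sq (E := Rn n) (μ := volume) (r := (n : ℝ) + 1)
    (by simp)).const_mul (poissonConst n)
  refine h.congr (.of_forall fun x => ?_)
  simp only [poissonKernel, poissonConst]
  rw [neg_div, Real.rpow_neg (by positivity), div_eq_mul_inv _ ((1 + ‖x‖ ^ 2) ^ _)]

theorem integral_poissonKernel_pos : 0 < ∫ x, poissonKernel (n := n) x := by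
  rw [integral_pos_iff_support_of_nonneg (fun x => poissonKernel_nonneg x) integrable_poissonKernel]
  have hs : Function.support (poissonKernel (n := n)) = Set.univ := by
    ext x
    simp only [Function.mem_support, Set.mem_univ, iff_true]
    exact (div_pos (poissonConst_pos n) (by positivity)).ne'
  rw [hs]
  exact isOpen_univ.measure_pos _ Set.univ_nonempty

theorem integrable_poissonKernelDil (t : {t : ℝ // 0 < t}) :
    Integrable (poissonKernelDil (n := n) t) :=
  (integrable_poissonKernel.comp_smul (inv_ne_zero t.2.ne')).const_mul _

theorem integral_poissonKernelDil (t : {t : ℝ // 0 < t}) :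
    ∫ x, poissonKernelDil (n := n) t x = ∫ x, poissonKernel (n := n) x := by
  have ht := pow_pos t.2 n
  unfold poissonKernelDil
  rw [integral_const_mul, Measure.integral_comp_inv_smul_of_nonneg _ _ t.2.le, smul_eq_mul,
    ← mul_assoc]
  simp [ht.ne']

/-- The coefficients of the combination of Poisson kernels. -/
def poissonCoeff (k : ℕ) : ℝ := eulerCoeff k * (1 / 2) ^ k

theorem summable_norm_poissonCoeff : Summable fun k => ‖poissonCoeff k‖ :=
  summable_norm_eulerCoeff_mul_pow _

/-- The Schwartz function `∑_k e_k (4^k + |x|²)^{-(n+1)/2}`. -/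
def profileSchwartz (n : ℕ) : 𝓢(Rn n, ℂ) :=
  (exists_schwartz_profile (n := n) (by positivity : (0 : ℝ) ≤ ((n : ℝ) + 1) / 2)).choose

theorem profileSchwartz_apply (x : Rn n) :
    profileSchwartz n x = (profile (((n : ℝ) + 1) / 2) (‖x‖ ^ 2) : ℝ) :=
  (exists_schwartz_profile (n := n) (by positivity : (0 : ℝ) ≤ ((n : ℝ) + 1) / 2)).choose_spec x

/-- Rescaling `(4^k + |x|²)^{-(n+1)/2}` gives `2^{-k(n+1)}`, while an `L¹` dilation absorbs only
`2^{-kn}`. The leftover `2^{-k}` is the factor in `poissonCoeff`. -/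
theorem poissonCoeff_mul_poissonKernelDil (t : {t : ℝ // 0 < t}) (k : ℕ) (z : Rn n) :
    poissonCoeff k * poissonKernelDil (twoScale t k) z = poissonConst n * ((t : ℝ) ^ n)⁻¹ *
      (eulerCoeff k * (4 ^ k + ‖(t : ℝ)⁻¹ • z‖ ^ 2) ^ (-(((n : ℝ) + 1) / 2))) := by
  have ht := t.2
  set w := (t : ℝ)⁻¹ • z with hw
  have h1 : ((twoScale t k : ℝ))⁻¹ • z = ((2 : ℝ) ^ k)⁻¹ • w := by
    rw [hw, smul_smul]
    congr 1
    exact mul_inv _ _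
  have h2 : 1 + ‖((2 : ℝ) ^ k)⁻¹ • w‖ ^ 2 = (4 ^ k + ‖w‖ ^ 2) * ((1 / 2) ^ k) ^ (2 : ℝ) := by
    rw [norm_smul, norm_inv, Real.norm_of_nonneg (by positivity), Real.rpow_two, ← pow_mul,
      mul_comm k 2, pow_mul]
    norm_num
    rw [mul_pow, inv_pow, ← pow_mul, mul_comm k 2, pow_mul]
    norm_num
    field_simp
    rw [← mul_pow]
    norm_num
  have h3 : (((1 : ℝ) / 2) ^ k) ^ ((n : ℝ) + 1) = (((2 : ℝ) ^ k)⁻¹) ^ (n + 1) := by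
    rw [one_div, inv_pow, ← Nat.cast_succ, Real.rpow_natCast]
  rw [poissonKernelDil, poissonKernel, h1, h2, Real.mul_rpow (by positivity) (by positivity),
    ← Real.rpow_mul (by positivity), mul_div_cancel₀ _ (two_ne_zero),
    h3, Real.rpow_neg (by positivity), poissonCoeff, poissonConst]
  change _ * (((2 ^ k * (t : ℝ)) ^ n)⁻¹ * _) = _
  rw [one_div, inv_pow, mul_pow, inv_pow, pow_succ]
  field_simp
  ring

theorem tsum_poissonCoeff_mul (t : {t : ℝ // 0 < t}) (z : Rn n) :
    (∑' k, ((poissonCoeff k * poissonKernelDil (twoScale t k) z : ℝ) : ℂ)) =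
      poissonConst n * dilate t (profileSchwartz n) z := by
  rw [← Complex.ofReal_tsum]
  simp only [poissonCoeff_mul_poissonKernelDil]
  rw [tsum_mul_left, dilate_apply, profileSchwartz_apply, Complex.real_smul, profile]
  push_cast
  ring

theorem summable_integral_norm_poissonCoeff (t : {t : ℝ // 0 < t}) :
    Summable fun k => ∫ z : Rn n, ‖poissonCoeff k * poissonKernelDil (twoScale t k) z‖ := by
  refine (summable_norm_poissonCoeff.mul_right (∫ x, poissonKernel (n := n) x)).congr fun k => ?_
  simp only [norm_mul, Real.norm_of_nonneg (poissonKernelDil_nonneg _ _)]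
  rw [integral_const_mul, integral_poissonKernelDil]

/-- All dilated Poisson kernels have the same integral, so up to the nonzero factor `poissonConst n`
the integral is `∑ e_k 2^{-k} = E(1/2)` times `∫ P`. -/
theorem integral_profileSchwartz_ne_zero (n : ℕ) : ∫ x, profileSchwartz n x ≠ 0 := by
  have h := hasSum_integral_of_summable_integral_norm
    (F := fun k (z : Rn n) => ((poissonCoeff k * poissonKernelDil (twoScale ⟨1, one_pos⟩ k) z : ℝ) : ℂ))
    (μ := volume) (fun k => ((integrable_poissonKernelDil _).const_mul _).ofReal)
    (by simpa only [Complex.norm_real] using summable_integral_norm_poissonCoeff (n := n) ⟨1, one_pos⟩)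
  simp only [tsum_poissonCoeff_mul, integral_complex_ofReal, integral_const_mul,
    integral_poissonKernelDil, dilate_one ⟨1, one_pos⟩ rfl] at h
  have h2 : HasSum (fun k => ((poissonCoeff k * ∫ x, poissonKernel (n := n) x : ℝ) : ℂ))
      ((euler (1 / 2) * ∫ x, poissonKernel (n := n) x : ℝ) : ℂ) :=
    Complex.hasSum_ofReal.2 ((summable_eulerCoeff_mul_pow (1 / 2)).hasSum.mul_right _)
  have h3 := h.unique h2
  intro h0
  rw [h0, mul_zero] at h3
  have : euler (1 / 2) * ∫ x, poissonKernel (n := n) x = 0 := by exact_mod_cast h3.symm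
  exact (mul_ne_zero euler_half_ne_zero integral_poissonKernel_pos.ne') this

/-- Both sides are bounded continuous functions, so they are compared against test functions. There
`f` sits on the test function, and the identity becomes the superposition formula for the kernel,
integrated term by term. -/
theorem IsBoundedDist.conv_profileSchwartz {f : 𝓢'(Rn n, ℂ)} (hf : IsBoundedDist f)
    (t : {t : ℝ // 0 < t}) (x : Rn n) :
    poissonConst n * conv (dilate t (profileSchwartz n)) f x =
      ∑' k, (poissonCoeff k : ℂ) * poissonInt (twoScale t k) f x := by
  obtain ⟨C, hC⟩ := hf.exists_norm_poissonInt_le t.2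
  obtain ⟨D, hD⟩ := hf (dilate t (profileSchwartz n))
  have hb : ∀ k x, ‖(poissonCoeff k : ℂ) * poissonInt (twoScale t k) f x‖ ≤ ‖poissonCoeff k‖ * C := by
    intro k x
    rw [norm_mul, Complex.norm_real]
    exact mul_le_mul_of_nonneg_left (hC _ (le_twoScale t k) x) (norm_nonneg _)
  have hs := summable_norm_poissonCoeff.mul_right C
  set u : Rn n →ᵇ ℂ := BoundedContinuousFunction.ofNormedAddCommGroup
    (fun x => poissonConst n * conv (dilate t (profileSchwartz n)) f x)
    (continuous_const.mul (conv_continuous _ f)) (poissonConst n * D) (fun x => by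
      rw [norm_mul, Complex.norm_real, Real.norm_of_nonneg (poissonConst_pos n).le]
      exact mul_le_mul_of_nonneg_left (hD x) (poissonConst_pos n).le) with hu
  set v : Rn n →ᵇ ℂ := BoundedContinuousFunction.ofNormedAddCommGroup
    (fun x => ∑' k, (poissonCoeff k : ℂ) * poissonInt (twoScale t k) f x)
    (continuous_tsum (fun k => continuous_const.mul (hf.continuous_poissonInt _)) hs hb)
    (∑' k, ‖poissonCoeff k‖ * C) (fun x => tsum_of_norm_bounded hs.hasSum fun k => hb k x) with hv
  suffices u = v from congrArg (fun w : Rn n →ᵇ ℂ => w x) this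
  refine eq_of_integral_mul_eq fun ψ => ?_
  change ∫ x, (poissonConst n * conv (dilate t (profileSchwartz n)) f x) * ψ x =
    ∫ x, (∑' k, (poissonCoeff k : ℂ) * poissonInt (twoScale t k) f x) * ψ x
  obtain ⟨E, hE⟩ := hf (reflect ψ)
  have hE0 : 0 ≤ E := (norm_nonneg _).trans (hE 0)
  have hFb : ∀ k y, ‖conv (reflect ψ) f y *
      ((poissonCoeff k * poissonKernelDil (twoScale t k) (-y) : ℝ) : ℂ)‖ ≤
        E * (‖poissonCoeff k‖ * poissonKernelDil (twoScale t k) (-y)) := by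
    intro k y
    rw [norm_mul, Complex.norm_real, norm_mul,
      Real.norm_of_nonneg (poissonKernelDil_nonneg (twoScale t k) (-y))]
    exact mul_le_mul_of_nonneg_right (hE y)
      (mul_nonneg (norm_nonneg _) (poissonKernelDil_nonneg _ _))
  have hFi : ∀ k, Integrable fun y : Rn n =>
      E * (‖poissonCoeff k‖ * poissonKernelDil (twoScale t k) (-y)) := fun k =>
    ((integrable_poissonKernelDil (twoScale t k)).comp_neg.const_mul _).const_mul _
  have hF : ∀ k, Integrable fun y => conv (reflect ψ) f y *
      ((poissonCoeff k * poissonKernelDil (twoScale t k) (-y) : ℝ) : ℂ) := fun k =>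
    (hFi k).mono' ((conv_continuous _ f).aestronglyMeasurable.mul
      ((integrable_poissonKernelDil (twoScale t k)).comp_neg.const_mul
        (poissonCoeff k)).ofReal.aestronglyMeasurable) (.of_forall (hFb k))
  have hGb : ∀ k x, ‖((poissonCoeff k : ℂ) * poissonInt (twoScale t k) f x) * ψ x‖ ≤
      ‖poissonCoeff k‖ * C * ‖ψ x‖ := fun k x => by
    rw [norm_mul]
    exact mul_le_mul_of_nonneg_right (hb k x) (norm_nonneg _)
  have hG : ∀ k, Integrable fun x =>
      ((poissonCoeff k : ℂ) * poissonInt (twoScale t k) f x) * ψ x := fun k =>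
    (ψ.integrable.norm.const_mul (‖poissonCoeff k‖ * C)).mono'
      ((continuous_const.mul (hf.continuous_poissonInt _)).mul ψ.continuous).aestronglyMeasurable
      (.of_forall (hGb k))
  have h1 := hasSum_integral_of_summable_integral_norm
    (F := fun k (y : Rn n) => conv (reflect ψ) f y *
      ((poissonCoeff k * poissonKernelDil (twoScale t k) (-y) : ℝ) : ℂ)) (μ := volume) hF ?_
  have h2 := hasSum_integral_of_summable_integral_norm
    (F := fun k (x : Rn n) => ((poissonCoeff k : ℂ) * poissonInt (twoScale t k) f x) * ψ x)
    (μ := volume) hG ?_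
  · have h3 : ∀ k, ∫ y, conv (reflect ψ) f y *
        ((poissonCoeff k * poissonKernelDil (twoScale t k) (-y) : ℝ) : ℂ) =
        ∫ x, ((poissonCoeff k : ℂ) * poissonInt (twoScale t k) f x) * ψ x := by
      intro k
      simp only [mul_assoc]
      rw [integral_const_mul, hf.integral_poissonInt_mul, ← integral_const_mul]
      refine integral_congr_ae (.of_forall fun y => ?_)
      push_cast
      ring
    simp only [h3, tsum_mul_left, tsum_mul_right, tsum_poissonCoeff_mul] at h1 h2
    rw [h2.unique h1]
    simp only [mul_assoc]
    rw [integral_const_mul, integral_conv_mul, ← integral_const_mul]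
    refine integral_congr_ae (.of_forall fun y => ?_)
    simp only
    ring
  · refine Summable.of_nonneg_of_le (fun k => integral_nonneg fun _ => norm_nonneg _)
      (fun k => integral_mono (hG k).norm (ψ.integrable.norm.const_mul _) (hGb k)) ?_
    simp only [integral_const_mul]
    exact hs.mul_right _
  · refine Summable.of_nonneg_of_le (fun k => integral_nonneg fun _ => norm_nonneg _)
      (fun k => integral_mono (hF k).norm (hFi k) (hFb k)) ?_
    simp only [integral_const_mul, integral_neg_eq_self (poissonKernelDil (n := n) _),
      integral_poissonKernelDil]
    exact (summable_norm_poissonCoeff.mul_right _).mul_left E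

/-- Triangle inequality for the superposition, whose coefficients are absolutely summable. The bound
is pointwise, so the constant in (a) does not depend on `p`. -/
theorem ell2_conv_profileSchwartz_le {f : ℤ → 𝓢'(Rn n, ℂ)} (hf : ∀ j, IsBoundedDist (f j))
    (t : {t : ℝ // 0 < t}) (x : Rn n) :
    ell2 (fun j => conv (dilate t (profileSchwartz n)) (f j) x) ≤
      (‖(poissonConst n : ℂ)‖₊⁻¹ * ∑' k, ‖poissonCoeff k‖₊ : ℝ≥0) * poissonMax f x := by
  refine ell2_le_of_forall fun s l hl => ?_
  have hsm : ∀ j, Summable fun k =>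
      l j * ((poissonCoeff k : ℂ) * poissonInt (twoScale t k) (f j) x) := by
    intro j
    obtain ⟨C, hC⟩ := (hf j).exists_norm_poissonInt_le t.2
    refine Summable.mul_left (l j)
      (Summable.of_norm_bounded (summable_norm_poissonCoeff.mul_right C) fun k => ?_)
    rw [norm_mul, Complex.norm_real]
    exact mul_le_mul_of_nonneg_left (hC _ (le_twoScale t k) x) (norm_nonneg _)
  have hS : Summable fun k => ‖poissonCoeff k‖₊ := by
    simpa only [← NNReal.summable_coe, coe_nnnorm] using summable_norm_poissonCoeff
  have h1 : (poissonConst n : ℂ) * ∑ j ∈ s, l j * conv (dilate t (profileSchwartz n)) (f j) x =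
      ∑' k, (poissonCoeff k : ℂ) * ∑ j ∈ s, l j * poissonConv (twoScale t k) (f j) x := by
    simp only [Finset.mul_sum, (hf _).poissonConv_eq, mul_left_comm _ (l _)]
    rw [Summable.tsum_finsetSum fun j _ => hsm j]
    refine Finset.sum_congr rfl fun j _ => ?_
    rw [(hf j).conv_profileSchwartz, tsum_mul_left]
  have h2 : ‖(poissonConst n : ℂ)‖ₑ *
      ‖∑ j ∈ s, l j * conv (dilate t (profileSchwartz n)) (f j) x‖ₑ ≤
        (∑' k, ‖poissonCoeff k‖₊ : ℝ≥0) * poissonMax f x := by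
    rw [← enorm_mul, h1, ENNReal.coe_tsum hS,
      ← ENNReal.tsum_mul_right]
    refine enorm_tsum_le_tsum_enorm.trans (ENNReal.tsum_le_tsum fun k => ?_)
    rw [enorm_mul]
    refine mul_le_mul' (le_of_eq ?_) ((enorm_sum_mul_le_ell2 _ l s hl).trans
      (le_iSup (fun t => ell2 fun j => poissonConv t (f j) x) (twoScale t k)))
    rw [enorm_eq_nnnorm, Complex.nnnorm_real]
  have hP : (poissonConst n : ℂ) ≠ 0 := by exact_mod_cast (poissonConst_pos n).ne'
  have hPn : ‖(poissonConst n : ℂ)‖₊ ≠ 0 := nnnorm_ne_zero_iff.2 hP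
  rw [ENNReal.coe_mul, ENNReal.coe_inv hPn, mul_assoc, mul_comm, ← div_eq_mul_inv,
    ENNReal.le_div_iff_mul_le (.inl (by exact_mod_cast hPn)) (.inl ENNReal.coe_ne_top), mul_comm]
  exact h2

theorem exists_weakLpNorm_smoothMax_le (n : ℕ) : ∃ Φ : 𝓢(Rn n, ℂ), ∫ x, Φ x = 1 ∧ ∃ C : ℝ≥0,
    ∀ p : ℝ, 0 < p → ∀ f : ℤ → 𝓢'(Rn n, ℂ),
      weakLpNorm p (smoothMax Φ f) ≤ C * weakHardyNorm p f := by
  set I := ∫ x, profileSchwartz n x with hI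
  set c : ℝ≥0 := ‖I⁻¹‖₊ * (‖(poissonConst n : ℂ)‖₊⁻¹ * ∑' k, ‖poissonCoeff k‖₊) with hc
  refine ⟨I⁻¹ • profileSchwartz n, ?_, c + 1, fun p hp f => ?_⟩
  · simp only [smul_apply, smul_eq_mul]
    rw [integral_const_mul, inv_mul_cancel₀ (integral_profileSchwartz_ne_zero n)]
  by_cases hf : ∀ j, IsBoundedDist (f j)
  swap
  · rw [weakHardyNorm, if_neg hf, ENNReal.mul_top (by simp)]
    exact le_top
  rw [weakHardyNorm, if_pos hf]
  refine (weakLpNorm_le_const_mul hp (C := c) fun x => ?_).trans (mul_le_mul' (ENNReal.coe_le_coe.2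
    le_self_add) le_rfl)
  refine iSup_le fun t => ?_
  rw [ell2_conv_dilate_smul, hc, ENNReal.coe_mul, mul_assoc]
  exact mul_le_mul' le_rfl (ell2_conv_profileSchwartz_le hf t x)

end WeakHardy

end

open WeakHardy in
theorem theoremt6p4p13 (n : ℕ) (hn : 0 < n) :
    -- (a)
    (∃ Φ : 𝓢(Rn n, ℂ), ∫ x, Φ x = 1 ∧ ∃ C₁ : ℝ≥0, ∀ p : ℝ, 0 < p →
      ∀ f : ℤ → 𝓢'(Rn n, ℂ),
        weakLpNorm p (smoothMax Φ f) ≤ C₁ * weakHardyNorm p f) ∧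
    -- (b)
    (∀ p : ℝ, 0 < p → ∀ a : ℝ, 0 < a → ∀ Φ : 𝓢(Rn n, ℂ), ∫ x, Φ x ≠ 0 →
      ∃ C₂ : ℝ≥0, ∀ f : ℤ → 𝓢'(Rn n, ℂ),
        weakLpNorm p (nontangMax a Φ f) ≤ C₂ * weakLpNorm p (smoothMax Φ f)) ∧
    -- (c)
    (∀ p : ℝ, 0 < p → ∀ a : ℝ, 0 < a → ∀ b : ℝ, (n : ℝ) / p < b → ∀ Φ : 𝓢(Rn n, ℂ),
      ∃ C₃ : ℝ≥0, ∀ f : ℤ → 𝓢'(Rn n, ℂ),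
        weakLpNorm p (auxMax b Φ f) ≤ C₃ * weakLpNorm p (nontangMax a Φ f)) ∧
    -- (d)
    (∀ b : ℝ, 0 < b → ∀ Φ : 𝓢(Rn n, ℂ), ∫ x, Φ x ≠ 0 →
      ∃ C₄ : ℝ≥0, ∀ p : ℝ, 0 < p → ∀ f : ℤ → 𝓢'(Rn n, ℂ),
        weakLpNorm p (grandMax (⌊b⌋₊ + 1) f) ≤ C₄ * weakLpNorm p (auxMax b Φ f)) ∧
    -- (e)
    (∀ N : ℕ, 0 < N → ∃ C₅ : ℝ≥0, ∀ p : ℝ, 0 < p → ∀ f : ℤ → 𝓢'(Rn n, ℂ),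
      weakLpNorm p (grandMax N f) < ∞ →
        IsBoundedSeq f ∧ MemWeakHardy p f ∧
          weakHardyNorm p f ≤ C₅ * weakLpNorm p (grandMax N f)) := by
  exact ⟨exists_weakLpNorm_smoothMax_le n,
    fun p hp a ha Φ hΦ => exists_weakLpNorm_nontangMax_le hn hp ha Φ hΦ,
    fun p hp a ha b hb Φ => exists_weakLpNorm_auxMax_le hn hp ha hb Φ,
    fun b hb Φ hΦ => exists_weakLpNorm_grandMax_le hb Φ hΦ,
    fun N _ => exists_weakHardyNorm_le n N⟩
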